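/- Fix $-1<\nu,\gamma<1$ and $T>0$, and let $w(x)=(1-x)^{\nu}(1+x)^{\gamma}$. Let $P_m=P_m^{(\nu,\gamma)}$ be the Jacobi polynomials and $h_m=\int_{-1}^{1}w\,P_m^2\,dx$. For an integer $k\ge 1$ and $n=1,\dots,2^{k-1}$ put $I_{k,n}=\left(\frac{n-1}{2^{k-1}}T,\frac{n}{2^{k-1}}T\right)$ and $w_{n,k}(t)=w\!\left(\frac{2^k}{T}t-2n+1\right)$, and let $w_k$ be the weight on $(0,T)$ that equals $w_{n,k}$ on $I_{k,n}$. The generalized Jacobi wavelets are $$\psi_{n,m}(t)=2^{k/2}\sqrt{\tfrac{1}{h_mT}}\;P_m\!\left(\tfrac{2^k}{T}t-2n+1\right)\quad\text{for } \tfrac{n-1}{2^{k-1}}T\le t<\tfrac{n}{2^{k-1}}T,$$ and $\psi_{n,m}(t)=0$ otherwise. Write $\|v\|_{L^2_{\omega}(a,b)}=\left(\int_a^b\omega v^2\,dt\right)^{1/2}$ and $\|v\|_{H^r_{\omega}(a,b)}=\left(\sum_{j=0}^r\|v^{(j)}\|^2_{L^2_{\omega}(a,b)}\right)^{1/2}$,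 with weak derivatives, and let $H^r_\omega(a,b)$ be the space of functions whose weak derivatives of orders $0,\dots,r$ on $(a,b)$ lie in $L^2_\omega(a,b)$. For $u\in L^2_{w_k}(0,T)$ let $$\Psi_{k,M}(u)=\sum_{n=1}^{2^{k-1}}\sum_{m=0}^{M}u_{n,m}\psi_{n,m},\qquad u_{n,m}=\int_0^Tw_k\,u\,\psi_{n,m}\,dt .$$ For $u\in H^\mu_{w_k}(0,T)$ and integers $0\le r\le\mu$ let $$|u|_{H^{r;\mu;M;k}_{w_k}(0,T)}=\left(\sum_{j=\min\{\mu,M+1\}}^{\mu}(2^k)^{2r-2j}\,\|u^{(j)}\|^2_{L^2_{w_k}(0,T)}\right)^{1/2}.$$ Since $\Psi_{k,M}(u)$ may jump at the break points, the norm of $u-\Psi_{k,M}(u)$ in $H^r_{w_k}(0,T)$ is understood piecewise: $\|v\|^2_{H^r_{w_k}(0,T)}=\sum_{n=1}^{2^{k-1}}\|v\|^2_{H^r_{w_{n,k}}(I_{k,n})}$. **Theorem.** For every integer $\mu\ge 0$ there is a constant $C>0$, depending only on $\nu,\gamma,T,\mu$, such that for all integers $k\ge1$ and $M\ge1$ and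 all $u\in H^\mu_{w_k}(0,T)$ the function $\Psi_{k,M}(u)$ is a best approximation of $u$ in $L^2_{w_k}(0,T)$ from the span of the $\psi_{n,m}$, $1\le n\le 2^{k-1}$, $0\le m\le M$; the error $u-\Psi_{k,M}(u)$ belongs to $L^2_{w_k}(0,T)$ and to $H^\mu_{w_{n,k}}(I_{k,n})$ for every $n$; and $$\|u-\Psi_{k,M}(u)\|_{L^2_{w_k}(0,T)}\le C\,M^{-\mu}\,|u|_{H^{0;\mu;M;k}_{w_k}(0,T)},$$ and, for $1\le r\le\mu$, $$\|u-\Psi_{k,M}(u)\|_{H^r_{w_k}(0,T)}\le C\,M^{2r-\frac12-\mu}\,|u|_{H^{r;\mu;M;k}_{w_k}(0,T)}.$$ If moreover $M\ge\mu-1$, then $|u|_{H^{r;\mu;M;k}_{w_k}(0,T)}=(2^k)^{r-\mu}\|u^{(\mu)}\|_{L^2_{w_k}(0,T)}$ for $0\le r\le\mu$, and hence $$\|u-\Psi_{k,M}(u)\|_{L^2_{w_k}(0,T)}\le C\,M^{-\mu}2^{-\mu k}\,\|u^{(\mu)}\|_{L^2_{w_k}(0,T)}$$ and, for $1\le r\le\mu$,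 $$\|u-\Psi_{k,M}(u)\|_{H^r_{w_k}(0,T)}\le C\,M^{2r-\frac12-\mu}(2^k)^{r-\mu}\,\|u^{(\mu)}\|_{L^2_{w_k}(0,T)}.$$ -/

import Mathlib

open MeasureTheory Set
open scoped ContDiff

namespace JacobiWavelet

noncomputable section

/-! ### Weighted Lebesgue and Sobolev spaces on an interval -/

/-- Membership in `L²_w(a,b)`: measurable functions with `w f²` Lebesgue integrable on `(a,b)`. -/
def MemL2 (w : ℝ → ℝ) (a b : ℝ) (f : ℝ → ℝ) : Prop :=
  AEStronglyMeasurable f (volume.restrict (Ioo a b)) ∧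
    IntegrableOn (fun t => w t * f t ^ 2) (Ioo a b)

/-- The norm `(∫_a^b w f²)^{1/2}` of `L²_w(a,b)`. -/
def l2Norm (w : ℝ → ℝ) (a b : ℝ) (f : ℝ → ℝ) : ℝ :=
  Real.sqrt (∫ t in Ioo a b, w t * f t ^ 2)

/-- `g` is a weak (distributional) derivative of order `j` of `f` on the open interval `(a,b)`. -/
def IsWeakDeriv (a b : ℝ) (j : ℕ) (f g : ℝ → ℝ) : Prop :=
  LocallyIntegrableOn f (Ioo a b) ∧ LocallyIntegrableOn g (Ioo a b) ∧
    ∀ φ : ℝ → ℝ, ContDiff ℝ ∞ φ → HasCompactSupport φ → tsupport φ ⊆ Ioo a b →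
      ∫ t in Ioo a b, f t * iteratedDeriv j φ t = (-1) ^ j * ∫ t in Ioo a b, g t * φ t

open Classical in
/-- A representative of the weak derivative `f^{(j)}` on `(a,b)` (it is unique up to null sets),
and `0` if `f` has no weak derivative of order `j`. -/
def weakDeriv (a b : ℝ) (j : ℕ) (f : ℝ → ℝ) : ℝ → ℝ :=
  if h : ∃ g, IsWeakDeriv a b j f g then h.choose else 0

/-- Membership in `H^r_w(a,b)`: the weak derivatives of all orders `0 ≤ j ≤ r` exist and lie in
`L²_w(a,b)` (the one of order `0` is `f` itself, up to null sets). -/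
def MemSobolev (w : ℝ → ℝ) (a b : ℝ) (r : ℕ) (f : ℝ → ℝ) : Prop :=
  ∀ j ≤ r, ∃ g, IsWeakDeriv a b j f g ∧ MemL2 w a b g

/-- The norm of `H^r_w(a,b)`. -/
def sobolevNorm (w : ℝ → ℝ) (a b : ℝ) (r : ℕ) (f : ℝ → ℝ) : ℝ :=
  Real.sqrt (∑ j ∈ Finset.range (r + 1), l2Norm w a b (weakDeriv a b j f) ^ 2)

/-! ### Jacobi polynomials -/

/-- The Jacobi weight `(1-t)^ν (1+t)^γ`. -/
def jacobiWeight (ν γ : ℝ) (t : ℝ) : ℝ := (1 - t) ^ ν * (1 + t) ^ γ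

/-- The Jacobi polynomial `P_i^{(ν,γ)}` in its standard normalization, written as
`∑_{s ≤ i} (ν+γ+i+1)_s (ν+s+1)_{i-s} / (s! (i-s)!) * ((t-1)/2)^s`, with rising factorials. -/
def jacobiP (ν γ : ℝ) (i : ℕ) (t : ℝ) : ℝ :=
  ∑ s ∈ Finset.range (i + 1),
    (ascPochhammer ℝ s).eval (ν + γ + i + 1) * (ascPochhammer ℝ (i - s)).eval (ν + s + 1) /
      ((s.factorial : ℝ) * ((i - s).factorial : ℝ)) * ((t - 1) / 2) ^ s

/-- The normalization constant `h_i = ∫_{-1}^1 w P_i²` of the orthogonality relation. -/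
def jacobiH (ν γ : ℝ) (i : ℕ) : ℝ :=
  ∫ t in Ioo (-1 : ℝ) 1, jacobiWeight ν γ t * jacobiP ν γ i t ^ 2

/-! ### Jacobi wavelets on `[0,T)` at resolution level `k ≥ 1`

The subintervals are indexed by `n = 1, …, 2^(k-1)`. -/

/-- Left end point `(n-1) T / 2^(k-1)` of the `n`-th subinterval. -/
def leftPt (T : ℝ) (k n : ℕ) : ℝ := ((n : ℝ) - 1) / 2 ^ (k - 1) * T

/-- Right end point `n T / 2^(k-1)` of the `n`-th subinterval. -/
def rightPt (T : ℝ) (k n : ℕ) : ℝ := (n : ℝ) / 2 ^ (k - 1) * T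

/-- The affine change of variable `2^k t / T - 2n + 1`, from the `n`-th subinterval to `[-1,1)`. -/
def localVar (T : ℝ) (k n : ℕ) (t : ℝ) : ℝ := 2 ^ k / T * t - 2 * n + 1

/-- The local weight `w_{n,k}`. -/
def localWeight (ν γ T : ℝ) (k n : ℕ) (t : ℝ) : ℝ := jacobiWeight ν γ (localVar T k n t)

/-- The weight `w_k`, equal to `w_{n,k}` on the `n`-th subinterval. -/
def waveletWeight (ν γ T : ℝ) (k : ℕ) (t : ℝ) : ℝ :=
  ∑ n ∈ Finset.Icc 1 (2 ^ (k - 1)),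
    (Ico (leftPt T k n) (rightPt T k n)).indicator (localWeight ν γ T k n) t

/-- The generalized Jacobi wavelet `ψ_{n,m}`. -/
def wavelet (ν γ T : ℝ) (k n m : ℕ) : ℝ → ℝ :=
  (Ico (leftPt T k n) (rightPt T k n)).indicator fun t =>
    (2 : ℝ) ^ ((k : ℝ) / 2) * Real.sqrt (1 / (jacobiH ν γ m * T)) *
      jacobiP ν γ m (localVar T k n t)

/-- The coefficient `u_{n,m} = ⟨u, ψ_{n,m}⟩_{w_k}`. -/
def waveletCoeff (ν γ T : ℝ) (k : ℕ) (u : ℝ → ℝ) (n m : ℕ) : ℝ :=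
  ∫ t in Ioo 0 T, waveletWeight ν γ T k t * u t * wavelet ν γ T k n m t

/-- The linear combination of the wavelets of level `k` and degree at most `M` with
coefficients `c n m`. -/
def waveletSum (ν γ T : ℝ) (k M : ℕ) (c : ℕ → ℕ → ℝ) (t : ℝ) : ℝ :=
  ∑ n ∈ Finset.Icc 1 (2 ^ (k - 1)), ∑ m ∈ Finset.range (M + 1), c n m * wavelet ν γ T k n m t

/-- The truncated Jacobi wavelet expansion `Ψ_{k,M}(u)`. -/
def waveletApprox (ν γ T : ℝ) (k M : ℕ) (u : ℝ → ℝ) : ℝ → ℝ :=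
  waveletSum ν γ T k M (waveletCoeff ν γ T k u)

/-- Membership in the piecewise Sobolev space: the restriction to each open subinterval
`I_{k,n}` lies in `H^r_{w_{n,k}}(I_{k,n})`. -/
def MemBrokenSobolev (ν γ T : ℝ) (k r : ℕ) (f : ℝ → ℝ) : Prop :=
  ∀ n ∈ Finset.Icc 1 (2 ^ (k - 1)),
    MemSobolev (localWeight ν γ T k n) (leftPt T k n) (rightPt T k n) r f

/-- The piecewise `H^r_{w_k}` norm, `(∑_n ‖f‖²_{H^r_{w_{n,k}}(I_{k,n})})^{1/2}`. This is how the
`H^r_{w_k}(0,T)` norm of a function with jumps at the break points is meant. -/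
def brokenSobolevNorm (ν γ T : ℝ) (k r : ℕ) (f : ℝ → ℝ) : ℝ :=
  Real.sqrt (∑ n ∈ Finset.Icc 1 (2 ^ (k - 1)),
    sobolevNorm (localWeight ν γ T k n) (leftPt T k n) (rightPt T k n) r f ^ 2)

/-- The scaled seminorm `|u|_{H^{r;μ;M;k}_{w_k}(0,T)}`. -/
def waveletSeminorm (ν γ T : ℝ) (k r μ M : ℕ) (u : ℝ → ℝ) : ℝ :=
  Real.sqrt (∑ j ∈ Finset.Icc (min μ (M + 1)) μ,
    ((2 : ℝ) ^ k) ^ (2 * (r : ℤ) - 2 * (j : ℤ)) *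
      l2Norm (waveletWeight ν γ T k) 0 T (weakDeriv 0 T j u) ^ 2)

end

end JacobiWavelet

open JacobiWavelet

namespace JacobiWavelet

open Polynomial (C X)

noncomputable section

/-! ### Primitives and integration by parts on an interval -/

/-! The affine map of `I_{k,n}` onto `(-1,1)` turns the wavelets into normalized Jacobi polynomials,
so on each subinterval the truncated expansion is the `L²_w`-orthogonal projection of the
transplanted function onto polynomials of degree at most `M` (`waveletPoly_waveletCoeff`). Best
approximation follows at once. The estimates reduce to the reference interval: a derivative of order
`j` scales by `(2^k/T)^j`, the Jacobian cancels between the two sides, and the squares are summed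
over `n`.

On the reference interval the `L²` rate comes from the Sturm–Liouville form of the Jacobi equation.
If `e` is orthogonal to polynomials of degree below `m`, then `λ_m ‖e‖² ≤ ‖e'‖²` with the weight
multiplied by `1-x²` on the right, where `λ_m` grows like `m²` (`PolyOrth.eigen_mul_sq_le`).
Moreover `e'` is orthogonal, for that raised weight, to polynomials of degree below `m-1`
(`PolyOrth.of_isPrimitive`). Iterating `μ` times gains `m^{-μ}`, and the raised weights are bounded
by the original one.

For derivatives let `P` be the projection. The error `f' - (Pf)'` is `(f' - Pf') + (Pf' - (Pf)')`.
The first summand is an error of the same kind for `f'`, which has one derivative fewer. The second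
is a polynomial whose antiderivative involves only two Jacobi polynomials besides a constant; for
such polynomials the original norm exceeds the raised one by at most a factor of order `√M`
(`exists_norm_le_of_polyOrth_add_one`). This uses `‖J_n'‖² ≤ K n³ ‖J_n‖²`, a Rellich identity,
against `‖J_n'‖² = λ_n ‖J_n‖²` in the raised weight. So the first derivative of the error is of
order `M^{3/2-μ}`, and each further derivative costs `M²` by Markov's inequality. This is the
exponent `2r - 1/2 - μ`.

The bounds `ν, γ < 1` put `L²_w` inside `L¹`. Weak derivatives are then integrable up to the end
points, functions are primitives of them, and integration by parts against the raised weight, which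
vanishes at `±1`, leaves no boundary terms. When `M + 1 < μ`, only `M + 1` derivatives are used; `M`
is then bounded in terms of `μ`, so the missing powers of `M` go into the constant. -/

/-- `f` agrees almost everywhere on `(a,b)` with a primitive of the integrable function `g`. -/
def IsPrimitive (a b : ℝ) (f g : ℝ → ℝ) : Prop :=
  IntegrableOn g (Ioo a b) ∧
    ∃ c : ℝ, ∀ᵐ x ∂volume.restrict (Ioo a b), f x = c + ∫ y in a..x, g y

lemma intervalIntegrable_of_integrableOn_Ioo {a b : ℝ} (hab : a ≤ b) {g : ℝ → ℝ}
    (hg : IntegrableOn g (Ioo a b)) : IntervalIntegrable g volume a b := by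
  rwa [intervalIntegrable_iff_integrableOn_Ioo_of_le hab]

/-- Both factors are absolutely continuous, `Φ` being itself the primitive of `φ`. The boundary
terms vanish with `Φ`, and the constant of integration of `f` contributes a multiple of `∫ φ = 0`.
Only integrability of `φ` is asked, because the Jacobi weight may blow up at `±1`. -/
lemma IsPrimitive.integral_mul_deriv {a b : ℝ} (hab : a ≤ b) {f g Φ φ : ℝ → ℝ}
    (hfg : IsPrimitive a b f g) (hΦ : ContinuousOn Φ (Icc a b)) (hΦa : Φ a = 0) (hΦb : Φ b = 0)
    (hd : ∀ x ∈ Ioo a b, HasDerivAt Φ (φ x) x) (hφ : IntegrableOn φ (Ioo a b)) :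
    ∫ x in Ioo a b, f x * φ x = -∫ x in Ioo a b, g x * Φ x := by
  obtain ⟨hg, c, hc⟩ := hfg
  have hgI := intervalIntegrable_of_integrableOn_Ioo hab hg
  have hφI := intervalIntegrable_of_integrableOn_Ioo hab hφ
  have hΦint : ∀ x ∈ Icc a b, Φ x = ∫ y in a..x, φ y := by
    intro x hx
    have := intervalIntegral.integral_eq_sub_of_hasDerivAt_of_le hx.1
      (hΦ.mono (Icc_subset_Icc_right hx.2)) (fun y hy => hd y ⟨hy.1, hy.2.trans_le hx.2⟩)
      (hφI.mono_set (by rw [uIcc_of_le hx.1, uIcc_of_le hab]; exact Icc_subset_Icc_right hx.2))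
    rw [this, hΦa, sub_zero]
  have hFc := hgI.absolutelyContinuousOnInterval_intervalIntegral (c := a) (by simp)
  have hΦc := hφI.absolutelyContinuousOnInterval_intervalIntegral (c := a) (by simp)
  have key := hFc.integral_mul_deriv_eq_deriv_mul hΦc
  have e0 : ∫ y in a..b, φ y = 0 := by rw [← hΦint b ⟨hab, le_rfl⟩, hΦb]
  simp only [intervalIntegral.integral_same, e0, mul_zero, sub_zero, zero_sub] at key
  have e1 : ∫ x in a..b, (∫ y in a..x, g y) * deriv (fun x => ∫ y in a..x, φ y) x
      = ∫ x in a..b, (∫ y in a..x, g y) * φ x := by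
    apply intervalIntegral.integral_congr_ae
    filter_upwards [hφI.ae_hasDerivAt_integral] with x hx hx'
    rw [(hx (uIoc_subset_uIcc hx') a (by simp)).deriv]
  have e2 : ∫ x in a..b, deriv (fun x => ∫ y in a..x, g y) x * (∫ y in a..x, φ y)
      = ∫ x in a..b, g x * Φ x := by
    apply intervalIntegral.integral_congr_ae
    filter_upwards [hgI.ae_hasDerivAt_integral] with x hx hx'
    have hx2 := uIoc_subset_uIcc hx'
    rw [(hx hx2 a (by simp)).deriv, hΦint x (by rwa [uIcc_of_le hab] at hx2)]
  rw [e1, e2] at key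
  have e3 : ∫ x in Ioo a b, f x * φ x = ∫ x in a..b, (c + ∫ y in a..x, g y) * φ x := by
    rw [intervalIntegral.integral_of_le hab, integral_Ioc_eq_integral_Ioo]
    apply integral_congr_ae
    filter_upwards [hc] with x hx
    rw [hx]
  rw [e3, ← integral_Ioc_eq_integral_Ioo, ← intervalIntegral.integral_of_le hab, ← key]
  simp only [add_mul]
  rw [intervalIntegral.integral_add (hφI.const_mul c) (hφI.continuousOn_mul hFc.continuousOn),
    intervalIntegral.integral_const_mul, e0, mul_zero, zero_add]

lemma IsPrimitive.sub {a b : ℝ} (hab : a ≤ b) {f g f' g' : ℝ → ℝ} (h : IsPrimitive a b f g)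
    (h' : IsPrimitive a b f' g') :
    IsPrimitive a b (fun x => f x - f' x) (fun x => g x - g' x) := by
  obtain ⟨hg, c, hc⟩ := h
  obtain ⟨hg', c', hc'⟩ := h'
  refine ⟨hg.sub hg', c - c', ?_⟩
  filter_upwards [hc, hc', ae_restrict_mem measurableSet_Ioo] with x hx hx' hxI
  have hs : uIcc a x ⊆ uIcc a b := by
    rw [uIcc_of_le hxI.1.le, uIcc_of_le hab]; exact Icc_subset_Icc_right hxI.2.le
  rw [hx, hx', intervalIntegral.integral_sub
    ((intervalIntegrable_of_integrableOn_Ioo hab hg).mono_set hs)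
    ((intervalIntegrable_of_integrableOn_Ioo hab hg').mono_set hs)]
  ring

lemma IsPrimitive.of_hasDerivAt {a b : ℝ} {f g : ℝ → ℝ} (hg : Continuous g)
    (hd : ∀ x, HasDerivAt f (g x) x) : IsPrimitive a b f g := by
  refine ⟨(hg.integrableOn_Icc).mono_set Ioo_subset_Icc_self, f a, ae_of_all _ fun x => ?_⟩
  rw [intervalIntegral.integral_eq_sub_of_hasDerivAt (fun y _ => hd y)
    (hg.intervalIntegrable _ _)]
  ring

lemma isPrimitive_eval (a b : ℝ) (p : Polynomial ℝ) :
    IsPrimitive a b (fun x => p.eval x) (fun x => p.derivative.eval x) :=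
  .of_hasDerivAt p.derivative.continuous fun x => p.hasDerivAt x

/-! ### The Jacobi weight -/

lemma jacobiWeight_pos (a b : ℝ) {x : ℝ} (hx : x ∈ Ioo (-1 : ℝ) 1) : 0 < jacobiWeight a b x :=
  mul_pos (Real.rpow_pos_of_pos (by linarith [hx.2]) _)
    (Real.rpow_pos_of_pos (by linarith [hx.1]) _)

@[fun_prop]
lemma measurable_jacobiWeight (a b : ℝ) : Measurable (jacobiWeight a b) := by
  unfold jacobiWeight
  fun_prop

lemma jacobiWeight_add_one (a b : ℝ) {x : ℝ} (hx : x ∈ Ioo (-1 : ℝ) 1) :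
    jacobiWeight (a + 1) (b + 1) x = jacobiWeight a b x * (1 - x ^ 2) := by
  have h1 : 0 < 1 - x := by linarith [hx.2]
  have h2 : 0 < 1 + x := by linarith [hx.1]
  rw [jacobiWeight, jacobiWeight, Real.rpow_add_one h1.ne', Real.rpow_add_one h2.ne']
  ring

/-- Splitting at `0` leaves one possibly singular factor on each half, the other being continuous
there. -/
lemma integrableOn_jacobiWeight {a b : ℝ} (ha : -1 < a) (hb : -1 < b) :
    IntegrableOn (jacobiWeight a b) (Ioo (-1) 1) := by
  have h1 : IntervalIntegrable (fun x : ℝ => (1 - x) ^ a) volume 0 1 := by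
    have := (intervalIntegral.intervalIntegrable_rpow' (a := 0) (b := 1) ha).comp_sub_left 1
    simpa using this.symm
  have h2 : IntervalIntegrable (fun x : ℝ => (1 + x) ^ b) volume (-1) 0 := by
    have := (intervalIntegral.intervalIntegrable_rpow' (a := 0) (b := 1) hb).comp_add_left 1
    simpa using this
  have h3 : IntervalIntegrable (jacobiWeight a b) volume 0 1 := by
    refine h1.mul_continuousOn (g := fun x : ℝ => (1 + x) ^ b) ?_
    intro x hx
    rw [uIcc_of_le zero_le_one] at hx
    exact ((continuousAt_const.add continuousAt_id).rpow_const
      (Or.inl (by simp; linarith [hx.1]))).continuousWithinAt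
  have h4 : IntervalIntegrable (jacobiWeight a b) volume (-1) 0 := by
    refine h2.continuousOn_mul (g := fun x : ℝ => (1 - x) ^ a) ?_
    intro x hx
    rw [uIcc_of_le (by norm_num)] at hx
    exact ((continuousAt_const.sub continuousAt_id).rpow_const
      (Or.inl (by simp; linarith [hx.2]))).continuousWithinAt
  exact (intervalIntegrable_iff_integrableOn_Ioo_of_le (by norm_num)).1 (h4.trans h3)

/-- The polynomial `τ = b - a - (a+b+2) x`, for which `((1-x²) w)' = τ w`. -/
def jacobiTau (a b : ℝ) : Polynomial ℝ := C (b - a) - C (a + b + 2) * X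

/-- Pearson's equation for the weight: raising both exponents by one multiplies it by `1-x²`, and
differentiating brings it back to the original weight times a polynomial. -/
lemma hasDerivAt_jacobiWeight_mul (a b : ℝ) (s : Polynomial ℝ) {x : ℝ}
    (hx : x ∈ Ioo (-1 : ℝ) 1) :
    HasDerivAt (fun x => jacobiWeight (a + 1) (b + 1) x * s.eval x)
      (jacobiWeight a b x * (jacobiTau a b * s + (1 - X ^ 2) * s.derivative).eval x) x := by
  have h1 : 0 < 1 - x := by linarith [hx.2]
  have h2 : 0 < 1 + x := by linarith [hx.1]
  have d1 : HasDerivAt (fun x : ℝ => (1 - x) ^ (a + 1)) (-1 * (a + 1) * (1 - x) ^ (a + 1 - 1)) x :=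
    ((hasDerivAt_id x).const_sub 1).rpow_const (Or.inl h1.ne')
  have d2 : HasDerivAt (fun x : ℝ => (1 + x) ^ (b + 1)) (1 * (b + 1) * (1 + x) ^ (b + 1 - 1)) x :=
    ((hasDerivAt_id x).const_add 1).rpow_const (Or.inl h2.ne')
  convert! (d1.mul d2).mul (s.hasDerivAt x) using 1
  simp only [jacobiWeight, jacobiTau, add_sub_cancel_right, Pi.mul_apply,
    Real.rpow_add_one h1.ne', Real.rpow_add_one h2.ne',
    Polynomial.eval_add, Polynomial.eval_mul, Polynomial.eval_sub, Polynomial.eval_C,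
    Polynomial.eval_X, Polynomial.eval_one, Polynomial.eval_pow]
  ring

/-- Integration by parts against the Jacobi weight. -/
lemma IsPrimitive.integral_jacobiWeight {a b : ℝ} (ha : -1 < a) (hb : -1 < b) {f g : ℝ → ℝ}
    (hfg : IsPrimitive (-1) 1 f g) (s : Polynomial ℝ) :
    ∫ x in Ioo (-1 : ℝ) 1, jacobiWeight a b x *
        (f x * (jacobiTau a b * s + (1 - X ^ 2) * s.derivative).eval x) =
      -∫ x in Ioo (-1 : ℝ) 1, jacobiWeight (a + 1) (b + 1) x * (g x * s.eval x) := by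
  have hI : IntegrableOn (fun x => jacobiWeight a b x *
      (jacobiTau a b * s + (1 - X ^ 2) * s.derivative).eval x) (Ioo (-1) 1) := by
    have h := (intervalIntegrable_of_integrableOn_Ioo (by norm_num)
      (integrableOn_jacobiWeight ha hb)).mul_continuousOn
      (jacobiTau a b * s + (1 - X ^ 2) * s.derivative).continuousOn
    exact (intervalIntegrable_iff_integrableOn_Ioo_of_le (by norm_num)).1 h
  have hc : ContinuousOn (fun x => jacobiWeight (a + 1) (b + 1) x * s.eval x) (Icc (-1) 1) := by
    have h1 : Continuous fun x : ℝ => (1 - x) ^ (a + 1) :=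
      (continuous_const.sub continuous_id).rpow_const fun _ => Or.inr (by linarith)
    have h2 : Continuous fun x : ℝ => (1 + x) ^ (b + 1) :=
      (continuous_const.add continuous_id).rpow_const fun _ => Or.inr (by linarith)
    exact ((h1.mul h2).mul s.continuous).continuousOn
  -- The raised exponents are positive, so the function integrated by parts vanishes at both end
  -- points.
  have := hfg.integral_mul_deriv (by norm_num) hc
    (by simp [jacobiWeight, Real.zero_rpow (by linarith : b + 1 ≠ 0)])
    (by simp [jacobiWeight, Real.zero_rpow (by linarith : a + 1 ≠ 0)])
    (fun x hx => hasDerivAt_jacobiWeight_mul a b s hx) hI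
  simp only [mul_left_comm (f _), mul_left_comm (g _)] at this
  exact this

end

end JacobiWavelet

namespace JacobiWavelet

open Polynomial (C X)
open scoped RealInnerProductSpace

noncomputable section

/-! ### The weighted `L²` space on `(-1,1)` as a Hilbert space -/

/-- The measure with density the Jacobi weight on `(-1,1)`. -/
def jacobiMeasure (a b : ℝ) : Measure ℝ :=
  (volume.restrict (Ioo (-1) 1)).withDensity fun x => ENNReal.ofReal (jacobiWeight a b x)

lemma integral_jacobiMeasure (a b : ℝ) (f : ℝ → ℝ) :
    ∫ x, f x ∂jacobiMeasure a b = ∫ x in Ioo (-1 : ℝ) 1, jacobiWeight a b x * f x := by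
  rw [jacobiMeasure, integral_withDensity_eq_integral_toReal_smul (by fun_prop) (by simp)]
  refine setIntegral_congr_fun measurableSet_Ioo fun x hx => ?_
  simp [ENNReal.toReal_ofReal (jacobiWeight_pos a b hx).le]

lemma integrable_jacobiMeasure_iff (a b : ℝ) (f : ℝ → ℝ) :
    Integrable f (jacobiMeasure a b) ↔
      IntegrableOn (fun x => jacobiWeight a b x * f x) (Ioo (-1) 1) := by
  rw [jacobiMeasure, integrable_withDensity_iff_integrable_smul' (by fun_prop) (by simp)]
  refine integrable_congr ?_
  filter_upwards [ae_restrict_mem measurableSet_Ioo] with x hx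
  simp [ENNReal.toReal_ofReal (jacobiWeight_pos a b hx).le]

lemma jacobiMeasure_absolutelyContinuous (a b : ℝ) :
    jacobiMeasure a b ≪ volume.restrict (Ioo (-1) 1) :=
  withDensity_absolutelyContinuous _ _

lemma absolutelyContinuous_jacobiMeasure (a b : ℝ) :
    volume.restrict (Ioo (-1) 1) ≪ jacobiMeasure a b := by
  refine withDensity_absolutelyContinuous' (by fun_prop) ?_
  filter_upwards [ae_restrict_mem measurableSet_Ioo] with x hx
  simpa using jacobiWeight_pos a b hx

lemma memLp_jacobiMeasure_iff (a b : ℝ) (f : ℝ → ℝ) :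
    MemLp f 2 (jacobiMeasure a b) ↔ MemL2 (jacobiWeight a b) (-1) 1 f := by
  constructor
  · intro h
    have h1 := h.aestronglyMeasurable
    refine ⟨h1.mono_ac (absolutelyContinuous_jacobiMeasure a b), ?_⟩
    exact (integrable_jacobiMeasure_iff a b _).1 ((memLp_two_iff_integrable_sq h1).1 h)
  · intro h
    refine (memLp_two_iff_integrable_sq
      (h.1.mono_ac (jacobiMeasure_absolutelyContinuous a b))).2 ?_
    exact (integrable_jacobiMeasure_iff a b _).2 h.2

lemma isFiniteMeasure_jacobiMeasure {a b : ℝ} (ha : -1 < a) (hb : -1 < b) :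
    IsFiniteMeasure (jacobiMeasure a b) := by
  have : Integrable (fun _ => (1 : ℝ)) (jacobiMeasure a b) := by
    rw [integrable_jacobiMeasure_iff]
    simpa using integrableOn_jacobiWeight ha hb
  simpa [integrable_const_iff] using this

lemma ae_jacobiMeasure_mem (a b : ℝ) : ∀ᵐ x ∂jacobiMeasure a b, x ∈ Ioo (-1 : ℝ) 1 :=
  (jacobiMeasure_absolutelyContinuous a b).ae_le (ae_restrict_mem measurableSet_Ioo)

lemma memLp_of_continuous {a b : ℝ} (ha : -1 < a) (hb : -1 < b) {f : ℝ → ℝ}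
    (hf : Continuous f) : MemLp f 2 (jacobiMeasure a b) := by
  have := isFiniteMeasure_jacobiMeasure ha hb
  obtain ⟨K, hK⟩ := (isCompact_Icc (a := (-1 : ℝ)) (b := 1)).exists_bound_of_continuousOn
    hf.continuousOn
  refine MemLp.of_bound hf.aestronglyMeasurable K ?_
  filter_upwards [ae_jacobiMeasure_mem a b] with x hx using hK x (Ioo_subset_Icc_self hx)

/-- The space `L²_w(-1,1)` for the Jacobi weight. -/
abbrev JacobiL2 (a b : ℝ) := Lp ℝ 2 (jacobiMeasure a b)

lemma inner_toLp {a b : ℝ} {f g : ℝ → ℝ} (hf : MemLp f 2 (jacobiMeasure a b))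
    (hg : MemLp g 2 (jacobiMeasure a b)) :
    ⟪hf.toLp f, hg.toLp g⟫ = ∫ x in Ioo (-1 : ℝ) 1, jacobiWeight a b x * (f x * g x) := by
  rw [L2.inner_def, ← integral_jacobiMeasure]
  refine integral_congr_ae ?_
  filter_upwards [hf.coeFn_toLp, hg.coeFn_toLp] with x h1 h2
  simp [h1, h2, mul_comm]

lemma norm_toLp_sq {a b : ℝ} {f : ℝ → ℝ} (hf : MemLp f 2 (jacobiMeasure a b)) :
    ‖hf.toLp f‖ ^ 2 = ∫ x in Ioo (-1 : ℝ) 1, jacobiWeight a b x * f x ^ 2 := by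
  rw [← real_inner_self_eq_norm_sq, inner_toLp]
  simp only [sq]

/-- Polynomials as elements of `L²_w(-1,1)`. -/
def polyL2 {a b : ℝ} (ha : -1 < a) (hb : -1 < b) : Polynomial ℝ →ₗ[ℝ] JacobiL2 a b where
  toFun p := (memLp_of_continuous ha hb p.continuous).toLp _
  map_add' p q := by
    rw [← MemLp.toLp_add]
    exact MemLp.toLp_congr _ _ (ae_of_all _ fun x => by simp)
  map_smul' c p := by
    rw [RingHom.id_apply, ← MemLp.toLp_const_smul]
    exact MemLp.toLp_congr _ _ (ae_of_all _ fun x => by simp)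

lemma inner_polyL2_toLp {a b : ℝ} (ha : -1 < a) (hb : -1 < b) (p : Polynomial ℝ) {f : ℝ → ℝ}
    (hf : MemLp f 2 (jacobiMeasure a b)) :
    ⟪polyL2 ha hb p, hf.toLp f⟫ =
      ∫ x in Ioo (-1 : ℝ) 1, jacobiWeight a b x * (f x * p.eval x) := by
  rw [polyL2, LinearMap.coe_mk, AddHom.coe_mk, inner_toLp]
  simp only [mul_comm (f _)]

lemma inner_polyL2 {a b : ℝ} (ha : -1 < a) (hb : -1 < b) (p q : Polynomial ℝ) :
    ⟪polyL2 ha hb p, polyL2 ha hb q⟫ =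
      ∫ x in Ioo (-1 : ℝ) 1, jacobiWeight a b x * (p * q).eval x := by
  rw [polyL2, LinearMap.coe_mk, AddHom.coe_mk, inner_toLp]
  simp only [Polynomial.eval_mul]

lemma polyL2_injective {a b : ℝ} (ha : -1 < a) (hb : -1 < b) :
    Function.Injective (polyL2 ha hb) := by
  rw [injective_iff_map_eq_zero]
  intro p hp
  have hm := memLp_of_continuous ha hb p.continuous
  have h : (fun x => p.eval x) =ᵐ[jacobiMeasure a b] (0 : ℝ → ℝ) := by
    refine hm.coeFn_toLp.symm.trans ?_
    rw [show hm.toLp _ = polyL2 ha hb p from rfl, hp]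
    exact Lp.coeFn_zero _ _ _
  have h2 : (fun x => p.eval x) =ᵐ[volume.restrict (Ioo (-1) 1)] (0 : ℝ → ℝ) :=
    (absolutelyContinuous_jacobiMeasure a b).ae_le h
  have h3 : EqOn (fun x => p.eval x) 0 (Ioo (-1) 1) :=
    Measure.eqOn_open_of_ae_eq h2 isOpen_Ioo p.continuousOn continuousOn_const
  exact p.eq_zero_of_infinite_isRoot ((Ioo_infinite (by norm_num : (-1 : ℝ) < 1)).mono
    fun x hx => h3 hx)

/-- Polynomials are dense in `L²_w(-1,1)`. -/
lemma exists_norm_sub_polyL2_lt {a b : ℝ} (ha : -1 < a) (hb : -1 < b) (f : JacobiL2 a b)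
    {ε : ℝ} (hε : 0 < ε) : ∃ p : Polynomial ℝ, ‖f - polyL2 ha hb p‖ < ε := by
  have := isFiniteMeasure_jacobiMeasure ha hb
  -- `A`, the square root of the total mass, converts the uniform error of Weierstrass approximation
  -- into an `L²` error. Bounded continuous functions provide the intermediate approximation; `A +
  -- 1` avoids a division by zero.
  set A : ℝ := Real.sqrt ((jacobiMeasure a b).real univ) with hA
  obtain ⟨g, hg, hgm⟩ := (Lp.memLp f).exists_boundedContinuous_eLpNorm_sub_le (by simp)
    (ε := ENNReal.ofReal (ε / 2)) (by simpa using hε)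
  obtain ⟨p, hp⟩ := exists_polynomial_near_of_continuousOn (-1) 1 g g.continuous.continuousOn
    (ε / (2 * (A + 1))) (by positivity)
  refine ⟨p, ?_⟩
  have hpm := memLp_of_continuous ha hb p.continuous
  have e1 : ‖f - hgm.toLp g‖ ≤ ε / 2 := by
    have : f - hgm.toLp g = ((Lp.memLp f).sub hgm).toLp _ := by
      rw [MemLp.toLp_sub (Lp.memLp f) hgm, Lp.toLp_coeFn]
    rw [this, Lp.norm_toLp]
    exact ENNReal.toReal_le_of_le_ofReal (by positivity) hg
  have e2 : ‖hgm.toLp g - polyL2 ha hb p‖ ≤ A * (ε / (2 * (A + 1))) := by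
    have h1 : hgm.toLp g - polyL2 ha hb p = (hgm.sub hpm).toLp _ := by
      rw [MemLp.toLp_sub hgm hpm]; rfl
    refine (sq_le_sq₀ (norm_nonneg _) (by positivity)).1 ?_
    rw [h1, norm_toLp_sq, ← integral_jacobiMeasure, mul_pow, hA,
      Real.sq_sqrt measureReal_nonneg]
    calc _ ≤ ∫ _, (ε / (2 * (A + 1))) ^ 2 ∂jacobiMeasure a b := by
          refine integral_mono_ae ((hgm.sub hpm).integrable_sq) (integrable_const _) ?_
          filter_upwards [ae_jacobiMeasure_mem a b] with x hx
          have := hp x (Ioo_subset_Icc_self hx)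
          rw [abs_sub_comm] at this
          exact sq_le_sq' (abs_lt.1 this).1.le (abs_lt.1 this).2.le
      _ = _ := by simp [hA]
  have e3 : A * (ε / (2 * (A + 1))) < ε / 2 := by
    have : 0 ≤ A := Real.sqrt_nonneg _
    rw [mul_div_assoc', div_lt_div_iff₀ (by positivity) (by positivity)]
    nlinarith
  calc _ ≤ ‖f - hgm.toLp g‖ + ‖hgm.toLp g - polyL2 ha hb p‖ :=
        norm_sub_le_norm_sub_add_norm_sub _ _ _
    _ < ε := by linarith

end

end JacobiWavelet

namespace JacobiWavelet

open Polynomial (C X)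
open scoped RealInnerProductSpace

noncomputable section

/-! ### Jacobi polynomials: differential equation and orthogonality -/

/-- The coefficient of `((t-1)/2)^s` in the Jacobi polynomial of degree `n`. -/
def jacobiCoeff (a b : ℝ) (n s : ℕ) : ℝ :=
  (ascPochhammer ℝ s).eval (a + b + n + 1) * (ascPochhammer ℝ (n - s)).eval (a + s + 1) /
    ((s.factorial : ℝ) * ((n - s).factorial : ℝ))

/-- The Jacobi polynomial in the variable `y = (t-1)/2`. -/
def jacobiShifted (a b : ℝ) (n : ℕ) : Polynomial ℝ :=
  ∑ s ∈ Finset.range (n + 1), Polynomial.monomial s (jacobiCoeff a b n s)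

/-- The Jacobi polynomial `P_n^{(a,b)}` as a polynomial. -/
def jacobiPoly (a b : ℝ) (n : ℕ) : Polynomial ℝ :=
  (jacobiShifted a b n).comp (C (1 / 2) * X - C (1 / 2))

lemma eval_jacobiPoly (a b : ℝ) (n : ℕ) (t : ℝ) :
    (jacobiPoly a b n).eval t = jacobiP a b n t := by
  simp only [jacobiPoly, jacobiShifted, Polynomial.eval_comp, Polynomial.eval_finsetSum,
    Polynomial.eval_monomial, jacobiCoeff, jacobiP, Polynomial.eval_sub, Polynomial.eval_mul,
    Polynomial.eval_C, Polynomial.eval_X]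
  refine Finset.sum_congr rfl fun s _ => ?_
  congr 2
  ring

lemma coeff_jacobiShifted (a b : ℝ) (n s : ℕ) :
    (jacobiShifted a b n).coeff s = if s ≤ n then jacobiCoeff a b n s else 0 := by
  simp only [jacobiShifted, Polynomial.finsetSum_coeff, Polynomial.coeff_monomial]
  rw [Finset.sum_ite_eq']
  simp

lemma ascPochhammer_succ_eval_left (n : ℕ) (x : ℝ) :
    (ascPochhammer ℝ (n + 1)).eval x = x * (ascPochhammer ℝ n).eval (x + 1) := by
  simp [ascPochhammer_succ_left, Polynomial.eval_comp]

/-- In the variable `(t-1)/2` the Jacobi polynomial is a terminating hypergeometric series, so its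
coefficients obey a two-term recurrence, which is the differential equation read coefficientwise. -/
lemma jacobiCoeff_succ (a b : ℝ) {n s : ℕ} (hs : s < n) :
    ((s : ℝ) + 1) * (s + a + 1) * jacobiCoeff a b n (s + 1) =
      ((n : ℝ) - s) * (n + s + a + b + 1) * jacobiCoeff a b n s := by
  obtain ⟨d, rfl⟩ := Nat.exists_eq_add_of_lt hs
  have h1 : s + d + 1 - s = d + 1 := by omega
  have h2 : s + d + 1 - (s + 1) = d := by omega
  rw [jacobiCoeff, jacobiCoeff, h1, h2, ascPochhammer_succ_eval, ascPochhammer_succ_eval_left,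
    Nat.factorial_succ, Nat.factorial_succ]
  have e : a + (s + 1 : ℕ) + 1 = a + s + 1 + 1 := by push_cast; ring
  rw [e]
  push_cast
  field_simp
  ring

lemma jacobiShifted_ode (a b : ℝ) (n : ℕ) :
    X * (1 + X) * (jacobiShifted a b n).derivative.derivative +
      (C (a + 1) + C (a + b + 2) * X) * (jacobiShifted a b n).derivative =
      C ((n : ℝ) * (n + a + b + 1)) * jacobiShifted a b n := by
  have e : X * (1 + X) * (jacobiShifted a b n).derivative.derivative +
      (C (a + 1) + C (a + b + 2) * X) * (jacobiShifted a b n).derivative =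
      X * (jacobiShifted a b n).derivative.derivative +
      X * (X * (jacobiShifted a b n).derivative.derivative) +
      C (a + 1) * (jacobiShifted a b n).derivative +
      C (a + b + 2) * (X * (jacobiShifted a b n).derivative) := by ring
  rw [e]
  ext s
  -- The recurrence extends to every `s`: at `s = n` the factor `n - s` vanishes together with the
  -- next coefficient, and beyond it both sides are zero.
  have key : ((s : ℝ) + 1) * (s + a + 1) * (jacobiShifted a b n).coeff (s + 1) =
      ((n : ℝ) - s) * (n + s + a + b + 1) * (jacobiShifted a b n).coeff s := by
    simp only [coeff_jacobiShifted]
    rcases lt_trichotomy s n with h | h | h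
    · rw [if_pos (by omega), if_pos h.le, jacobiCoeff_succ a b h]
    · simp [h]
    · simp [not_le.2 h, not_le.2 (Nat.lt_succ_of_lt h)]
  rcases s with _ | _ | s
  all_goals
    simp only [Polynomial.coeff_add, Polynomial.coeff_C_mul, Polynomial.coeff_derivative,
      Polynomial.coeff_X_mul, Polynomial.coeff_X_mul_zero]
    push_cast at key ⊢
    linear_combination key

/-- The eigenvalue `n (n+a+b+1)` of the Jacobi differential operator. -/
def jacobiEigen (a b : ℝ) (n : ℕ) : ℝ := n * (n + a + b + 1)

lemma jacobiPoly_ode (a b : ℝ) (n : ℕ) :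
    (1 - X ^ 2) * (jacobiPoly a b n).derivative.derivative +
      jacobiTau a b * (jacobiPoly a b n).derivative = -(C (jacobiEigen a b n) * jacobiPoly a b n) := by
  have h := congrArg (fun p => Polynomial.comp p (C (1 / 2) * X - C (1 / 2)))
    (jacobiShifted_ode a b n)
  have d1 : (jacobiPoly a b n).derivative =
      C (1 / 2) * (jacobiShifted a b n).derivative.comp (C (1 / 2) * X - C (1 / 2)) := by
    rw [jacobiPoly, Polynomial.derivative_comp]
    simp
  have d2 : (jacobiPoly a b n).derivative.derivative = C (1 / 2) * (C (1 / 2) *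
      (jacobiShifted a b n).derivative.derivative.comp (C (1 / 2) * X - C (1 / 2))) := by
    rw [d1, Polynomial.derivative_mul, Polynomial.derivative_comp]
    simp
  rw [d2, d1, jacobiEigen, jacobiPoly]
  apply Polynomial.funext
  intro t
  have h := congrArg (Polynomial.eval t) h
  simp [Polynomial.eval_comp, jacobiTau] at h ⊢
  linear_combination -h

lemma jacobiEigen_strictMono {a b : ℝ} (ha : -1 < a) (hb : -1 < b) :
    StrictMono (jacobiEigen a b) := by
  refine strictMono_nat_of_lt_succ fun n => ?_
  have : (0 : ℝ) ≤ n := n.cast_nonneg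
  simp only [jacobiEigen]
  push_cast
  nlinarith

lemma jacobiEigen_pos {a b : ℝ} (ha : -1 < a) (hb : -1 < b) {n : ℕ} (hn : 1 ≤ n) :
    0 < jacobiEigen a b n := by
  have := jacobiEigen_strictMono ha hb (show 0 < n from hn)
  simpa [jacobiEigen] using this

lemma jacobiCoeff_self_ne_zero {a b : ℝ} (ha : -1 < a) (hb : -1 < b) (n : ℕ) :
    jacobiCoeff a b n n ≠ 0 := by
  -- In degree zero the rising factorial is empty. In positive degree its base `a + b + n + 1` is
  -- positive, so no factor vanishes.
  rcases n with _ | n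
  · simp [jacobiCoeff]
  · have : 0 < (ascPochhammer ℝ (n + 1)).eval (a + b + (n + 1 : ℕ) + 1) :=
      ascPochhammer_pos _ _ (by push_cast; have : (0 : ℝ) ≤ n := n.cast_nonneg; linarith)
    rw [jacobiCoeff]
    refine div_ne_zero (mul_ne_zero this.ne' ?_) (by positivity)
    simp

lemma natDegree_jacobiPoly {a b : ℝ} (ha : -1 < a) (hb : -1 < b) (n : ℕ) :
    (jacobiPoly a b n).natDegree = n := by
  have h1 : (jacobiShifted a b n).natDegree = n := by
    refine le_antisymm (Polynomial.natDegree_le_iff_coeff_eq_zero.2 fun s hs => ?_)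
      (Polynomial.le_natDegree_of_ne_zero ?_)
    · rw [coeff_jacobiShifted, if_neg (by omega)]
    · rw [coeff_jacobiShifted, if_pos le_rfl]
      exact jacobiCoeff_self_ne_zero ha hb n
  have h2 : (C (1 / 2 : ℝ) * X - C (1 / 2)).natDegree = 1 := by
    rw [Polynomial.natDegree_sub_C]
    exact Polynomial.natDegree_C_mul_X _ (by norm_num)
  rw [jacobiPoly, Polynomial.natDegree_comp, h1, h2, mul_one]

lemma jacobiPoly_ne_zero {a b : ℝ} (ha : -1 < a) (hb : -1 < b) (n : ℕ) :
    jacobiPoly a b n ≠ 0 := by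
  rcases n with _ | n
  · intro h
    have := eval_jacobiPoly a b 0 0
    simp [h, jacobiP] at this
  · intro h
    have := natDegree_jacobiPoly ha hb (n + 1)
    simp [h] at this

lemma degree_jacobiPoly {a b : ℝ} (ha : -1 < a) (hb : -1 < b) (n : ℕ) :
    (jacobiPoly a b n).degree = n := by
  rw [Polynomial.degree_eq_natDegree (jacobiPoly_ne_zero ha hb n), natDegree_jacobiPoly ha hb]

/-- Linear maps that agree on a sequence of polynomials of degrees `0, 1, 2, …` agree. -/
lemma linearMap_eq_of_degree_lt {E : Type*} [AddCommGroup E] [Module ℝ E]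
    {J : ℕ → Polynomial ℝ} (hJ : ∀ n, (J n).degree = n) {L L' : Polynomial ℝ →ₗ[ℝ] E} {m : ℕ}
    (h : ∀ n < m, L (J n) = L' (J n)) {p : Polynomial ℝ} (hp : p.degree < m) : L p = L' p := by
  induction m generalizing p with
  | zero =>
    have : p = 0 := by simpa using hp
    simp [this]
  | succ m ih =>
    have hJm := hJ m
    have hne : J m ≠ 0 := fun h0 => by simp [h0] at hJm
    have hlc : (J m).leadingCoeff ≠ 0 := by simpa using hne
    have hnd : (J m).natDegree = m := Polynomial.natDegree_eq_of_degree_eq_some hJm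
    set c := p.coeff m / (J m).leadingCoeff with hc
    have hlt : (p - c • J m).degree < m := by
      rw [Polynomial.degree_lt_iff_coeff_zero]
      intro i hi
      rcases hi.eq_or_lt with rfl | hi
      · have : (J m).coeff m = (J m).leadingCoeff := by rw [Polynomial.leadingCoeff, hnd]
        simp [this, hc, hlc]
      · have h1 : p.coeff i = 0 :=
          Polynomial.coeff_eq_zero_of_degree_lt (hp.trans_le (by exact_mod_cast hi))
        have h2 : (J m).coeff i = 0 :=
          Polynomial.coeff_eq_zero_of_degree_lt (by rw [hJm]; exact_mod_cast hi)
        simp [h1, h2]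
    have := ih (fun n hn => h n (hn.trans m.lt_succ_self)) hlt
    simpa [h m m.lt_succ_self] using this

/-- Sturm–Liouville form of the Jacobi equation, tested against a function with an integrable
derivative. -/
lemma IsPrimitive.integral_jacobiPoly {a b : ℝ} (ha : -1 < a) (hb : -1 < b) {f g : ℝ → ℝ}
    (hfg : IsPrimitive (-1) 1 f g) (n : ℕ) :
    ∫ x in Ioo (-1 : ℝ) 1, jacobiWeight (a + 1) (b + 1) x *
        (g x * (jacobiPoly a b n).derivative.eval x) =
      jacobiEigen a b n *
        ∫ x in Ioo (-1 : ℝ) 1, jacobiWeight a b x * (f x * (jacobiPoly a b n).eval x) := by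
  have h := hfg.integral_jacobiWeight ha hb (jacobiPoly a b n).derivative
  rw [add_comm (jacobiTau a b * _), jacobiPoly_ode] at h
  rw [← integral_const_mul, ← neg_eq_iff_eq_neg.2 h, ← integral_neg]
  congr! 2 with x
  simp
  ring

lemma neg_one_lt_add_one {a : ℝ} (ha : -1 < a) : -1 < a + 1 := by linarith

/-- Shows that the derivatives of the Jacobi polynomials are orthogonal for the raised weight, with
squared norms multiplied by the eigenvalues. -/
lemma inner_derivative_jacobiPoly {a b : ℝ} (ha : -1 < a) (hb : -1 < b) (n : ℕ)
    (p : Polynomial ℝ) :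
    ⟪polyL2 (neg_one_lt_add_one ha) (neg_one_lt_add_one hb) (jacobiPoly a b n).derivative,
      polyL2 (neg_one_lt_add_one ha) (neg_one_lt_add_one hb) p.derivative⟫ =
      jacobiEigen a b n * ⟪polyL2 ha hb (jacobiPoly a b n), polyL2 ha hb p⟫ := by
  have := (isPrimitive_eval (-1) 1 p).integral_jacobiPoly ha hb n
  rw [inner_polyL2, inner_polyL2]
  simpa only [Polynomial.eval_mul, mul_comm (Polynomial.eval _ p),
    mul_comm (Polynomial.eval _ p.derivative)] using this

/-- The pairing of the derivatives is symmetric and equals either eigenvalue times the pairing of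
the polynomials; the eigenvalues are distinct. -/
lemma inner_jacobiPoly_of_ne {a b : ℝ} (ha : -1 < a) (hb : -1 < b) {m n : ℕ} (hmn : m ≠ n) :
    ⟪polyL2 ha hb (jacobiPoly a b m), polyL2 ha hb (jacobiPoly a b n)⟫ = 0 := by
  have h1 := inner_derivative_jacobiPoly ha hb m (jacobiPoly a b n)
  have h2 := inner_derivative_jacobiPoly ha hb n (jacobiPoly a b m)
  rw [real_inner_comm, real_inner_comm (polyL2 ha hb (jacobiPoly a b m))] at h2
  have h3 := h1.symm.trans h2
  have h4 : jacobiEigen a b m - jacobiEigen a b n ≠ 0 :=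
    sub_ne_zero.2 fun h => hmn ((jacobiEigen_strictMono ha hb).injective h)
  exact (mul_eq_zero.1 (by linear_combination h3 :
    (jacobiEigen a b m - jacobiEigen a b n) *
      ⟪polyL2 ha hb (jacobiPoly a b m), polyL2 ha hb (jacobiPoly a b n)⟫ = 0)).resolve_left h4

lemma inner_jacobiPoly_of_degree_lt {a b : ℝ} (ha : -1 < a) (hb : -1 < b) {n : ℕ}
    {p : Polynomial ℝ} (hp : p.degree < n) :
    ⟪polyL2 ha hb (jacobiPoly a b n), polyL2 ha hb p⟫ = 0 := by
  refine linearMap_eq_of_degree_lt (degree_jacobiPoly ha hb)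
    (L := (innerₛₗ ℝ (polyL2 ha hb (jacobiPoly a b n))).comp (polyL2 ha hb)) (L' := 0)
    (fun i hi => ?_) hp
  simpa using inner_jacobiPoly_of_ne ha hb hi.ne'

lemma norm_jacobiPoly_pos {a b : ℝ} (ha : -1 < a) (hb : -1 < b) (n : ℕ) :
    0 < ‖polyL2 ha hb (jacobiPoly a b n)‖ := by
  rw [norm_pos_iff]
  intro h
  exact jacobiPoly_ne_zero ha hb n (polyL2_injective ha hb (h.trans (map_zero _).symm))

lemma jacobiH_eq {a b : ℝ} (ha : -1 < a) (hb : -1 < b) (n : ℕ) :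
    jacobiH a b n = ‖polyL2 ha hb (jacobiPoly a b n)‖ ^ 2 := by
  rw [← real_inner_self_eq_norm_sq, inner_polyL2, jacobiH]
  simp only [Polynomial.eval_mul, eval_jacobiPoly, sq]

lemma norm_derivative_jacobiPoly_sq {a b : ℝ} (ha : -1 < a) (hb : -1 < b) (n : ℕ) :
    ‖polyL2 (neg_one_lt_add_one ha) (neg_one_lt_add_one hb) (jacobiPoly a b n).derivative‖ ^ 2 =
      jacobiEigen a b n * ‖polyL2 ha hb (jacobiPoly a b n)‖ ^ 2 := by
  rw [← real_inner_self_eq_norm_sq, inner_derivative_jacobiPoly, real_inner_self_eq_norm_sq]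

end

end JacobiWavelet

namespace JacobiWavelet

open Polynomial (C X)
open scoped RealInnerProductSpace

noncomputable section

/-! ### Weighted orthogonal projection onto polynomials -/

lemma l2Norm_nonneg (w : ℝ → ℝ) (a b : ℝ) (f : ℝ → ℝ) : 0 ≤ l2Norm w a b f := Real.sqrt_nonneg _

lemma l2Norm_eq_norm_toLp {a b : ℝ} {f : ℝ → ℝ} (hf : MemLp f 2 (jacobiMeasure a b)) :
    l2Norm (jacobiWeight a b) (-1) 1 f = ‖hf.toLp f‖ := by
  rw [l2Norm, ← norm_toLp_sq hf, Real.sqrt_sq (norm_nonneg _)]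

lemma l2Norm_eval {a b : ℝ} (ha : -1 < a) (hb : -1 < b) (p : Polynomial ℝ) :
    l2Norm (jacobiWeight a b) (-1) 1 (fun x => p.eval x) = ‖polyL2 ha hb p‖ :=
  l2Norm_eq_norm_toLp (memLp_of_continuous ha hb p.continuous)

lemma l2Norm_add_le {a b : ℝ} {f g : ℝ → ℝ} (hf : MemLp f 2 (jacobiMeasure a b))
    (hg : MemLp g 2 (jacobiMeasure a b)) :
    l2Norm (jacobiWeight a b) (-1) 1 (fun x => f x + g x) ≤
      l2Norm (jacobiWeight a b) (-1) 1 f + l2Norm (jacobiWeight a b) (-1) 1 g := by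
  refine (l2Norm_eq_norm_toLp (hf.add hg)).trans_le ?_
  rw [l2Norm_eq_norm_toLp hf, l2Norm_eq_norm_toLp hg, MemLp.toLp_add hf hg]
  exact norm_add_le _ _

lemma l2Norm_sub_le {a b : ℝ} {f g : ℝ → ℝ} (hf : MemLp f 2 (jacobiMeasure a b))
    (hg : MemLp g 2 (jacobiMeasure a b)) :
    l2Norm (jacobiWeight a b) (-1) 1 (fun x => f x - g x) ≤
      l2Norm (jacobiWeight a b) (-1) 1 f + l2Norm (jacobiWeight a b) (-1) 1 g := by
  refine (l2Norm_eq_norm_toLp (hf.sub hg)).trans_le ?_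
  rw [l2Norm_eq_norm_toLp hf, l2Norm_eq_norm_toLp hg, MemLp.toLp_sub hf hg]
  exact norm_sub_le _ _

lemma memLp_sub_eval {a b : ℝ} (ha : -1 < a) (hb : -1 < b) {f : ℝ → ℝ}
    (hf : MemLp f 2 (jacobiMeasure a b)) (p : Polynomial ℝ) :
    MemLp (fun x => f x - p.eval x) 2 (jacobiMeasure a b) :=
  hf.sub (memLp_of_continuous ha hb p.continuous)

lemma toLp_sub_eval {a b : ℝ} (ha : -1 < a) (hb : -1 < b) {f : ℝ → ℝ}
    (hf : MemLp f 2 (jacobiMeasure a b)) (p : Polynomial ℝ) :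
    (memLp_sub_eval ha hb hf p).toLp _ = hf.toLp f - polyL2 ha hb p :=
  MemLp.toLp_sub hf (memLp_of_continuous ha hb p.continuous)

lemma l2Norm_sub_eval {a b : ℝ} (ha : -1 < a) (hb : -1 < b) {f : ℝ → ℝ}
    (hf : MemLp f 2 (jacobiMeasure a b)) (p : Polynomial ℝ) :
    l2Norm (jacobiWeight a b) (-1) 1 (fun x => f x - p.eval x) =
      ‖hf.toLp f - polyL2 ha hb p‖ := by
  rw [l2Norm_eq_norm_toLp (memLp_sub_eval ha hb hf p), toLp_sub_eval]

lemma jacobiWeight_add_one_le (a b : ℝ) {x : ℝ} (hx : x ∈ Ioo (-1 : ℝ) 1) :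
    jacobiWeight (a + 1) (b + 1) x ≤ jacobiWeight a b x := by
  rw [jacobiWeight_add_one a b hx]
  exact mul_le_of_le_one_right (jacobiWeight_pos a b hx).le (by nlinarith [sq_nonneg x])

lemma memLp_add_one {a b : ℝ} {f : ℝ → ℝ} (hf : MemLp f 2 (jacobiMeasure a b)) :
    MemLp f 2 (jacobiMeasure (a + 1) (b + 1)) := by
  refine hf.mono_measure ?_
  refine withDensity_mono ?_
  filter_upwards [ae_restrict_mem measurableSet_Ioo] with x hx
  exact ENNReal.ofReal_le_ofReal (jacobiWeight_add_one_le a b hx)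

/-- The raised weight is the original one times `1-x² ≤ 1`. This allows a return to the original
weight after each use of the Poincaré inequality. -/
lemma l2Norm_add_one_le {a b : ℝ} {f : ℝ → ℝ} (hf : MemLp f 2 (jacobiMeasure a b)) :
    l2Norm (jacobiWeight (a + 1) (b + 1)) (-1) 1 f ≤ l2Norm (jacobiWeight a b) (-1) 1 f := by
  refine Real.sqrt_le_sqrt ?_
  refine setIntegral_mono_on ((memLp_jacobiMeasure_iff _ _ _).1 (memLp_add_one hf)).2
    ((memLp_jacobiMeasure_iff _ _ _).1 hf).2 measurableSet_Ioo fun x hx => ?_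
  exact mul_le_mul_of_nonneg_right (jacobiWeight_add_one_le a b hx) (sq_nonneg _)

/-- `f` is orthogonal to all polynomials of degree less than `m`. -/
def PolyOrth (a b : ℝ) (m : ℕ) (f : ℝ → ℝ) : Prop :=
  ∀ p : Polynomial ℝ, p.degree < m →
    ∫ x in Ioo (-1 : ℝ) 1, jacobiWeight a b x * (f x * p.eval x) = 0

lemma polyOrth_iff {a b : ℝ} (ha : -1 < a) (hb : -1 < b) {m : ℕ} {f : ℝ → ℝ}
    (hf : MemLp f 2 (jacobiMeasure a b)) :
    PolyOrth a b m f ↔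
      ∀ p : Polynomial ℝ, p.degree < m → ⟪polyL2 ha hb p, hf.toLp f⟫ = 0 := by
  simp only [PolyOrth, inner_polyL2_toLp]

/-- The `L²_w(-1,1)`-orthogonal projection onto the polynomials of degree less than `m`. -/
def jacobiProj (a b : ℝ) (m : ℕ) (f : ℝ → ℝ) : Polynomial ℝ :=
  ∑ n ∈ Finset.range m,
    ((∫ x in Ioo (-1 : ℝ) 1, jacobiWeight a b x * (f x * (jacobiPoly a b n).eval x)) /
      jacobiH a b n) • jacobiPoly a b n

lemma degree_sum_jacobiPoly_lt {a b : ℝ} (ha : -1 < a) (hb : -1 < b) (m : ℕ) (c : ℕ → ℝ) :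
    (∑ n ∈ Finset.range m, c n • jacobiPoly a b n).degree < m := by
  rw [← Polynomial.mem_degreeLT]
  refine Submodule.sum_mem _ fun n hn => Submodule.smul_mem _ _ ?_
  rw [Polynomial.mem_degreeLT, degree_jacobiPoly ha hb]
  exact_mod_cast Finset.mem_range.1 hn

lemma degree_jacobiProj_lt {a b : ℝ} (ha : -1 < a) (hb : -1 < b) (m : ℕ) (f : ℝ → ℝ) :
    (jacobiProj a b m f).degree < m :=
  degree_sum_jacobiPoly_lt ha hb m _

lemma inner_jacobiPoly_sum {a b : ℝ} (ha : -1 < a) (hb : -1 < b) {m n : ℕ} (hn : n < m)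
    (c : ℕ → ℝ) :
    ⟪polyL2 ha hb (jacobiPoly a b n),
      polyL2 ha hb (∑ i ∈ Finset.range m, c i • jacobiPoly a b i)⟫ =
      c n * ‖polyL2 ha hb (jacobiPoly a b n)‖ ^ 2 := by
  rw [map_sum, inner_sum, Finset.sum_eq_single n]
  · rw [map_smul, inner_smul_right, real_inner_self_eq_norm_sq]
  · intro i _ hi
    rw [map_smul, inner_smul_right, inner_jacobiPoly_of_ne ha hb hi.symm, mul_zero]
  · intro h
    exact absurd (Finset.mem_range.2 hn) h

lemma norm_sum_jacobiPoly_sq {a b : ℝ} (ha : -1 < a) (hb : -1 < b) (m : ℕ) (c : ℕ → ℝ) :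
    ‖polyL2 ha hb (∑ i ∈ Finset.range m, c i • jacobiPoly a b i)‖ ^ 2 =
      ∑ i ∈ Finset.range m, c i ^ 2 * ‖polyL2 ha hb (jacobiPoly a b i)‖ ^ 2 := by
  rw [← real_inner_self_eq_norm_sq]
  nth_rewrite 1 [map_sum]
  rw [sum_inner]
  refine Finset.sum_congr rfl fun n hn => ?_
  rw [map_smul, real_inner_smul_left, inner_jacobiPoly_sum ha hb (Finset.mem_range.1 hn)]
  ring

lemma polyOrth_sub_jacobiProj {a b : ℝ} (ha : -1 < a) (hb : -1 < b) (m : ℕ) {f : ℝ → ℝ}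
    (hf : MemLp f 2 (jacobiMeasure a b)) :
    PolyOrth a b m (fun x => f x - (jacobiProj a b m f).eval x) := by
  rw [polyOrth_iff ha hb (memLp_sub_eval ha hb hf _)]
  intro p hdeg
  rw [toLp_sub_eval ha hb hf, inner_sub_right, sub_eq_zero, real_inner_comm (hf.toLp f),
    real_inner_comm (polyL2 ha hb (jacobiProj a b m f))]
  -- Pairing with `f` and pairing with its projection are linear in the test polynomial, so it
  -- suffices to compare them on Jacobi polynomials.
  refine linearMap_eq_of_degree_lt (degree_jacobiPoly ha hb)
    (L := (innerₛₗ ℝ (hf.toLp f)).comp (polyL2 ha hb))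
    (L' := (innerₛₗ ℝ (polyL2 ha hb (jacobiProj a b m f))).comp (polyL2 ha hb)) ?_ hdeg
  intro n hn
  simp only [LinearMap.comp_apply, innerₛₗ_apply_apply]
  rw [real_inner_comm _ (hf.toLp f), real_inner_comm _ (polyL2 ha hb (jacobiProj a b m f)),
    jacobiProj,
    inner_jacobiPoly_sum ha hb hn, inner_polyL2_toLp, jacobiH_eq ha hb]
  have := norm_jacobiPoly_pos ha hb n
  field_simp

/-- Best approximation property of a function orthogonal to polynomials. -/
lemma PolyOrth.l2Norm_le {a b : ℝ} (ha : -1 < a) (hb : -1 < b) {m : ℕ} {f : ℝ → ℝ}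
    (hf : MemLp f 2 (jacobiMeasure a b)) (h : PolyOrth a b m f) {q : Polynomial ℝ}
    (hq : q.degree < m) :
    l2Norm (jacobiWeight a b) (-1) 1 f ≤
      l2Norm (jacobiWeight a b) (-1) 1 (fun x => f x - q.eval x) := by
  rw [l2Norm_sub_eval ha hb hf, l2Norm_eq_norm_toLp hf]
  refine (sq_le_sq₀ (norm_nonneg _) (norm_nonneg _)).1 ?_
  have h0 := (polyOrth_iff ha hb hf).1 h q hq
  rw [norm_sub_sq_real, real_inner_comm, h0]
  nlinarith [sq_nonneg ‖polyL2 ha hb q‖]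

lemma l2Norm_sub_jacobiProj_le {a b : ℝ} (ha : -1 < a) (hb : -1 < b) {m : ℕ} {f : ℝ → ℝ}
    (hf : MemLp f 2 (jacobiMeasure a b)) {q : Polynomial ℝ} (hq : q.degree < m) :
    l2Norm (jacobiWeight a b) (-1) 1 (fun x => f x - (jacobiProj a b m f).eval x) ≤
      l2Norm (jacobiWeight a b) (-1) 1 (fun x => f x - q.eval x) := by
  have hdeg : (q - jacobiProj a b m f).degree < m :=
    (Polynomial.degree_sub_le _ _).trans_lt (max_lt hq (degree_jacobiProj_lt ha hb m f))
  have := (polyOrth_sub_jacobiProj ha hb m hf).l2Norm_le ha hb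
    (memLp_sub_eval ha hb hf _) hdeg
  simpa using this

/-- The Fourier expansion is a linear map that reproduces each Jacobi polynomial of index below `m`,
and these have degrees `0, …, m-1`. -/
lemma eq_sum_jacobiPoly {a b : ℝ} (ha : -1 < a) (hb : -1 < b) {m : ℕ} {p : Polynomial ℝ}
    (hp : p.degree < m) : ∃ c : ℕ → ℝ, p = ∑ n ∈ Finset.range m, c n • jacobiPoly a b n := by
  refine ⟨fun n => ⟪polyL2 ha hb (jacobiPoly a b n), polyL2 ha hb p⟫ /
    ‖polyL2 ha hb (jacobiPoly a b n)‖ ^ 2, ?_⟩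
  let L : Polynomial ℝ →ₗ[ℝ] Polynomial ℝ := ∑ n ∈ Finset.range m,
    ((innerₛₗ ℝ (polyL2 ha hb (jacobiPoly a b n))).comp (polyL2 ha hb)).smulRight
      ((‖polyL2 ha hb (jacobiPoly a b n)‖ ^ 2)⁻¹ • jacobiPoly a b n)
  have hL : ∀ p, L p = ∑ n ∈ Finset.range m, (⟪polyL2 ha hb (jacobiPoly a b n), polyL2 ha hb p⟫ /
    ‖polyL2 ha hb (jacobiPoly a b n)‖ ^ 2) • jacobiPoly a b n := by
    intro p
    simp [L, smul_smul, div_eq_mul_inv]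
  rw [← hL]
  refine linearMap_eq_of_degree_lt (degree_jacobiPoly ha hb) (L := LinearMap.id) (L' := L)
    (fun n hn => ?_) hp
  rw [hL, Finset.sum_eq_single n]
  · rw [real_inner_self_eq_norm_sq, div_self (by have := norm_jacobiPoly_pos ha hb n; positivity)]
    simp
  · intro i _ hi
    rw [inner_jacobiPoly_of_ne ha hb hi]
    simp
  · intro h
    exact absurd (Finset.mem_range.2 hn) h

/-! ### The weighted Poincaré inequality -/

lemma degree_jacobiTau_mul_lt (a b : ℝ) {m : ℕ} {p : Polynomial ℝ} (hp : p.degree < m) :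
    Polynomial.degree (jacobiTau a b * p + (1 - X ^ 2) * p.derivative) < (m + 1 : ℕ) := by
  rw [Polynomial.degree_lt_iff_coeff_zero] at hp ⊢
  have e : jacobiTau a b * p + (1 - X ^ 2) * p.derivative =
      C (b - a) * p - C (a + b + 2) * (X * p) + p.derivative - X * (X * p.derivative) := by
    rw [jacobiTau]; ring
  intro i hi
  rw [e]
  rcases i with _ | _ | i
  · omega
  · simp only [Polynomial.coeff_add, Polynomial.coeff_sub, Polynomial.coeff_C_mul,
      Polynomial.coeff_derivative, Polynomial.coeff_X_mul, Polynomial.coeff_X_mul_zero]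
    rw [hp _ (by omega), hp 0 (by omega), hp _ (by omega)]
    simp
  · simp only [Polynomial.coeff_add, Polynomial.coeff_sub, Polynomial.coeff_C_mul,
      Polynomial.coeff_derivative, Polynomial.coeff_X_mul]
    rw [hp _ (by omega), hp (i + 1) (by omega), hp _ (by omega)]
    simp

/-- Testing `g` against `p` in the raised weight is, after integration by parts, testing `e` in the
original weight against a polynomial of degree at most one higher. -/
lemma PolyOrth.of_isPrimitive {a b : ℝ} (ha : -1 < a) (hb : -1 < b) {m : ℕ} {e g : ℝ → ℝ}
    (heg : IsPrimitive (-1) 1 e g) (h : PolyOrth a b (m + 1) e) :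
    PolyOrth (a + 1) (b + 1) m g := by
  intro p hp
  have := heg.integral_jacobiWeight ha hb p
  rw [h _ (degree_jacobiTau_mul_lt a b hp)] at this
  linarith

/-- Weighted Poincaré inequality. The derivative of a partial Jacobi sum of `e` is the corresponding
partial sum of `g` in the orthogonal family of derivatives, so Bessel's inequality bounds `∑ λ_n
c_n² ‖J_n‖²` by `‖g‖²`. Only indices `n ≥ m` contribute, and there `λ_n ≥ λ_m`. -/
lemma PolyOrth.eigen_mul_sq_le {a b : ℝ} (ha : -1 < a) (hb : -1 < b) {m : ℕ} {e g : ℝ → ℝ}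
    (he : MemLp e 2 (jacobiMeasure a b)) (hg : MemLp g 2 (jacobiMeasure (a + 1) (b + 1)))
    (heg : IsPrimitive (-1) 1 e g) (h : PolyOrth a b m e) :
    jacobiEigen a b m * l2Norm (jacobiWeight a b) (-1) 1 e ^ 2 ≤
      l2Norm (jacobiWeight (a + 1) (b + 1)) (-1) 1 g ^ 2 := by
  have ha' := neg_one_lt_add_one ha
  have hb' := neg_one_lt_add_one hb
  rw [l2Norm_eq_norm_toLp he, l2Norm_eq_norm_toLp hg]
  have hlam : 0 ≤ jacobiEigen a b m := by
    rcases Nat.eq_zero_or_pos m with rfl | hm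
    · simp [jacobiEigen]
    · exact (jacobiEigen_pos ha hb hm).le
  -- the projections of `e` satisfy the inequality
  have main : ∀ K, jacobiEigen a b m * ‖polyL2 ha hb (jacobiProj a b K e)‖ ^ 2 ≤ ‖hg.toLp g‖ ^ 2 := by
    intro K
    set c : ℕ → ℝ := fun n =>
      (∫ x in Ioo (-1 : ℝ) 1, jacobiWeight a b x * (e x * (jacobiPoly a b n).eval x)) /
        jacobiH a b n with hc
    have hS : jacobiProj a b K e = ∑ n ∈ Finset.range K, c n • jacobiPoly a b n := rfl
    have hcn : ∀ n, ∫ x in Ioo (-1 : ℝ) 1, jacobiWeight a b x * (e x * (jacobiPoly a b n).eval x) =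
        c n * ‖polyL2 ha hb (jacobiPoly a b n)‖ ^ 2 := by
      intro n
      have := norm_jacobiPoly_pos ha hb n
      simp only [hc, jacobiH_eq ha hb]
      field_simp
    set S := jacobiProj a b K e
    set Q := ∑ n ∈ Finset.range K, jacobiEigen a b n * (c n ^ 2 *
      ‖polyL2 ha hb (jacobiPoly a b n)‖ ^ 2) with hQ
    have hd : S.derivative = ∑ n ∈ Finset.range K, c n • (jacobiPoly a b n).derivative := by
      rw [hS, Polynomial.derivative_sum]
      simp
    have h1 : ⟪polyL2 ha' hb' S.derivative, hg.toLp g⟫ = Q := by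
      rw [hd, map_sum, sum_inner]
      refine Finset.sum_congr rfl fun n _ => ?_
      rw [map_smul, real_inner_smul_left, inner_polyL2_toLp, heg.integral_jacobiPoly ha hb, hcn]
      ring
    have h2 : ‖polyL2 ha' hb' S.derivative‖ ^ 2 = Q := by
      rw [← real_inner_self_eq_norm_sq]
      nth_rewrite 1 [hd]
      rw [map_sum, sum_inner]
      refine Finset.sum_congr rfl fun n hn => ?_
      rw [map_smul, real_inner_smul_left, inner_derivative_jacobiPoly ha hb, hS,
        inner_jacobiPoly_sum ha hb (Finset.mem_range.1 hn)]
      ring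
    -- Since `⟪S', g⟫ = ‖S'‖² = Q`, expanding `0 ≤ ‖g - S'‖²` gives Bessel's inequality.
    have h3 : Q ≤ ‖hg.toLp g‖ ^ 2 := by
      have := sq_nonneg ‖hg.toLp g - polyL2 ha' hb' S.derivative‖
      rw [norm_sub_sq_real, real_inner_comm, h1, h2] at this
      linarith
    refine le_trans ?_ h3
    rw [hS, norm_sum_jacobiPoly_sq, Finset.mul_sum, hQ]
    refine Finset.sum_le_sum fun n _ => ?_
    rcases lt_or_ge n m with hn | hn
    · have : c n = 0 := by
        simp only [hc]
        rw [h _ (by rw [degree_jacobiPoly ha hb]; exact_mod_cast hn), zero_div]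
      simp [this]
    · exact mul_le_mul_of_nonneg_right ((jacobiEigen_strictMono ha hb).monotone hn) (by positivity)
  rw [← Real.sqrt_le_sqrt_iff (by positivity), Real.sqrt_sq (norm_nonneg _),
    Real.sqrt_mul hlam, Real.sqrt_sq (norm_nonneg _)]
  -- Passage from the projections to `e` itself by density of polynomials. Dividing by `√λ_m + 1`
  -- also covers `m = 0`, where the eigenvalue is zero.
  refine le_of_forall_pos_le_add fun ε hε => ?_
  obtain ⟨p, hp⟩ := exists_norm_sub_polyL2_lt ha hb (he.toLp e)
    (ε := ε / (Real.sqrt (jacobiEigen a b m) + 1)) (by positivity)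
  set K := p.natDegree + 1
  have hdeg : p.degree < K := Polynomial.degree_le_natDegree.trans_lt
    (by exact_mod_cast p.natDegree.lt_succ_self)
  have h1 := l2Norm_sub_jacobiProj_le ha hb he hdeg
  rw [l2Norm_sub_eval ha hb he, l2Norm_sub_eval ha hb he] at h1
  have h2 : ‖he.toLp e - polyL2 ha hb (jacobiProj a b K e)‖ ≤
      ε / (Real.sqrt (jacobiEigen a b m) + 1) := h1.trans hp.le
  have h3 := norm_sub_norm_le (he.toLp e) (polyL2 ha hb (jacobiProj a b K e))
  have h4 : Real.sqrt (jacobiEigen a b m) * ‖polyL2 ha hb (jacobiProj a b K e)‖ ≤ ‖hg.toLp g‖ := by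
    have := Real.sqrt_le_sqrt (main K)
    rwa [Real.sqrt_sq (norm_nonneg _), Real.sqrt_mul hlam, Real.sqrt_sq (norm_nonneg _)] at this
  set r := Real.sqrt (jacobiEigen a b m)
  have hr : 0 ≤ r := Real.sqrt_nonneg _
  have h5 : r * (ε / (r + 1)) ≤ ε := by
    rw [mul_div_assoc', div_le_iff₀ (by positivity)]
    nlinarith
  calc r * ‖he.toLp e‖ ≤ r * (‖polyL2 ha hb (jacobiProj a b K e)‖ + ε / (r + 1)) :=
        mul_le_mul_of_nonneg_left (by linarith) hr
    _ ≤ ‖hg.toLp g‖ + ε := by linarith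

lemma exists_mul_sq_le_jacobiEigen {a b : ℝ} (ha : -1 < a) (hb : -1 < b) :
    ∃ κ : ℝ, 0 < κ ∧ ∀ n : ℕ, κ * (n : ℝ) ^ 2 ≤ jacobiEigen a b n := by
  -- For `n ≥ 1` write `n + a + b + 1 = (n - 1) + (a + b + 2)`, which is at least this minimum times
  -- `n`.
  refine ⟨min 1 (a + b + 2), lt_min one_pos (by linarith), fun n => ?_⟩
  rcases n with _ | n
  · simp [jacobiEigen]
  · have h1 := min_le_left 1 (a + b + 2)
    have h2 := min_le_right 1 (a + b + 2)
    have h0 : (0 : ℝ) ≤ n := n.cast_nonneg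
    rw [jacobiEigen]
    push_cast
    have : min 1 (a + b + 2) * (n + 1) ≤ n + 1 + a + b + 1 := by nlinarith
    nlinarith

/-! ### Approximation in the weighted `L²` norm -/

/-- `G 0, …, G μ` are successive derivatives lying in `L²_w(-1,1)`. -/
structure DerivChain (a b : ℝ) (μ : ℕ) (G : ℕ → ℝ → ℝ) : Prop where
  memLp : ∀ j ≤ μ, MemLp (G j) 2 (jacobiMeasure a b)
  isPrimitive : ∀ j < μ, IsPrimitive (-1) 1 (G j) (G (j + 1))

lemma DerivChain.mono {a b : ℝ} {μ μ' : ℕ} {G : ℕ → ℝ → ℝ} (h : DerivChain a b μ G)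
    (hμ : μ' ≤ μ) : DerivChain a b μ' G :=
  ⟨fun j hj => h.memLp j (hj.trans hμ), fun j hj => h.isPrimitive j (hj.trans_le hμ)⟩

lemma DerivChain.tail {a b : ℝ} {μ : ℕ} {G : ℕ → ℝ → ℝ} (h : DerivChain a b (μ + 1) G) :
    DerivChain a b μ (fun j => G (j + 1)) :=
  ⟨fun j hj => h.memLp _ (by omega), fun j hj => h.isPrimitive _ (by omega)⟩

lemma DerivChain.add_one {a b : ℝ} {μ : ℕ} {G : ℕ → ℝ → ℝ} (h : DerivChain a b μ G) :
    DerivChain (a + 1) (b + 1) μ G :=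
  ⟨fun j hj => memLp_add_one (h.memLp j hj), h.isPrimitive⟩

lemma degree_derivative_lt_of_lt_succ {p : Polynomial ℝ} {m : ℕ} (hp : p.degree < (m + 1 : ℕ)) :
    p.derivative.degree < m := by
  rw [Polynomial.degree_lt_iff_coeff_zero] at hp ⊢
  intro i hi
  rw [Polynomial.coeff_derivative, hp (i + 1) (by omega), zero_mul]

/-- Each use of the Poincaré inequality gains a factor `m` and passes to the derivative, with
exponents raised by one and orthogonality degree lowered by one. Hence the induction runs over all
exponents and all polynomials `q`, not just the projection: `q'` need not be the projection of `G 1`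
in the original weight. -/
lemma exists_pow_mul_l2Norm_le_of_polyOrth (μ : ℕ) : ∀ {a b : ℝ}, -1 < a → -1 < b →
    ∃ K : ℝ, 0 ≤ K ∧ ∀ (m : ℕ), μ ≤ m → ∀ (G : ℕ → ℝ → ℝ), DerivChain a b μ G →
      ∀ q : Polynomial ℝ, q.degree < m → PolyOrth a b m (fun x => G 0 x - q.eval x) →
        (m : ℝ) ^ μ * l2Norm (jacobiWeight a b) (-1) 1 (fun x => G 0 x - q.eval x) ≤
          K * l2Norm (jacobiWeight a b) (-1) 1 (G μ) := by
  induction μ with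
  | zero =>
    intro a b ha hb
    refine ⟨1, zero_le_one, fun m _ G hG q hq h => ?_⟩
    have := h.l2Norm_le ha hb (memLp_sub_eval ha hb (hG.memLp 0 le_rfl) q)
      (q := -q) (by rwa [Polynomial.degree_neg])
    simpa using this
  | succ μ ih =>
    intro a b ha hb
    obtain ⟨K, hK0, hK⟩ := ih (neg_one_lt_add_one ha) (neg_one_lt_add_one hb)
    obtain ⟨κ, hκ0, hκ⟩ := exists_mul_sq_le_jacobiEigen ha hb
    refine ⟨(Real.sqrt κ)⁻¹ * (2 ^ μ * K), by positivity, fun m hm G hG q hq h => ?_⟩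
    obtain ⟨m, rfl⟩ : ∃ m', m = m' + 1 := ⟨m - 1, by omega⟩
    have hprim := (hG.isPrimitive 0 (by omega)).sub (by norm_num) (isPrimitive_eval (-1) 1 q)
    have h1 := h.eigen_mul_sq_le ha hb (memLp_sub_eval ha hb (hG.memLp 0 (by omega)) q)
      (memLp_add_one (memLp_sub_eval ha hb (hG.memLp 1 (by omega)) q.derivative)) hprim
    have h2 := hK m (by omega) _ hG.tail.add_one q.derivative
      (degree_derivative_lt_of_lt_succ hq) (h.of_isPrimitive ha hb hprim)
    have h3 := l2Norm_add_one_le (hG.memLp (μ + 1) le_rfl)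
    set A := l2Norm (jacobiWeight a b) (-1) 1 (fun x => G 0 x - q.eval x)
    set B := l2Norm (jacobiWeight (a + 1) (b + 1)) (-1) 1 (fun x => G (0 + 1) x - q.derivative.eval x)
      with hB
    have hA : 0 ≤ A := l2Norm_nonneg _ _ _ _
    have hB0 : 0 ≤ B := l2Norm_nonneg _ _ _ _
    have h4 : Real.sqrt κ * ((m + 1 : ℕ) * A) ≤ B := by
      refine (sq_le_sq₀ (by positivity) hB0).1 (le_trans ?_ h1)
      rw [mul_pow, Real.sq_sqrt hκ0.le, mul_pow, ← mul_assoc]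
      exact mul_le_mul_of_nonneg_right (hκ _) (sq_nonneg _)
    -- Pays for the lost degree. For `m = 0` the bound `μ + 1 ≤ m + 1` forces `μ = 0`.
    have h5 : ((m + 1 : ℕ) : ℝ) ^ μ ≤ 2 ^ μ * (m : ℝ) ^ μ := by
      rcases Nat.eq_zero_or_pos m with rfl | hm'
      · have : μ = 0 := by omega
        simp [this]
      · rw [← mul_pow]
        refine pow_le_pow_left₀ (by positivity) ?_ _
        have : (1 : ℝ) ≤ m := by exact_mod_cast hm'
        push_cast
        linarith
    have hs : 0 < Real.sqrt κ := Real.sqrt_pos.2 hκ0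
    calc ((m + 1 : ℕ) : ℝ) ^ (μ + 1) * A
        = (Real.sqrt κ)⁻¹ * (((m + 1 : ℕ) : ℝ) ^ μ * (Real.sqrt κ * ((m + 1 : ℕ) * A))) := by
          field_simp
          ring
      _ ≤ (Real.sqrt κ)⁻¹ * ((2 ^ μ * (m : ℝ) ^ μ) * B) := by gcongr
      _ = (Real.sqrt κ)⁻¹ * (2 ^ μ * ((m : ℝ) ^ μ * B)) := by ring
      _ ≤ (Real.sqrt κ)⁻¹ * (2 ^ μ * (K * l2Norm (jacobiWeight a b) (-1) 1 (G (μ + 1)))) := by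
          have := h2.trans (mul_le_mul_of_nonneg_left h3 hK0)
          gcongr
      _ = _ := by ring

lemma exists_pow_mul_l2Norm_sub_jacobiProj_le {a b : ℝ} (ha : -1 < a) (hb : -1 < b) (μ : ℕ) :
    ∃ K : ℝ, 0 ≤ K ∧ ∀ (m : ℕ), μ ≤ m → ∀ (G : ℕ → ℝ → ℝ), DerivChain a b μ G →
      (m : ℝ) ^ μ * l2Norm (jacobiWeight a b) (-1) 1
          (fun x => G 0 x - (jacobiProj a b m (G 0)).eval x) ≤
        K * l2Norm (jacobiWeight a b) (-1) 1 (G μ) := by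
  obtain ⟨K, hK0, hK⟩ := exists_pow_mul_l2Norm_le_of_polyOrth μ ha hb
  exact ⟨K, hK0, fun m hm G hG => hK m hm G hG _ (degree_jacobiProj_lt ha hb m _)
    (polyOrth_sub_jacobiProj ha hb m (hG.memLp 0 (by omega)))⟩

end

end JacobiWavelet

namespace JacobiWavelet

open Polynomial (C X)
open scoped RealInnerProductSpace

noncomputable section

/-! ### Derivatives of Jacobi polynomials in the original weight, and Markov's inequality -/

lemma integral_jacobiWeight_tau {a b : ℝ} (ha : -1 < a) (hb : -1 < b) (s : Polynomial ℝ) :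
    ∫ x in Ioo (-1 : ℝ) 1, jacobiWeight a b x *
      (jacobiTau a b * s + (1 - X ^ 2) * s.derivative).eval x = 0 := by
  have h := (isPrimitive_eval (-1) 1 1).integral_jacobiWeight ha hb s
  simpa only [Polynomial.eval_one, one_mul, Polynomial.derivative_one, Polynomial.eval_zero,
    zero_mul, mul_zero, integral_zero, neg_zero] using h

/-- A Rellich-type identity for the Jacobi equation. -/
lemma integral_derivative_jacobiPoly_sq {a b : ℝ} (ha : -1 < a) (hb : -1 < b) (n : ℕ) :
    ∫ x in Ioo (-1 : ℝ) 1, jacobiWeight a b x *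
      ((1 - x ^ 2 + (a + b + 2) * (x - (b - a) / (a + b + 2)) ^ 2) *
        (jacobiPoly a b n).derivative.eval x ^ 2) =
      2 * jacobiEigen a b n * (n * ‖polyL2 ha hb (jacobiPoly a b n)‖ ^ 2) := by
  set J := jacobiPoly a b n with hJ
  set x₀ := (b - a) / (a + b + 2) with hx₀
  have hσ : a + b + 2 ≠ 0 := by linarith
  have hx₀' : (a + b + 2) * x₀ = b - a := by rw [hx₀]; field_simp
  -- The multiplier is `(x - x₀) J'` with `x₀` the zero of `τ`. Eliminating `J''` by the
  -- differential equation turns the `τ` terms into the nonnegative square `(a+b+2)(x-x₀)²`.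
  have key : jacobiTau a b * ((X - C x₀) * J.derivative ^ 2) +
      (1 - X ^ 2) * Polynomial.derivative ((X - C x₀) * J.derivative ^ 2) =
      (1 - X ^ 2 + C (a + b + 2) * (X - C x₀) ^ 2) * J.derivative ^ 2 -
        C (2 * jacobiEigen a b n) * (J * ((X - C x₀) * J.derivative)) := by
    have ode := jacobiPoly_ode a b n
    rw [← hJ] at ode
    have ht : jacobiTau a b = -(C (a + b + 2) * (X - C x₀)) := by
      rw [jacobiTau, ← hx₀', Polynomial.C_mul]; ring
    have hd : Polynomial.derivative ((X - C x₀) * J.derivative ^ 2) =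
        J.derivative ^ 2 + 2 * (X - C x₀) * J.derivative * J.derivative.derivative := by
      rw [Polynomial.derivative_mul, Polynomial.derivative_pow]
      simp only [Polynomial.derivative_sub, Polynomial.derivative_X, Polynomial.derivative_C,
        show (C (2 : ℕ) : Polynomial ℝ) = 2 from rfl]
      ring
    rw [hd, ht, Polynomial.C_mul, show (C 2 : Polynomial ℝ) = 2 from rfl]
    rw [ht] at ode
    linear_combination (2 * (X - C x₀) * J.derivative) * ode
  have h := integral_jacobiWeight_tau ha hb ((X - C x₀) * J.derivative ^ 2)
  rw [key] at h
  have hI : ∀ p : Polynomial ℝ,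
      IntegrableOn (fun x => jacobiWeight a b x * p.eval x) (Ioo (-1) 1) := by
    intro p
    have := isFiniteMeasure_jacobiMeasure ha hb
    exact (integrable_jacobiMeasure_iff _ _ _).1
      ((memLp_of_continuous ha hb p.continuous).integrable (by norm_num))
  simp only [Polynomial.eval_sub (_ * _), mul_sub] at h
  rw [integral_sub (hI _) (hI _), sub_eq_zero] at h
  have h2 : ∫ x in Ioo (-1 : ℝ) 1, jacobiWeight a b x *
      (C (2 * jacobiEigen a b n) * (J * ((X - C x₀) * J.derivative))).eval x =
      2 * jacobiEigen a b n * ⟪polyL2 ha hb J, polyL2 ha hb ((X - C x₀) * J.derivative)⟫ := by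
    rw [inner_polyL2, ← integral_const_mul]
    congr! 2 with x
    rw [Polynomial.eval_mul, Polynomial.eval_C]
    ring
  have h3 : ⟪polyL2 ha hb J, polyL2 ha hb ((X - C x₀) * J.derivative)⟫ =
      n * ‖polyL2 ha hb J‖ ^ 2 := by
    -- The leading coefficients cancel, and `J` is orthogonal to what remains.
    have hdeg : Polynomial.degree ((X - C x₀) * J.derivative - (n : ℝ) • J) < n := by
      have hnd := natDegree_jacobiPoly ha hb n
      have hc : ∀ i, n < i → J.coeff i = 0 := fun i hi =>
        Polynomial.coeff_eq_zero_of_natDegree_lt (by rw [hJ, hnd]; exact hi)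
      rw [Polynomial.degree_lt_iff_coeff_zero]
      intro i hi
      rw [show (X - C x₀) * J.derivative - (n : ℝ) • J =
        X * J.derivative - C x₀ * J.derivative - (n : ℝ) • J by ring]
      rcases i with _ | i
      · obtain rfl : n = 0 := by omega
        simp [Polynomial.coeff_derivative, hc 1]
      · simp only [Polynomial.coeff_sub, Polynomial.coeff_X_mul, Polynomial.coeff_C_mul,
          Polynomial.coeff_derivative, Polynomial.coeff_smul, smul_eq_mul]
        rw [hc (i + 1 + 1) (by omega)]
        rcases hi.eq_or_lt with h | h
        · rw [h]; push_cast; ring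
        · rw [hc _ h]; ring
    have h0 := inner_jacobiPoly_of_degree_lt ha hb hdeg
    rw [map_sub, map_smul, inner_sub_right, inner_smul_right, real_inner_self_eq_norm_sq,
      sub_eq_zero] at h0
    exact h0
  rw [h2, h3] at h
  rw [← h]
  congr! 2 with x
  simp

/-- The factor `ρ` in the Rellich identity has a positive minimum on `[-1,1]`: `1-x²` vanishes only
at `±1`, whereas `x₀` is neither end point. The right-hand side of the identity is of order `n³
‖J_n‖²`. -/
lemma exists_norm_derivative_jacobiPoly_sq_le {a b : ℝ} (ha : -1 < a) (hb : -1 < b) :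
    ∃ K : ℝ, 0 ≤ K ∧ ∀ n : ℕ, ‖polyL2 ha hb (jacobiPoly a b n).derivative‖ ^ 2 ≤
      K * (n : ℝ) ^ 3 * ‖polyL2 ha hb (jacobiPoly a b n)‖ ^ 2 := by
  have hσ : 0 < a + b + 2 := by linarith
  set x₀ := (b - a) / (a + b + 2) with hx₀
  have hx₀' : (a + b + 2) * x₀ = b - a := by rw [hx₀]; field_simp
  set ρ : ℝ → ℝ := fun x => 1 - x ^ 2 + (a + b + 2) * (x - x₀) ^ 2 with hρ
  obtain ⟨y, hy, hmin⟩ := (isCompact_Icc (a := (-1 : ℝ)) (b := 1)).exists_isMinOn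
    ⟨0, by norm_num⟩ (f := ρ) (by fun_prop)
  have hpos : 0 < ρ y := by
    have h0 : 0 ≤ (a + b + 2) * (y - x₀) ^ 2 := by positivity
    have h1 : 0 ≤ 1 - y ^ 2 := by nlinarith [hy.1, hy.2]
    rcases h1.eq_or_lt with h | h
    · have hne : y - x₀ ≠ 0 := by
        intro h'
        have hyx : y = x₀ := by linarith
        have : (1 - y) * (1 + y) = 0 := by linarith
        rcases mul_eq_zero.1 this with h2 | h2
        · have : x₀ = 1 := by linarith
          rw [this] at hx₀'; linarith
        · have : x₀ = -1 := by linarith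
          rw [this] at hx₀'; linarith
      have : 0 < (a + b + 2) * (y - x₀) ^ 2 := by positivity
      simp only [hρ]; linarith
    · simp only [hρ]; linarith
  refine ⟨2 * (1 + |a + b + 1|) / ρ y, by positivity, fun n => ?_⟩
  set J := jacobiPoly a b n
  have hI : ∀ p : Polynomial ℝ,
      IntegrableOn (fun x => jacobiWeight a b x * p.eval x) (Ioo (-1) 1) := by
    intro p
    have := isFiniteMeasure_jacobiMeasure ha hb
    exact (integrable_jacobiMeasure_iff _ _ _).1
      ((memLp_of_continuous ha hb p.continuous).integrable (by norm_num))
  have h1 : ρ y * ‖polyL2 ha hb J.derivative‖ ^ 2 ≤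
      2 * jacobiEigen a b n * (n * ‖polyL2 ha hb J‖ ^ 2) := by
    rw [← integral_derivative_jacobiPoly_sq, ← real_inner_self_eq_norm_sq, inner_polyL2,
      ← integral_const_mul]
    refine setIntegral_mono_on ((hI _).const_mul _) ?_ measurableSet_Ioo fun x hx => ?_
    · have := hI ((1 - X ^ 2 + C (a + b + 2) * (X - C x₀) ^ 2) * J.derivative ^ 2)
      simpa using this
    · have h2 : ρ y ≤ ρ x := hmin (Ioo_subset_Icc_self hx)
      rw [Polynomial.eval_mul]
      have h3 : 0 ≤ jacobiWeight a b x * J.derivative.eval x ^ 2 :=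
        mul_nonneg (jacobiWeight_pos a b hx).le (sq_nonneg _)
      calc _ = ρ y * (jacobiWeight a b x * J.derivative.eval x ^ 2) := by ring
        _ ≤ ρ x * (jacobiWeight a b x * J.derivative.eval x ^ 2) :=
          mul_le_mul_of_nonneg_right h2 h3
        _ = _ := by ring
  have h2 : jacobiEigen a b n * n ≤ (1 + |a + b + 1|) * (n : ℝ) ^ 3 := by
    rcases Nat.eq_zero_or_pos n with rfl | hn
    · simp
    · have hn' : (1 : ℝ) ≤ n := by exact_mod_cast hn
      have h3 : (n : ℝ) + a + b + 1 ≤ (1 + |a + b + 1|) * n := by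
        nlinarith [le_abs_self (a + b + 1), abs_nonneg (a + b + 1)]
      rw [jacobiEigen]
      calc (n : ℝ) * (n + a + b + 1) * n = (n : ℝ) ^ 2 * (n + a + b + 1) := by ring
        _ ≤ (n : ℝ) ^ 2 * ((1 + |a + b + 1|) * n) := by gcongr
        _ = _ := by ring
  rw [div_mul_eq_mul_div, div_mul_eq_mul_div, le_div_iff₀ hpos]
  nlinarith [mul_le_mul_of_nonneg_right h2 (sq_nonneg ‖polyL2 ha hb J‖)]

/-- Markov's inequality in the weighted `L²` norm. -/
lemma exists_norm_derivative_le {a b : ℝ} (ha : -1 < a) (hb : -1 < b) :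
    ∃ K : ℝ, 0 ≤ K ∧ ∀ (m : ℕ) (p : Polynomial ℝ), p.degree < m →
      ‖polyL2 ha hb p.derivative‖ ≤ K * (m : ℝ) ^ 2 * ‖polyL2 ha hb p‖ := by
  obtain ⟨K, hK0, hK⟩ := exists_norm_derivative_jacobiPoly_sq_le ha hb
  refine ⟨Real.sqrt K, by positivity, fun m p hp => ?_⟩
  obtain ⟨c, rfl⟩ := eq_sum_jacobiPoly ha hb hp
  refine (sq_le_sq₀ (norm_nonneg _) (by positivity)).1 ?_
  rw [mul_pow, mul_pow, Real.sq_sqrt hK0, norm_sum_jacobiPoly_sq]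
  set h : ℕ → ℝ := fun n => ‖polyL2 ha hb (jacobiPoly a b n)‖
  have h1 : ‖polyL2 ha hb (∑ i ∈ Finset.range m, c i • jacobiPoly a b i).derivative‖ ≤
      ∑ i ∈ Finset.range m, Real.sqrt (K * (i : ℝ) ^ 3) * (|c i| * h i) := by
    rw [Polynomial.derivative_sum, map_sum]
    refine (norm_sum_le _ _).trans (Finset.sum_le_sum fun i _ => ?_)
    rw [Polynomial.derivative_smul, map_smul, norm_smul, Real.norm_eq_abs, mul_left_comm]
    refine mul_le_mul_of_nonneg_left ?_ (abs_nonneg _)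
    refine (sq_le_sq₀ (norm_nonneg _) (by positivity)).1 ?_
    rw [mul_pow, Real.sq_sqrt (by positivity)]
    exact hK i
  refine (pow_le_pow_left₀ (norm_nonneg _) h1 2).trans ?_
  -- Cauchy–Schwarz: the sum of `K i³` over `i < m` is at most `K m⁴`, whose square root is the
  -- Markov factor.
  refine (Finset.sum_mul_sq_le_sq_mul_sq _ _ _).trans ?_
  have e : ∀ i, (|c i| * h i) ^ 2 = c i ^ 2 * ‖polyL2 ha hb (jacobiPoly a b i)‖ ^ 2 := by
    intro i; rw [mul_pow, sq_abs]
  simp only [e]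
  refine mul_le_mul_of_nonneg_right ?_ (Finset.sum_nonneg fun i _ => by positivity)
  calc ∑ i ∈ Finset.range m, Real.sqrt (K * (i : ℝ) ^ 3) ^ 2
      ≤ ∑ i ∈ Finset.range m, K * (m : ℝ) ^ 3 := by
        refine Finset.sum_le_sum fun i hi => ?_
        rw [Real.sq_sqrt (by positivity)]
        have : (i : ℝ) ≤ m := by exact_mod_cast (Finset.mem_range.1 hi).le
        gcongr
    _ = K * ((m : ℝ) ^ 2) ^ 2 := by
        rw [Finset.sum_const, Finset.card_range, nsmul_eq_mul]; ring

lemma exists_norm_iterate_derivative_le {a b : ℝ} (ha : -1 < a) (hb : -1 < b) (r : ℕ) :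
    ∃ K : ℝ, 0 ≤ K ∧ ∀ (m : ℕ) (p : Polynomial ℝ), p.degree < m →
      ‖polyL2 ha hb (Polynomial.derivative^[r] p)‖ ≤ K * (m : ℝ) ^ (2 * r) * ‖polyL2 ha hb p‖ := by
  induction r with
  | zero => exact ⟨1, zero_le_one, fun m p _ => by simp⟩
  | succ r ih =>
    obtain ⟨K, hK0, hK⟩ := ih
    obtain ⟨K', hK0', hK'⟩ := exists_norm_derivative_le ha hb
    refine ⟨K * K', by positivity, fun m p hp => ?_⟩
    rw [Function.iterate_succ_apply]
    have hp' : p.derivative.degree < m := (Polynomial.degree_derivative_le).trans_lt hp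
    calc _ ≤ K * (m : ℝ) ^ (2 * r) * ‖polyL2 ha hb p.derivative‖ := hK m _ hp'
      _ ≤ K * (m : ℝ) ^ (2 * r) * (K' * (m : ℝ) ^ 2 * ‖polyL2 ha hb p‖) := by
        gcongr; exact hK' m p hp
      _ = _ := by ring

/-! ### Polynomials almost orthogonal to lower degree polynomials -/

lemma exists_derivative_eq {q : Polynomial ℝ} {m : ℕ} (hq : q.degree < m) :
    ∃ p : Polynomial ℝ, p.derivative = q ∧ p.degree < (m + 1 : ℕ) := by
  refine ⟨∑ i ∈ Finset.range m, Polynomial.monomial (i + 1) (q.coeff i / (i + 1)), ?_, ?_⟩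
  · rw [Polynomial.degree_lt_iff_coeff_zero] at hq
    ext i
    have : (i : ℝ) + 1 ≠ 0 := by positivity
    simp only [Polynomial.coeff_derivative, Polynomial.finsetSum_coeff,
      Polynomial.coeff_monomial, Nat.add_right_cancel_iff, Finset.sum_ite_eq', Finset.mem_range]
    split_ifs with h
    · field_simp
    · rw [hq i (not_lt.1 h), zero_mul]
  · rw [← Polynomial.mem_degreeLT]
    refine Submodule.sum_mem _ fun i hi => ?_
    rw [Polynomial.mem_degreeLT]
    refine (Polynomial.degree_monomial_le _ _).trans_lt ?_
    exact_mod_cast Nat.succ_lt_succ (Finset.mem_range.1 hi)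

/-- Orthogonality leaves only `J_{m+1}'` and `J_{m+2}'` in the expansion of `q` in derivatives of
Jacobi polynomials. For these the squared norms are at most of order `m³` in the original weight and
at least of order `m²` in the raised one, relative to `‖J_n‖²`; the ratio yields the factor
`√(m+1)`. -/
lemma exists_norm_le_of_polyOrth_add_one {a b : ℝ} (ha : -1 < a) (hb : -1 < b) :
    ∃ K : ℝ, 0 ≤ K ∧ ∀ (m : ℕ) (q : Polynomial ℝ), q.degree < (m + 2 : ℕ) →
      PolyOrth (a + 1) (b + 1) m (fun x => q.eval x) →
      ‖polyL2 ha hb q‖ ≤ K * Real.sqrt (m + 1 : ℕ) *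
        ‖polyL2 (neg_one_lt_add_one ha) (neg_one_lt_add_one hb) q‖ := by
  obtain ⟨K, hK0, hK⟩ := exists_norm_derivative_jacobiPoly_sq_le ha hb
  obtain ⟨κ, hκ0, hκ⟩ := exists_mul_sq_le_jacobiEigen ha hb
  have ha' := neg_one_lt_add_one ha
  have hb' := neg_one_lt_add_one hb
  refine ⟨Real.sqrt (16 * K / κ), by positivity, fun m q hq horth => ?_⟩
  obtain ⟨p, rfl, hp⟩ := exists_derivative_eq hq
  obtain ⟨c, rfl⟩ := eq_sum_jacobiPoly ha hb hp
  have hd : (∑ i ∈ Finset.range (m + 2 + 1), c i • jacobiPoly a b i).derivative =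
      ∑ i ∈ Finset.range (m + 2 + 1), c i • (jacobiPoly a b i).derivative := by
    rw [Polynomial.derivative_sum]; simp
  have hc : ∀ i, 1 ≤ i → i ≤ m → c i = 0 := by
    intro i hi him
    have h1 := horth (jacobiPoly a b i).derivative (by
      refine degree_derivative_lt_of_lt_succ ?_
      rw [degree_jacobiPoly ha hb]
      exact_mod_cast Nat.lt_succ_of_le him)
    have h2 := inner_derivative_jacobiPoly ha hb i
      (∑ i ∈ Finset.range (m + 2 + 1), c i • jacobiPoly a b i)
    rw [inner_polyL2] at h2
    simp only [Polynomial.eval_mul] at h2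
    simp only [mul_comm (Polynomial.eval _ (Polynomial.derivative (∑ i ∈ _, _)))] at h1
    rw [h1, inner_jacobiPoly_sum ha hb (by omega)] at h2
    have h3 := jacobiEigen_pos ha hb hi
    have h4 := norm_jacobiPoly_pos ha hb i
    have : c i * (jacobiEigen a b i * ‖polyL2 ha hb (jacobiPoly a b i)‖ ^ 2) = 0 := by
      rw [h2]; ring
    exact (mul_eq_zero.1 this).resolve_right (by positivity)
  set J1 := jacobiPoly a b (m + 1)
  set J2 := jacobiPoly a b (m + 2)
  have hq2 : (∑ i ∈ Finset.range (m + 2 + 1), c i • jacobiPoly a b i).derivative =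
      c (m + 1) • J1.derivative + c (m + 2) • J2.derivative := by
    rw [hd, Finset.sum_range_succ, Finset.sum_range_succ, Finset.sum_eq_zero, zero_add]
    intro i hi
    rcases Nat.eq_zero_or_pos i with rfl | hi0
    · have : (jacobiPoly a b 0).derivative = 0 :=
        Polynomial.derivative_of_natDegree_zero (natDegree_jacobiPoly ha hb 0)
      rw [this, smul_zero]
    · rw [hc i hi0 (by have := Finset.mem_range.1 hi; omega), zero_smul]
  rw [hq2]
  set A := c (m + 1) ^ 2 * ‖polyL2 ha hb J1‖ ^ 2 with hA
  set B := c (m + 2) ^ 2 * ‖polyL2 ha hb J2‖ ^ 2 with hB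
  have hA0 : 0 ≤ A := by positivity
  have hB0 : 0 ≤ B := by positivity
  have h1 : ‖polyL2 ha' hb' (c (m + 1) • J1.derivative + c (m + 2) • J2.derivative)‖ ^ 2 =
      jacobiEigen a b (m + 1) * A + jacobiEigen a b (m + 2) * B := by
    rw [map_add, map_smul, map_smul, norm_add_sq_real, norm_smul, norm_smul, mul_pow, mul_pow,
      norm_derivative_jacobiPoly_sq ha hb, norm_derivative_jacobiPoly_sq ha hb, inner_smul_right,
      real_inner_smul_left, inner_derivative_jacobiPoly ha hb,
      inner_jacobiPoly_of_ne ha hb (by omega), hA, hB, Real.norm_eq_abs, Real.norm_eq_abs, sq_abs,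
      sq_abs]
    ring
  set N : ℝ := ((m + 1 : ℕ) : ℝ) with hN
  have hN1 : 1 ≤ N := by rw [hN]; push_cast; linarith [m.cast_nonneg (α := ℝ)]
  have h2 : κ * N ^ 2 * (A + B) ≤
      ‖polyL2 ha' hb' (c (m + 1) • J1.derivative + c (m + 2) • J2.derivative)‖ ^ 2 := by
    rw [h1]
    have e1 := hκ (m + 1)
    have e2 := (hκ (m + 1)).trans ((jacobiEigen_strictMono ha hb).monotone (Nat.le_succ (m + 1)))
    nlinarith [mul_le_mul_of_nonneg_right e1 hA0, mul_le_mul_of_nonneg_right e2 hB0]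
  -- The factor 16 is `2 · 8`: the square of a sum of two terms, and `(m+2)³ ≤ 8 (m+1)³`.
  have h3 : ‖polyL2 ha hb (c (m + 1) • J1.derivative + c (m + 2) • J2.derivative)‖ ^ 2 ≤
      16 * K * N ^ 3 * (A + B) := by
    have t : ‖polyL2 ha hb (c (m + 1) • J1.derivative + c (m + 2) • J2.derivative)‖ ^ 2 ≤
        2 * (‖c (m + 1) • polyL2 ha hb J1.derivative‖ ^ 2 +
          ‖c (m + 2) • polyL2 ha hb J2.derivative‖ ^ 2) := by
      rw [map_add, map_smul, map_smul]
      exact (pow_le_pow_left₀ (norm_nonneg _) (norm_add_le _ _) 2).trans (add_sq_le)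
    refine t.trans ?_
    rw [norm_smul, norm_smul, mul_pow, mul_pow, Real.norm_eq_abs, Real.norm_eq_abs, sq_abs, sq_abs]
    have e1 : c (m + 1) ^ 2 * ‖polyL2 ha hb J1.derivative‖ ^ 2 ≤ K * N ^ 3 * A := by
      refine (mul_le_mul_of_nonneg_left (hK (m + 1)) (sq_nonneg _)).trans_eq ?_
      rw [hA]; ring
    have e2 : c (m + 2) ^ 2 * ‖polyL2 ha hb J2.derivative‖ ^ 2 ≤ K * (8 * N ^ 3) * B := by
      refine (mul_le_mul_of_nonneg_left (hK (m + 2)) (sq_nonneg _)).trans ?_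
      have : ((m + 2 : ℕ) : ℝ) ≤ 2 * N := by rw [hN]; push_cast; linarith [m.cast_nonneg (α := ℝ)]
      have h8 : ((m + 2 : ℕ) : ℝ) ^ 3 ≤ 8 * N ^ 3 := by
        calc ((m + 2 : ℕ) : ℝ) ^ 3 ≤ (2 * N) ^ 3 := by gcongr
          _ = _ := by ring
      rw [hB]
      calc _ = K * ((m + 2 : ℕ) : ℝ) ^ 3 * (c (m + 2) ^ 2 * ‖polyL2 ha hb J2‖ ^ 2) := by ring
        _ ≤ _ := by gcongr
    have e3 : 0 ≤ K * N ^ 3 * A := by positivity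
    nlinarith
  refine (sq_le_sq₀ (norm_nonneg _) (by positivity)).1 (h3.trans ?_)
  rw [mul_pow, mul_pow, Real.sq_sqrt (by positivity), Real.sq_sqrt (by positivity)]
  calc 16 * K * N ^ 3 * (A + B) = 16 * K / κ * N * (κ * N ^ 2 * (A + B)) := by field_simp
    _ ≤ _ := by gcongr

end

end JacobiWavelet

namespace JacobiWavelet

open Polynomial (C X)
open scoped RealInnerProductSpace

noncomputable section

/-! ### Approximation in weighted Sobolev norms on `(-1,1)` -/

/-- Testing `p` in the raised weight is testing `(1-x²) p` in the original one, at the cost of two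
degrees. -/
lemma PolyOrth.add_one {a b : ℝ} {m : ℕ} {f : ℝ → ℝ} (h : PolyOrth a b (m + 2) f) :
    PolyOrth (a + 1) (b + 1) m f := by
  intro p hp
  have hdeg : Polynomial.degree ((1 - X ^ 2) * p) < (m + 2 : ℕ) := by
    rw [Polynomial.degree_lt_iff_coeff_zero] at hp ⊢
    intro i hi
    obtain ⟨i, rfl⟩ : ∃ i', i = i' + 2 := ⟨i - 2, by omega⟩
    rw [show (1 - X ^ 2) * p = p - p * X ^ 2 by ring, Polynomial.coeff_sub,
      Polynomial.coeff_mul_X_pow, hp _ (by omega), hp _ (by omega), sub_zero]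
  rw [← h _ hdeg]
  refine setIntegral_congr_fun measurableSet_Ioo fun x hx => ?_
  simp only [jacobiWeight_add_one a b hx, Polynomial.eval_mul, Polynomial.eval_sub,
    Polynomial.eval_one, Polynomial.eval_pow, Polynomial.eval_X]
  ring

lemma PolyOrth.mono {a b : ℝ} {m m' : ℕ} {f : ℝ → ℝ} (h : PolyOrth a b m f) (hm : m' ≤ m) :
    PolyOrth a b m' f :=
  fun p hp => h p (hp.trans_le (by exact_mod_cast hm))

lemma PolyOrth.sub {a b : ℝ} (ha : -1 < a) (hb : -1 < b) {m : ℕ} {f g : ℝ → ℝ}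
    (hfm : MemLp f 2 (jacobiMeasure a b)) (hgm : MemLp g 2 (jacobiMeasure a b))
    (hf : PolyOrth a b m f) (hg : PolyOrth a b m g) : PolyOrth a b m (fun x => f x - g x) := by
  have e : (hfm.sub hgm).toLp _ = hfm.toLp f - hgm.toLp g := MemLp.toLp_sub hfm hgm
  refine (polyOrth_iff ha hb (hfm.sub hgm)).2 fun p hp => ?_
  rw [e, inner_sub_right, (polyOrth_iff ha hb hfm).1 hf p hp, (polyOrth_iff ha hb hgm).1 hg p hp,
    sub_zero]

/-- The commutator of projection and differentiation. -/
lemma exists_norm_jacobiProj_sub_derivative_le {a b : ℝ} (ha : -1 < a) (hb : -1 < b) :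
    ∃ K : ℝ, 0 ≤ K ∧ ∀ (m : ℕ) (f g : ℝ → ℝ), MemLp f 2 (jacobiMeasure a b) →
      MemLp g 2 (jacobiMeasure a b) → IsPrimitive (-1) 1 f g →
      ‖polyL2 ha hb (jacobiProj a b (m + 2) g - (jacobiProj a b (m + 2) f).derivative)‖ ≤
        K * Real.sqrt (m + 1 : ℕ) * l2Norm (jacobiWeight a b) (-1) 1
          (fun x => g x - (jacobiProj a b (m + 1) g).eval x) := by
  obtain ⟨K, hK0, hK⟩ := exists_norm_le_of_polyOrth_add_one ha hb
  have ha' := neg_one_lt_add_one ha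
  have hb' := neg_one_lt_add_one hb
  refine ⟨K * 2, by positivity, fun m f g hf hg hfg => ?_⟩
  set P := jacobiProj a b (m + 2) f
  set Q := jacobiProj a b (m + 2) g
  set R := jacobiProj a b (m + 1) g
  have hP := polyOrth_sub_jacobiProj ha hb (m + 2) hf
  have hQ := polyOrth_sub_jacobiProj ha hb (m + 2) hg
  have hPd := degree_jacobiProj_lt ha hb (m + 2) f
  have hQd := degree_jacobiProj_lt ha hb (m + 2) g
  have hRd := degree_jacobiProj_lt ha hb (m + 1) g
  have hP'd := degree_derivative_lt_of_lt_succ hPd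
  have hprim := hfg.sub (by norm_num) (isPrimitive_eval (-1) 1 P)
  have hP' : PolyOrth (a + 1) (b + 1) (m + 1) (fun x => g x - P.derivative.eval x) :=
    hP.of_isPrimitive ha hb hprim
  have hm1 := memLp_add_one (memLp_sub_eval ha hb hg P.derivative)
  have hm2 := memLp_add_one (memLp_sub_eval ha hb hg Q)
  have e : (fun x => (Q - P.derivative).eval x) =
      fun x => (g x - P.derivative.eval x) - (g x - Q.eval x) := by
    funext x; simp
  -- The commutator is the difference of two errors for `g`, both orthogonal to low degrees in the
  -- raised weight: one by differentiating the error of `f`, the other by the previous lemma on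
  -- raising exponents.
  have horth : PolyOrth (a + 1) (b + 1) m (fun x => (Q - P.derivative).eval x) := by
    rw [e]
    exact (hP'.mono m.le_succ).sub ha' hb' hm1 hm2 hQ.add_one
  have hdeg : (Q - P.derivative).degree < (m + 2 : ℕ) :=
    (Polynomial.degree_sub_le _ _).trans_lt
      (max_lt hQd (hP'd.trans (by exact_mod_cast Nat.lt_succ_self _)))
  have h1 := hK m _ hdeg horth
  have h2 : ‖polyL2 ha' hb' (Q - P.derivative)‖ ≤
      l2Norm (jacobiWeight (a + 1) (b + 1)) (-1) 1 (fun x => g x - P.derivative.eval x) +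
      l2Norm (jacobiWeight (a + 1) (b + 1)) (-1) 1 (fun x => g x - Q.eval x) := by
    rw [← l2Norm_eval, e]
    exact l2Norm_sub_le hm1 hm2
  -- In the raised weight `P'` is the best approximation of `g` in degree at most `m`, so it does no
  -- worse than `R`.
  have h3 : l2Norm (jacobiWeight (a + 1) (b + 1)) (-1) 1 (fun x => g x - P.derivative.eval x) ≤
      l2Norm (jacobiWeight a b) (-1) 1 (fun x => g x - R.eval x) := by
    have hd : (R - P.derivative).degree < (m + 1 : ℕ) :=
      (Polynomial.degree_sub_le _ _).trans_lt (max_lt hRd hP'd)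
    have := hP'.l2Norm_le ha' hb' hm1 hd
    simp only [Polynomial.eval_sub, sub_sub_sub_cancel_right] at this
    exact this.trans (l2Norm_add_one_le (memLp_sub_eval ha hb hg R))
  have h4 : l2Norm (jacobiWeight (a + 1) (b + 1)) (-1) 1 (fun x => g x - Q.eval x) ≤
      l2Norm (jacobiWeight a b) (-1) 1 (fun x => g x - R.eval x) :=
    (l2Norm_add_one_le (memLp_sub_eval ha hb hg Q)).trans
      (l2Norm_sub_jacobiProj_le ha hb hg (hRd.trans (by exact_mod_cast Nat.lt_succ_self _)))
  calc _ ≤ K * Real.sqrt (m + 1 : ℕ) * ‖polyL2 ha' hb' (Q - P.derivative)‖ := h1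
    _ ≤ K * Real.sqrt (m + 1 : ℕ) *
        (2 * l2Norm (jacobiWeight a b) (-1) 1 (fun x => g x - R.eval x)) := by
      gcongr; linarith
    _ = _ := by ring

/-- The error of the projection of `G 0`, differentiated `r` times. -/
def projError (a b : ℝ) (m r : ℕ) (G : ℕ → ℝ → ℝ) (x : ℝ) : ℝ :=
  G r x - (Polynomial.derivative^[r] (jacobiProj a b m (G 0))).eval x

/-- Induction on `r`: the error for `G 0` differentiated `r + 1` times is the error for `G 1`
differentiated `r` times plus the commutator differentiated `r` times, which Markov's inequality
controls. Multiplying through by `N^μ √N` avoids negative and fractional exponents; the conditional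
reflects that the half power is gained only for `r ≥ 1`. -/
lemma exists_projError_le_of_le {a b : ℝ} (ha : -1 < a) (hb : -1 < b) (r : ℕ) :
    ∀ μ : ℕ, r ≤ μ → ∃ K : ℝ, 0 ≤ K ∧ ∀ N : ℕ, 1 ≤ N → μ ≤ N + 1 → ∀ G : ℕ → ℝ → ℝ,
      DerivChain a b μ G →
      (N : ℝ) ^ μ * Real.sqrt N * l2Norm (jacobiWeight a b) (-1) 1 (projError a b (N + 1) r G) ≤
        K * (N : ℝ) ^ (2 * r) * (if r = 0 then Real.sqrt N else 1) *
          l2Norm (jacobiWeight a b) (-1) 1 (G μ) := by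
  induction r with
  | zero =>
    intro μ _
    obtain ⟨K, hK0, hK⟩ := exists_pow_mul_l2Norm_sub_jacobiProj_le ha hb μ
    refine ⟨K, hK0, fun N hN hμ G hG => ?_⟩
    have h := hK (N + 1) hμ G hG
    have h0 : 0 ≤ l2Norm (jacobiWeight a b) (-1) 1 (projError a b (N + 1) 0 G) :=
      l2Norm_nonneg _ _ _ _
    change _ * l2Norm (jacobiWeight a b) (-1) 1 (projError a b (N + 1) 0 G) ≤ _ at h
    have h1 : (N : ℝ) ^ μ ≤ ((N + 1 : ℕ) : ℝ) ^ μ := by gcongr; omega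
    simp only [mul_zero, pow_zero, mul_one, if_true]
    calc (N : ℝ) ^ μ * Real.sqrt N * l2Norm (jacobiWeight a b) (-1) 1 (projError a b (N + 1) 0 G)
        = Real.sqrt N * ((N : ℝ) ^ μ *
            l2Norm (jacobiWeight a b) (-1) 1 (projError a b (N + 1) 0 G)) := by ring
      _ ≤ Real.sqrt N * (K * l2Norm (jacobiWeight a b) (-1) 1 (G μ)) := by
          refine mul_le_mul_of_nonneg_left (le_trans ?_ h) (Real.sqrt_nonneg _)
          gcongr
      _ = _ := by ring
  | succ r ih =>
    intro μ hrμ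
    obtain ⟨μ, rfl⟩ : ∃ μ', μ = μ' + 1 := ⟨μ - 1, by omega⟩
    obtain ⟨K₁, hK₁0, hK₁⟩ := ih μ (by omega)
    obtain ⟨K₂, hK₂0, hK₂⟩ := exists_norm_iterate_derivative_le ha hb r
    obtain ⟨K₃, hK₃0, hK₃⟩ := exists_norm_jacobiProj_sub_derivative_le ha hb
    obtain ⟨K₄, hK₄0, hK₄⟩ := exists_pow_mul_l2Norm_sub_jacobiProj_le ha hb μ
    refine ⟨K₁ + K₂ * 2 ^ (2 * r) * K₃ * K₄, by positivity, fun N hN hμ G hG => ?_⟩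
    obtain ⟨M, rfl⟩ : ∃ M, N = M + 1 := ⟨N - 1, by omega⟩
    have htail := hG.tail
    have i1 := hK₁ (M + 1) hN (by omega) _ htail
    set P := jacobiProj a b (M + 2) (G 0)
    set Q := jacobiProj a b (M + 2) (G 1)
    have hQdeg : (Q - P.derivative).degree < (M + 2 : ℕ) :=
      (Polynomial.degree_sub_le _ _).trans_lt (max_lt (degree_jacobiProj_lt ha hb _ _)
        ((degree_derivative_lt_of_lt_succ (degree_jacobiProj_lt ha hb _ _)).trans
          (by exact_mod_cast Nat.lt_succ_self _)))
    have i2 := hK₂ (M + 2) _ hQdeg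
    have i3 := hK₃ M (G 0) (G 1) (hG.memLp 0 (by omega)) (hG.memLp 1 (by omega))
      (hG.isPrimitive 0 (by omega))
    have i4 := hK₄ (M + 1) (by omega) _ htail
    set A := l2Norm (jacobiWeight a b) (-1) 1 (G (μ + 1))
    have hA : 0 ≤ A := l2Norm_nonneg _ _ _ _
    set E := l2Norm (jacobiWeight a b) (-1) 1
      (fun x => G 1 x - (jacobiProj a b (M + 1) (G 1)).eval x)
    set E₁ := l2Norm (jacobiWeight a b) (-1) 1
      (projError a b (M + 1 + 1) r (fun j => G (j + 1)))
    set q := ‖polyL2 ha hb (Q - P.derivative)‖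
    set q' := ‖polyL2 ha hb (Polynomial.derivative^[r] (Q - P.derivative))‖
    have hsplit : l2Norm (jacobiWeight a b) (-1) 1 (projError a b (M + 1 + 1) (r + 1) G) ≤
        E₁ + q' := by
      have e : projError a b (M + 1 + 1) (r + 1) G = fun x =>
          projError a b (M + 1 + 1) r (fun j => G (j + 1)) x +
            (Polynomial.derivative^[r] (Q - P.derivative)).eval x := by
        funext x
        simp only [projError, Function.iterate_succ_apply, Polynomial.iterate_derivative_sub,
          Polynomial.eval_sub]
        ring
      rw [e]
      refine (l2Norm_add_le (memLp_sub_eval ha hb (hG.memLp (r + 1) hrμ) _)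
        (memLp_of_continuous ha hb (Polynomial.continuous _))).trans_eq ?_
      rw [l2Norm_eval ha hb]
      rfl
    set n : ℝ := ((M + 1 : ℕ) : ℝ) with hn
    have hn1 : 1 ≤ n := by rw [hn]; exact_mod_cast hN
    have hn0 : 0 ≤ n := by linarith
    have hs : Real.sqrt n * Real.sqrt n = n := Real.mul_self_sqrt hn0
    have hs0 := Real.sqrt_nonneg n
    -- The recursive term has room to spare: the induction step allows a factor `n²`, of which one
    -- power replaces the lost smoothness.
    have hs1 : (if r = 0 then Real.sqrt n else 1) ≤ n := by
      split_ifs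
      · rw [Real.sqrt_le_left hn0]; nlinarith
      · exact hn1
    have j1 : n ^ (μ + 1) * Real.sqrt n * E₁ ≤ K₁ * n ^ (2 * (r + 1)) * A := by
      calc n ^ (μ + 1) * Real.sqrt n * E₁ = n * (n ^ μ * Real.sqrt n * E₁) := by ring
        _ ≤ n * (K₁ * n ^ (2 * r) * (if r = 0 then Real.sqrt n else 1) * A) := by gcongr
        _ ≤ n * (K₁ * n ^ (2 * r) * n * A) := by gcongr
        _ = _ := by ring
    have hm2 : ((M + 2 : ℕ) : ℝ) ≤ 2 * n := by
      rw [hn]; push_cast; linarith [M.cast_nonneg (α := ℝ)]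
    have j2 : n ^ (μ + 1) * Real.sqrt n * q' ≤
        K₂ * 2 ^ (2 * r) * K₃ * K₄ * n ^ (2 * (r + 1)) * A := by
      have k1 : q' ≤ K₂ * (2 * n) ^ (2 * r) * (K₃ * Real.sqrt n * E) := by
        refine i2.trans ?_
        gcongr
      calc n ^ (μ + 1) * Real.sqrt n * q'
          ≤ n ^ (μ + 1) * Real.sqrt n * (K₂ * (2 * n) ^ (2 * r) * (K₃ * Real.sqrt n * E)) := by
            gcongr
        _ = n * (Real.sqrt n * Real.sqrt n) * (K₂ * (2 * n) ^ (2 * r) * K₃) * (n ^ μ * E) := by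
            ring
        _ ≤ n * (Real.sqrt n * Real.sqrt n) * (K₂ * (2 * n) ^ (2 * r) * K₃) * (K₄ * A) := by
            gcongr
        _ = _ := by rw [hs, mul_pow]; ring
    rw [if_neg (by omega), mul_one]
    calc _ ≤ n ^ (μ + 1) * Real.sqrt n * (E₁ + q') := by gcongr
      _ = n ^ (μ + 1) * Real.sqrt n * E₁ + n ^ (μ + 1) * Real.sqrt n * q' := by ring
      _ ≤ _ := by linarith

/-- The approximation estimate on the reference interval. -/
lemma exists_projError_le {a b : ℝ} (ha : -1 < a) (hb : -1 < b) (μ : ℕ) :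
    ∃ K : ℝ, 0 ≤ K ∧ ∀ N : ℕ, 1 ≤ N → ∀ G : ℕ → ℝ → ℝ, DerivChain a b μ G → ∀ r ≤ μ,
      (N : ℝ) ^ μ * Real.sqrt N * l2Norm (jacobiWeight a b) (-1) 1 (projError a b (N + 1) r G) ≤
        K * (N : ℝ) ^ (2 * r) * (if r = 0 then Real.sqrt N else 1) *
          Real.sqrt (∑ j ∈ Finset.Icc (min μ (N + 1)) μ,
            l2Norm (jacobiWeight a b) (-1) 1 (G j) ^ 2) := by
  -- The condition `r ≤ μ'` stands after the constant so that `choose` yields a total function;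
  -- summing its values for `r, μ' ≤ μ` gives a constant independent of `N`.
  have H : ∀ r μ' : ℕ, ∃ K : ℝ, 0 ≤ K ∧ (r ≤ μ' → ∀ N : ℕ, 1 ≤ N → μ' ≤ N + 1 → ∀ G : ℕ → ℝ → ℝ,
      DerivChain a b μ' G →
      (N : ℝ) ^ μ' * Real.sqrt N * l2Norm (jacobiWeight a b) (-1) 1 (projError a b (N + 1) r G) ≤
        K * (N : ℝ) ^ (2 * r) * (if r = 0 then Real.sqrt N else 1) *
          l2Norm (jacobiWeight a b) (-1) 1 (G μ')) := by
    intro r μ'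
    by_cases h : r ≤ μ'
    · obtain ⟨K, hK0, hK⟩ := exists_projError_le_of_le ha hb r μ' h
      exact ⟨K, hK0, fun _ => hK⟩
    · exact ⟨0, le_rfl, fun h' => absurd h' h⟩
  choose K hK0 hK using H
  set K' := ∑ r ∈ Finset.range (μ + 1), ∑ μ' ∈ Finset.range (μ + 1), K r μ' with hK'
  have hK'0 : 0 ≤ K' := Finset.sum_nonneg fun _ _ => Finset.sum_nonneg fun _ _ => hK0 _ _
  have hle : ∀ r ≤ μ, ∀ μ' ≤ μ, K r μ' ≤ K' := fun r hr μ' hμ' =>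
    (Finset.single_le_sum (f := fun μ' => K r μ') (fun _ _ => hK0 _ _)
      (Finset.mem_range.2 (Nat.lt_succ_of_le hμ'))).trans
    (Finset.single_le_sum (f := fun r => ∑ μ' ∈ Finset.range (μ + 1), K r μ')
      (fun _ _ => Finset.sum_nonneg fun _ _ => hK0 _ _)
      (Finset.mem_range.2 (Nat.lt_succ_of_le hr)))
  refine ⟨(K' + 1) * ((μ : ℝ) + 1) ^ (μ + 1), by positivity, fun N hN G hG r hr => ?_⟩
  set S := Real.sqrt (∑ j ∈ Finset.Icc (min μ (N + 1)) μ,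
            l2Norm (jacobiWeight a b) (-1) 1 (G j) ^ 2) with hS
  have hS0 : 0 ≤ S := Real.sqrt_nonneg _
  have hGS : ∀ j, min μ (N + 1) ≤ j → j ≤ μ → l2Norm (jacobiWeight a b) (-1) 1 (G j) ≤ S := by
    intro j h1 h2
    refine Real.le_sqrt_of_sq_le ?_
    exact Finset.single_le_sum (f := fun j => l2Norm (jacobiWeight a b) (-1) 1 (G j) ^ 2)
      (fun _ _ => sq_nonneg _) (Finset.mem_Icc.2 ⟨h1, h2⟩)
  have hN1 : (1 : ℝ) ≤ N := by exact_mod_cast hN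
  have hμ1 : (1 : ℝ) ≤ μ + 1 := by linarith [μ.cast_nonneg (α := ℝ)]
  set t : ℝ := if r = 0 then Real.sqrt N else 1 with ht
  have ht1 : 1 ≤ t := by
    rw [ht]; split_ifs
    · exact Real.one_le_sqrt.2 hN1
    · exact le_rfl
  by_cases hrN : N + 1 ≤ r
  · -- the projection has degree less than `r`
    have e : projError a b (N + 1) r G = G r := by
      funext x
      rw [projError, Polynomial.iterate_derivative_eq_zero_of_degree_lt
        ((degree_jacobiProj_lt ha hb _ _).trans_le (by exact_mod_cast hrN))]
      simp
    rw [e]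
    have h1 := hGS r ((min_le_right _ _).trans hrN) hr
    have hNμ : (N : ℝ) ≤ μ + 1 := by exact_mod_cast (by omega : N ≤ μ + 1)
    have h2 : (N : ℝ) ^ μ * Real.sqrt N ≤ ((μ : ℝ) + 1) ^ (μ + 1) := by
      rw [pow_succ]
      have : Real.sqrt N ≤ (μ : ℝ) + 1 :=
        (Real.sqrt_le_left (by linarith)).2 (by nlinarith)
      gcongr
    have h3 : (1 : ℝ) ≤ (N : ℝ) ^ (2 * r) := one_le_pow₀ hN1
    calc _ ≤ ((μ : ℝ) + 1) ^ (μ + 1) * S := by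
          have := l2Norm_nonneg (jacobiWeight a b) (-1) 1 (G r)
          gcongr
      _ = 1 * ((μ : ℝ) + 1) ^ (μ + 1) * 1 * 1 * S := by ring
      _ ≤ (K' + 1) * ((μ : ℝ) + 1) ^ (μ + 1) * (N : ℝ) ^ (2 * r) * t * S := by
          gcongr
          linarith
  -- Only `μ'` derivatives are used. If `μ' < μ`, then `N ≤ μ + 1` and the remaining powers of `N`
  -- are bounded in terms of `μ`.
  · set μ' := min μ (N + 1) with hμ'
    have h1 := hK r μ' (by omega) N hN (by omega) G (hG.mono (by omega))
    have h2 := hGS μ' le_rfl (by omega)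
    have h3 := hle r hr μ' (by omega)
    have h4 : (N : ℝ) ^ μ ≤ (N : ℝ) ^ μ' * ((μ : ℝ) + 1) ^ (μ + 1) := by
      rcases le_or_gt μ (N + 1) with h | h
      · rw [hμ', min_eq_left h]
        exact le_mul_of_one_le_right (by positivity) (one_le_pow₀ hμ1)
      · have : μ = μ' + (μ - μ') := by omega
        rw [show (N : ℝ) ^ μ = (N : ℝ) ^ μ' * (N : ℝ) ^ (μ - μ') by rw [← pow_add, ← this]]
        gcongr ?_ * ?_
        have hNμ : (N : ℝ) ≤ μ + 1 := by exact_mod_cast (by omega : N ≤ μ + 1)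
        calc (N : ℝ) ^ (μ - μ') ≤ ((μ : ℝ) + 1) ^ (μ - μ') := by gcongr
          _ ≤ _ := pow_le_pow_right₀ hμ1 (by omega)
    have hE := l2Norm_nonneg (jacobiWeight a b) (-1) 1 (projError a b (N + 1) r G)
    calc _ ≤ (N : ℝ) ^ μ' * ((μ : ℝ) + 1) ^ (μ + 1) * Real.sqrt N *
          l2Norm (jacobiWeight a b) (-1) 1 (projError a b (N + 1) r G) := by gcongr
      _ = ((μ : ℝ) + 1) ^ (μ + 1) * ((N : ℝ) ^ μ' * Real.sqrt N *
          l2Norm (jacobiWeight a b) (-1) 1 (projError a b (N + 1) r G)) := by ring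
      _ ≤ ((μ : ℝ) + 1) ^ (μ + 1) * (K r μ' * (N : ℝ) ^ (2 * r) * t *
          l2Norm (jacobiWeight a b) (-1) 1 (G μ')) := by gcongr
      _ ≤ ((μ : ℝ) + 1) ^ (μ + 1) * ((K' + 1) * (N : ℝ) ^ (2 * r) * t * S) := by
          have := l2Norm_nonneg (jacobiWeight a b) (-1) 1 (G μ')
          have h5 : K r μ' ≤ K' + 1 := by linarith
          gcongr
      _ = _ := by ring

end

end JacobiWavelet

namespace JacobiWavelet

open Polynomial (C X)

noncomputable section

/-! ### Weak derivatives on an interval -/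

/-- Smooth functions with compact support in `(a,b)`. -/
structure IsTest (a b : ℝ) (φ : ℝ → ℝ) : Prop where
  contDiff : ContDiff ℝ ∞ φ
  hasCompactSupport : HasCompactSupport φ
  tsupport_subset : tsupport φ ⊆ Ioo a b

lemma IsTest.deriv {a b : ℝ} {φ : ℝ → ℝ} (h : IsTest a b φ) : IsTest a b (deriv φ) :=
  ⟨(contDiff_infty_iff_deriv.1 h.contDiff).2, h.hasCompactSupport.deriv,
    tsupport_deriv_subset.trans h.tsupport_subset⟩

lemma IsTest.eq_zero {a b : ℝ} {φ : ℝ → ℝ} (h : IsTest a b φ) {x : ℝ} (hx : x ∉ Ioo a b) :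
    φ x = 0 :=
  image_eq_zero_of_notMem_tsupport fun hx' => hx (h.tsupport_subset hx')

lemma IsTest.iteratedDeriv {a b : ℝ} {φ : ℝ → ℝ} (h : IsTest a b φ) (j : ℕ) :
    IsTest a b (iteratedDeriv j φ) := by
  induction j generalizing φ with
  | zero => simpa using h
  | succ j ih => rw [iteratedDeriv_succ']; exact ih h.deriv

lemma IsTest.integrableOn_mul {a b : ℝ} {φ f : ℝ → ℝ} (h : IsTest a b φ)
    (hf : LocallyIntegrableOn f (Ioo a b)) : IntegrableOn (fun t => f t * φ t) (Ioo a b) := by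
  have h1 : IntegrableOn f (tsupport φ) :=
    hf.integrableOn_compact_subset h.tsupport_subset h.hasCompactSupport
  have h2 : IntegrableOn (fun t => f t * φ t) (tsupport φ) :=
    h1.mul_continuousOn h.contDiff.continuous.continuousOn h.hasCompactSupport
  have h3 : Integrable (fun t => f t * φ t) := by
    rwa [integrableOn_iff_integrable_of_support_subset] at h2
    exact (Function.support_mul_subset_right _ _).trans (subset_tsupport φ)
  exact h3.integrableOn

lemma ae_eq_zero_of_forall_isTest {a b : ℝ} {f : ℝ → ℝ} (hf : LocallyIntegrableOn f (Ioo a b))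
    (h : ∀ φ, IsTest a b φ → ∫ t in Ioo a b, f t * φ t = 0) :
    ∀ᵐ t ∂volume.restrict (Ioo a b), f t = 0 := by
  rw [ae_restrict_iff' measurableSet_Ioo]
  refine isOpen_Ioo.ae_eq_zero_of_integral_contDiff_smul_eq_zero hf fun φ h1 h2 h3 => ?_
  have ht : IsTest a b φ := ⟨h1, h2, h3⟩
  rw [← h φ ht, ← setIntegral_eq_integral_of_forall_compl_eq_zero (s := Ioo a b)]
  · simp only [smul_eq_mul, mul_comm]
  · intro x hx
    rw [ht.eq_zero hx, zero_smul]

lemma ae_eq_of_forall_isTest {a b : ℝ} {f g : ℝ → ℝ} (hf : LocallyIntegrableOn f (Ioo a b))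
    (hg : LocallyIntegrableOn g (Ioo a b))
    (h : ∀ φ, IsTest a b φ → ∫ t in Ioo a b, f t * φ t = ∫ t in Ioo a b, g t * φ t) :
    f =ᵐ[volume.restrict (Ioo a b)] g := by
  have := ae_eq_zero_of_forall_isTest (hf.sub hg) fun φ hφ => by
    simp only [Pi.sub_apply, sub_mul]
    rw [integral_sub (hφ.integrableOn_mul hf) (hφ.integrableOn_mul hg), h φ hφ, sub_self]
  filter_upwards [this] with t ht using sub_eq_zero.1 ht

lemma IsWeakDeriv.ae_eq {a b : ℝ} {j : ℕ} {f g g' : ℝ → ℝ} (h : IsWeakDeriv a b j f g)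
    (h' : IsWeakDeriv a b j f g') : g =ᵐ[volume.restrict (Ioo a b)] g' := by
  refine ae_eq_of_forall_isTest h.2.1 h'.2.1 fun φ hφ => ?_
  have := (h.2.2 φ hφ.1 hφ.2 hφ.3).symm.trans (h'.2.2 φ hφ.1 hφ.2 hφ.3)
  exact mul_left_cancel₀ (pow_ne_zero j (by norm_num)) this

lemma isWeakDeriv_weakDeriv {a b : ℝ} {j : ℕ} {f g : ℝ → ℝ} (h : IsWeakDeriv a b j f g) :
    IsWeakDeriv a b j f (weakDeriv a b j f) := by
  have h' : ∃ g, IsWeakDeriv a b j f g := ⟨g, h⟩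
  rw [weakDeriv, dif_pos h']
  exact h'.choose_spec

lemma IsWeakDeriv.ae_eq_of_zero {a b : ℝ} {f g : ℝ → ℝ} (h : IsWeakDeriv a b 0 f g) :
    f =ᵐ[volume.restrict (Ioo a b)] g :=
  IsWeakDeriv.ae_eq ⟨h.1, h.1, by simp⟩ h

/-- If `φ` is a test function, so is `φ'`; testing the order `j` relation with it gives the claim.
-/
lemma IsWeakDeriv.of_succ {a b : ℝ} {j : ℕ} {f g g' : ℝ → ℝ} (h : IsWeakDeriv a b j f g)
    (h' : IsWeakDeriv a b (j + 1) f g') : IsWeakDeriv a b 1 g g' := by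
  refine ⟨h.2.1, h'.2.1, fun φ h1 h2 h3 => ?_⟩
  have hφ : IsTest a b φ := ⟨h1, h2, h3⟩
  have e1 := h.2.2 _ hφ.deriv.1 hφ.deriv.2 hφ.deriv.3
  have e2 := h'.2.2 φ h1 h2 h3
  rw [iteratedDeriv_succ', e1, pow_succ, mul_assoc] at e2
  have := mul_left_cancel₀ (pow_ne_zero j (by norm_num)) e2
  simpa [iteratedDeriv_one] using this

lemma IsWeakDeriv.restrict {a b c d : ℝ} (hac : a ≤ c) (hdb : d ≤ b) {j : ℕ} {f g : ℝ → ℝ}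
    (h : IsWeakDeriv a b j f g) : IsWeakDeriv c d j f g := by
  have hs : Ioo c d ⊆ Ioo a b := Ioo_subset_Ioo hac hdb
  refine ⟨h.1.mono_set hs, h.2.1.mono_set hs, fun φ h1 h2 h3 => ?_⟩
  have hφ : IsTest c d φ := ⟨h1, h2, h3⟩
  have key : ∀ (u ψ : ℝ → ℝ), IsTest c d ψ →
      ∫ t in Ioo c d, u t * ψ t = ∫ t in Ioo a b, u t * ψ t := by
    intro u ψ hψ
    refine (setIntegral_eq_of_subset_of_forall_sdiff_eq_zero measurableSet_Ioo hs ?_).symm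
    intro x hx
    rw [hψ.eq_zero hx.2, mul_zero]
  rw [key _ _ (hφ.iteratedDeriv j), key _ _ hφ]
  exact h.2.2 φ h1 h2 (h3.trans hs)

lemma IsWeakDeriv.sub {a b : ℝ} {j : ℕ} {f g f' g' : ℝ → ℝ} (h : IsWeakDeriv a b j f g)
    (h' : IsWeakDeriv a b j f' g') :
    IsWeakDeriv a b j (fun t => f t - f' t) (fun t => g t - g' t) := by
  refine ⟨h.1.sub h'.1, h.2.1.sub h'.2.1, fun φ h1 h2 h3 => ?_⟩
  have hφ : IsTest a b φ := ⟨h1, h2, h3⟩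
  have hφj := hφ.iteratedDeriv j
  simp only [sub_mul]
  rw [integral_sub (hφj.integrableOn_mul h.1) (hφj.integrableOn_mul h'.1),
    integral_sub (hφ.integrableOn_mul h.2.1) (hφ.integrableOn_mul h'.2.1),
    h.2.2 φ h1 h2 h3, h'.2.2 φ h1 h2 h3, mul_sub]

lemma IsWeakDeriv.congr_left {a b : ℝ} {j : ℕ} {f f' g : ℝ → ℝ} (h : IsWeakDeriv a b j f g)
    (hf : f =ᵐ[volume.restrict (Ioo a b)] f') : IsWeakDeriv a b j f' g := by
  refine ⟨h.1.congr hf, h.2.1, fun φ h1 h2 h3 => ?_⟩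
  rw [← h.2.2 φ h1 h2 h3]
  refine integral_congr_ae ?_
  filter_upwards [hf] with t ht
  rw [ht]

lemma isWeakDeriv_eval {a b : ℝ} (hab : a ≤ b) (j : ℕ) (p : Polynomial ℝ) :
    IsWeakDeriv a b j (fun t => p.eval t) (fun t => (Polynomial.derivative^[j] p).eval t) := by
  refine ⟨(p.continuous.locallyIntegrable).locallyIntegrableOn _,
    (Polynomial.continuous _).locallyIntegrable.locallyIntegrableOn _, fun φ h1 h2 h3 => ?_⟩
  have hφ : IsTest a b φ := ⟨h1, h2, h3⟩
  clear h1 h2 h3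
  induction j generalizing φ with
  | zero => simp
  | succ j ih =>
    rw [iteratedDeriv_succ', ih _ hφ.deriv, pow_succ, mul_assoc, Function.iterate_succ_apply']
    congr 1
    rw [neg_one_mul]
    have := (isPrimitive_eval a b (Polynomial.derivative^[j] p)).integral_mul_deriv hab
      hφ.contDiff.continuous.continuousOn (hφ.eq_zero (by simp)) (hφ.eq_zero (by simp))
      (fun x _ => (hφ.contDiff.differentiable (by simp) x).hasDerivAt)
      ((hφ.deriv.contDiff.continuous.integrableOn_Icc).mono_set Ioo_subset_Icc_self)
    exact this

/-- The primitive vanishes to the left of the support of `ψ`, and to the right of it because `ψ` has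
mean zero. -/
lemma IsTest.exists_deriv_eq {a b : ℝ} (hab : a < b) {ψ : ℝ → ℝ} (hψ : IsTest a b ψ)
    (h0 : ∫ t in Ioo a b, ψ t = 0) : ∃ φ, IsTest a b φ ∧ _root_.deriv φ = ψ := by
  have hc := hψ.contDiff.continuous
  have hd : ∀ x, HasDerivAt (fun x => ∫ y in a..x, ψ y) (ψ x) x := fun x =>
    intervalIntegral.integral_hasDerivAt_right (hc.intervalIntegrable _ _)
      (hc.stronglyMeasurableAtFilter _ _) hc.continuousAt
  have hderiv : _root_.deriv (fun x => ∫ y in a..x, ψ y) = ψ := funext fun x => (hd x).deriv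
  -- The midpoint keeps the compact set nonempty when `ψ = 0`, so that its least and greatest
  -- elements exist.
  have hK : IsCompact (insert ((a + b) / 2) (tsupport ψ)) :=
    IsCompact.insert (show IsCompact (tsupport ψ) from hψ.hasCompactSupport) _
  have hKs : insert ((a + b) / 2) (tsupport ψ) ⊆ Ioo a b :=
    insert_subset ⟨by linarith, by linarith⟩ hψ.tsupport_subset
  obtain ⟨α, hα, hαm⟩ := hK.exists_isLeast (insert_nonempty _ _)
  obtain ⟨β, hβ, hβm⟩ := hK.exists_isGreatest (insert_nonempty _ _)
  have hz : ∀ x, x ∉ Icc α β → ψ x = 0 := fun x hx =>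
    image_eq_zero_of_notMem_tsupport fun hx' =>
      hx ⟨hαm (mem_insert_of_mem _ hx'), hβm (mem_insert_of_mem _ hx')⟩
  have hsupp : Function.support (fun x => ∫ y in a..x, ψ y) ⊆ Icc α β := by
    intro x hx
    by_contra hxI
    refine hx ?_
    rcases lt_or_ge x α with h | h
    · refine intervalIntegral.integral_zero_ae (ae_of_all _ fun y hy => hz y fun hy' => ?_)
      have := (uIoc_subset_uIcc hy).2
      exact absurd (hy'.1.trans this) (not_le.2 (max_lt (hKs hα).1 h))
    · have hxβ : β < x := by
        by_contra h'
        exact hxI ⟨h, not_lt.1 h'⟩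
      have e1 : ∫ y in a..b, ψ y = 0 := by
        rw [intervalIntegral.integral_of_le hab.le, integral_Ioc_eq_integral_Ioo, h0]
      have e2 : ∫ y in x..b, ψ y = 0 := by
        refine intervalIntegral.integral_zero_ae (ae_of_all _ fun y hy => hz y fun hy' => ?_)
        have := (uIoc_subset_uIcc hy).1
        exact absurd (this.trans hy'.2) (not_le.2 (lt_min hxβ (hKs hβ).2))
      have e3 := intervalIntegral.integral_add_adjacent_intervals
        (hc.intervalIntegrable (μ := volume) a x) (hc.intervalIntegrable x b)
      simpa [e1, e2] using e3
  have hts : tsupport (fun x => ∫ y in a..x, ψ y) ⊆ Icc α β :=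
    closure_minimal hsupp isClosed_Icc
  refine ⟨fun x => ∫ y in a..x, ψ y, ⟨?_, ?_, ?_⟩, hderiv⟩
  · rw [contDiff_infty_iff_deriv, hderiv]
    exact ⟨fun x => (hd x).differentiableAt, hψ.contDiff⟩
  · exact isCompact_Icc.of_isClosed_subset (isClosed_tsupport _) hts
  · exact hts.trans (Icc_subset_Ioo (hKs hα).1 (hKs hβ).2)

/-- The du Bois-Reymond lemma. -/
lemma ae_eq_const_of_forall_isTest_deriv {a b : ℝ} (hab : a < b) {h : ℝ → ℝ}
    (hh : LocallyIntegrableOn h (Ioo a b))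
    (H : ∀ φ, IsTest a b φ → ∫ t in Ioo a b, h t * deriv φ t = 0) :
    ∃ c : ℝ, ∀ᵐ t ∂volume.restrict (Ioo a b), h t = c := by
  let B : ContDiffBump ((a + b) / 2) := ⟨(b - a) / 8, (b - a) / 4, by linarith, by linarith⟩
  set χ : ℝ → ℝ := B.normed volume with hχ
  have hχt : IsTest a b χ := by
    refine ⟨B.contDiff_normed, B.hasCompactSupport_normed, ?_⟩
    rw [hχ, B.tsupport_normed_eq, Real.closedBall_eq_Icc]
    exact Icc_subset_Ioo (by simp only [B]; linarith) (by simp only [B]; linarith)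
  have hχ1 : ∫ t in Ioo a b, χ t = 1 := by
    rw [setIntegral_eq_integral_of_forall_compl_eq_zero fun x hx => hχt.eq_zero hx]
    exact B.integral_normed
  have hint : ∀ ψ, IsTest a b ψ → IntegrableOn ψ (Ioo a b) := fun ψ hψ =>
    (hψ.contDiff.continuous.integrableOn_Icc).mono_set Ioo_subset_Icc_self
  refine ⟨∫ t in Ioo a b, h t * χ t, ?_⟩
  refine ae_eq_of_forall_isTest (g := fun _ => ∫ t in Ioo a b, h t * χ t) hh
    (locallyIntegrableOn_const _) fun η hη => ?_
  set I := ∫ t in Ioo a b, η t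
  -- Removing the multiple of the unit-mass bump `χ` with the same integral makes the test function
  -- a derivative.
  have hψ : IsTest a b (fun t => η t - I * χ t) := by
    refine ⟨hη.contDiff.sub (contDiff_const.mul hχt.contDiff),
      hη.hasCompactSupport.sub hχt.hasCompactSupport.mul_left, ?_⟩
    refine (tsupport_sub _ _).trans (union_subset hη.tsupport_subset ?_)
    exact (tsupport_mul_subset_right).trans hχt.tsupport_subset
  obtain ⟨φ, hφ, hφd⟩ := hψ.exists_deriv_eq hab (by
    rw [integral_sub (hint _ hη) ((hint _ hχt).const_mul I), integral_const_mul, hχ1, mul_one,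
      sub_self])
  have := H φ hφ
  rw [hφd] at this
  simp only [mul_sub, mul_left_comm (h _) I] at this
  rw [integral_sub (hη.integrableOn_mul hh) ((hχt.integrableOn_mul hh).const_mul I),
    integral_const_mul, sub_eq_zero] at this
  rw [this, integral_const_mul, mul_comm]

/-- The difference of `f` and the primitive of `g` has zero weak derivative, hence is constant
almost everywhere. -/
lemma IsWeakDeriv.isPrimitive {a b : ℝ} (hab : a < b) {f g : ℝ → ℝ} (h : IsWeakDeriv a b 1 f g)
    (hg : IntegrableOn g (Ioo a b)) : IsPrimitive a b f g := by
  have hgI := intervalIntegrable_of_integrableOn_Ioo hab.le hg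
  have hF : LocallyIntegrableOn (fun x => ∫ y in a..x, g y) (Ioo a b) := by
    have hc := (hgI.absolutelyContinuousOnInterval_intervalIntegral (c := a) (by simp)).continuousOn
    rw [uIcc_of_le hab.le] at hc
    exact (hc.integrableOn_Icc.mono_set Ioo_subset_Icc_self).locallyIntegrableOn
  have hFp : IsPrimitive a b (fun x => ∫ y in a..x, g y) g := ⟨hg, 0, by simp⟩
  obtain ⟨c, hc⟩ := ae_eq_const_of_forall_isTest_deriv hab (h.1.sub hF) fun φ hφ => by
    simp only [Pi.sub_apply, sub_mul]
    have h1 := h.2.2 φ hφ.1 hφ.2 hφ.3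
    have h2 := hFp.integral_mul_deriv hab.le
      hφ.contDiff.continuous.continuousOn (hφ.eq_zero (by simp)) (hφ.eq_zero (by simp))
      (fun x _ => (hφ.contDiff.differentiable (by simp) x).hasDerivAt)
      ((hφ.deriv.contDiff.continuous.integrableOn_Icc).mono_set Ioo_subset_Icc_self)
    rw [iteratedDeriv_one] at h1
    rw [integral_sub (hφ.deriv.integrableOn_mul h.1) (hφ.deriv.integrableOn_mul hF), h1, h2]
    ring
  refine ⟨hg, c, ?_⟩
  filter_upwards [hc] with x hx
  simp only [Pi.sub_apply] at hx
  linarith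

end

end JacobiWavelet

namespace JacobiWavelet

open Polynomial (C X)

noncomputable section

/-! ### Affine changes of variable -/

lemma preimage_affine_Ioo {s : ℝ} (hs : 0 < s) (d : ℝ) :
    (fun t : ℝ => s * t + d) ⁻¹' Ioo (-1) 1 = Ioo ((-1 - d) / s) ((1 - d) / s) := by
  ext t
  simp only [mem_preimage, mem_Ioo, div_lt_iff₀ hs, lt_div_iff₀ hs]
  constructor <;> rintro ⟨h1, h2⟩ <;> constructor <;> linarith

lemma measurableEmbedding_affine {s : ℝ} (hs : 0 < s) (d : ℝ) :
    MeasurableEmbedding fun t : ℝ => s * t + d :=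
  ((Homeomorph.mulLeft₀ s hs.ne').trans (Homeomorph.addRight d)).measurableEmbedding

lemma map_restrict_affine {s : ℝ} (hs : 0 < s) (d : ℝ) :
    (volume.restrict (Ioo ((-1 - d) / s) ((1 - d) / s))).map (fun t : ℝ => s * t + d) =
      ENNReal.ofReal s⁻¹ • volume.restrict (Ioo (-1) 1) := by
  rw [← preimage_affine_Ioo hs, ← (measurableEmbedding_affine hs d).restrict_map,
    ← Measure.restrict_smul]
  congr 1
  have h1 := Real.map_volume_mul_left hs.ne'
  have h2 := map_add_right_eq_self (volume : Measure ℝ) d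
  have h3 : (fun t : ℝ => s * t + d) = (fun t => t + d) ∘ fun t => s * t := rfl
  rw [h3, ← Measure.map_map (by fun_prop) (by fun_prop), h1, Measure.map_smul, h2,
    abs_of_pos (inv_pos.2 hs)]

lemma ofReal_inv_ne_zero {s : ℝ} (hs : 0 < s) : ENNReal.ofReal s⁻¹ ≠ 0 := by
  simpa using hs

lemma ae_affine_iff {s : ℝ} (hs : 0 < s) (d : ℝ) {p : ℝ → Prop} :
    (∀ᵐ t ∂volume.restrict (Ioo ((-1 - d) / s) ((1 - d) / s)), p (s * t + d)) ↔
      ∀ᵐ x ∂volume.restrict (Ioo (-1) 1), p x := by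
  rw [← (measurableEmbedding_affine hs d).ae_map_iff, map_restrict_affine hs,
    Measure.ae_ennreal_smul_measure_iff (ofReal_inv_ne_zero hs)]

lemma setIntegral_affine {s : ℝ} (hs : 0 < s) (d : ℝ) (f : ℝ → ℝ) :
    ∫ t in Ioo ((-1 - d) / s) ((1 - d) / s), f (s * t + d) =
      s⁻¹ * ∫ x in Ioo (-1 : ℝ) 1, f x := by
  rw [← (measurableEmbedding_affine hs d).integral_map (g := f), map_restrict_affine hs,
    integral_smul_measure, ENNReal.toReal_ofReal (inv_pos.2 hs).le, smul_eq_mul]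

lemma integrableOn_affine_iff {s : ℝ} (hs : 0 < s) (d : ℝ) (f : ℝ → ℝ) :
    IntegrableOn (fun t => f (s * t + d)) (Ioo ((-1 - d) / s) ((1 - d) / s)) ↔
      IntegrableOn f (Ioo (-1) 1) := by
  have h := (measurableEmbedding_affine hs d).integrable_map_iff (g := f)
    (μ := volume.restrict (Ioo ((-1 - d) / s) ((1 - d) / s)))
  rw [map_restrict_affine hs, integrable_smul_measure (ofReal_inv_ne_zero hs) (by simp)] at h
  exact h.symm

lemma aestronglyMeasurable_affine_iff {s : ℝ} (hs : 0 < s) (d : ℝ) (f : ℝ → ℝ) :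
    AEStronglyMeasurable (fun t => f (s * t + d))
        (volume.restrict (Ioo ((-1 - d) / s) ((1 - d) / s))) ↔
      AEStronglyMeasurable f (volume.restrict (Ioo (-1) 1)) := by
  have h := (measurableEmbedding_affine hs d).aestronglyMeasurable_map_iff (g := f)
    (μ := volume.restrict (Ioo ((-1 - d) / s) ((1 - d) / s)))
  rw [map_restrict_affine hs] at h
  refine Iff.trans ?_ (h.symm.trans ?_)
  · rfl
  · constructor
    · intro h'
      exact h'.mono_ac (Measure.AbsolutelyContinuous.rfl.smul_right
        (ofReal_inv_ne_zero hs))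
    · exact fun h' => h'.mono_ac Measure.smul_absolutelyContinuous

lemma memL2_affine_iff {s : ℝ} (hs : 0 < s) (d : ℝ) (w f : ℝ → ℝ) :
    MemL2 (fun t => w (s * t + d)) ((-1 - d) / s) ((1 - d) / s) (fun t => f (s * t + d)) ↔
      MemL2 w (-1) 1 f :=
  and_congr (aestronglyMeasurable_affine_iff hs d f)
    (integrableOn_affine_iff hs d fun x => w x * f x ^ 2)

lemma l2Norm_affine_sq {s : ℝ} (hs : 0 < s) (d : ℝ) {w : ℝ → ℝ} (hw : ∀ x ∈ Ioo (-1 : ℝ) 1, 0 ≤ w x)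
    (f : ℝ → ℝ) :
    l2Norm (fun t => w (s * t + d)) ((-1 - d) / s) ((1 - d) / s) (fun t => f (s * t + d)) ^ 2 =
      s⁻¹ * l2Norm w (-1) 1 f ^ 2 := by
  have h0 : 0 ≤ ∫ x in Ioo (-1 : ℝ) 1, w x * f x ^ 2 :=
    setIntegral_nonneg measurableSet_Ioo fun x hx => mul_nonneg (hw x hx) (sq_nonneg _)
  have h := setIntegral_affine hs d (fun x => w x * f x ^ 2)
  simp only [l2Norm] at h ⊢
  rw [h, Real.sq_sqrt (mul_nonneg (inv_pos.2 hs).le h0), Real.sq_sqrt h0]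

lemma l2Norm_congr_ae {w : ℝ → ℝ} {a b : ℝ} {f g : ℝ → ℝ}
    (h : f =ᵐ[volume.restrict (Ioo a b)] g) : l2Norm w a b f = l2Norm w a b g := by
  rw [l2Norm, l2Norm]
  congr 1
  refine integral_congr_ae ?_
  filter_upwards [h] with t ht
  rw [ht]

lemma MemL2.congr_ae {w : ℝ → ℝ} {a b : ℝ} {f g : ℝ → ℝ} (hf : MemL2 w a b f)
    (h : f =ᵐ[volume.restrict (Ioo a b)] g) : MemL2 w a b g := by
  refine ⟨hf.1.congr h, hf.2.congr ?_⟩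
  filter_upwards [h] with t ht
  rw [ht]

lemma MemL2.const_mul {w : ℝ → ℝ} {a b : ℝ} {f : ℝ → ℝ} (hf : MemL2 w a b f) (c : ℝ) :
    MemL2 w a b (fun t => c * f t) := by
  refine ⟨hf.1.const_mul c, (hf.2.const_mul (c ^ 2)).congr (ae_of_all _ fun t => ?_)⟩
  ring

lemma l2Norm_const_mul_sq {w : ℝ → ℝ} {a b : ℝ} (hw : ∀ x ∈ Ioo a b, 0 ≤ w x) (f : ℝ → ℝ) (c : ℝ) :
    l2Norm w a b (fun t => c * f t) ^ 2 = c ^ 2 * l2Norm w a b f ^ 2 := by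
  have h0 : ∀ g : ℝ → ℝ, 0 ≤ ∫ x in Ioo a b, w x * g x ^ 2 := fun g =>
    setIntegral_nonneg measurableSet_Ioo fun x hx => mul_nonneg (hw x hx) (sq_nonneg _)
  rw [l2Norm, l2Norm, Real.sq_sqrt (h0 _), Real.sq_sqrt (h0 _), ← integral_const_mul]
  congr! 2 with t
  ring

/-- Functions in `L²_w` are integrable when both exponents are less than `1`. -/
lemma integrableOn_of_memL2_jacobiWeight {a b : ℝ} (ha : a < 1) (hb : b < 1) {f : ℝ → ℝ}
    (hf : MemL2 (jacobiWeight a b) (-1) 1 f) : IntegrableOn f (Ioo (-1) 1) := by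
  -- The reciprocal weight is again an integrable Jacobi weight, and `2|f| ≤ w⁻¹ + w f²`.
  have h1 := integrableOn_jacobiWeight (a := -a) (b := -b) (by linarith) (by linarith)
  refine (h1.add hf.2).mono' hf.1 ?_
  filter_upwards [ae_restrict_mem measurableSet_Ioo] with x hx
  have hw := jacobiWeight_pos a b hx
  have e : jacobiWeight (-a) (-b) x = (jacobiWeight a b x)⁻¹ := by
    rw [jacobiWeight, jacobiWeight, Real.rpow_neg (by linarith [hx.2]),
      Real.rpow_neg (by linarith [hx.1]), mul_inv]
  simp only [Pi.add_apply, e, Real.norm_eq_abs]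
  set W := jacobiWeight a b x
  have h2 : 0 ≤ W⁻¹ * (1 - W * |f x|) ^ 2 := by positivity
  have h3 : W⁻¹ * (1 - W * |f x|) ^ 2 = W⁻¹ - 2 * |f x| + W * f x ^ 2 := by
    field_simp
    rw [← sq_abs (f x)]
    ring
  have := abs_nonneg (f x)
  linarith

lemma isPrimitive_affine {s : ℝ} (hs : 0 < s) (d : ℝ) {f g : ℝ → ℝ} (c : ℝ)
    (h : IsPrimitive ((-1 - d) / s) ((1 - d) / s) f g) :
    IsPrimitive (-1) 1 (fun x => c * f ((x - d) / s)) (fun x => c / s * g ((x - d) / s)) := by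
  obtain ⟨hg, c₀, hc₀⟩ := h
  have e : ∀ t : ℝ, (s * t + d - d) / s = t := fun t => by field_simp; ring
  refine ⟨?_, c * c₀, ?_⟩
  · have : IntegrableOn (fun x => g ((x - d) / s)) (Ioo (-1) 1) := by
      rw [← integrableOn_affine_iff hs d]
      simpa only [e] using hg
    exact this.const_mul _
  · rw [← ae_affine_iff hs d]
    filter_upwards [hc₀] with t ht
    rw [e, ht, intervalIntegral.integral_const_mul]
    have h1 := intervalIntegral.integral_comp_mul_add (a := (-1 - d) / s) (b := t)
      (fun x => g ((x - d) / s)) hs.ne' d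
    rw [show s * ((-1 - d) / s) + d = -1 by field_simp; ring] at h1
    simp only [e, smul_eq_mul] at h1
    rw [h1]
    ring

end

end JacobiWavelet

namespace JacobiWavelet

open Polynomial (C X)

noncomputable section

/-! ### Approximation on a single subinterval -/

lemma jacobiProj_congr_ae {a b : ℝ} (m : ℕ) {f g : ℝ → ℝ}
    (h : f =ᵐ[volume.restrict (Ioo (-1) 1)] g) : jacobiProj a b m f = jacobiProj a b m g := by
  rw [jacobiProj, jacobiProj]
  refine Finset.sum_congr rfl fun n _ => ?_
  congr 2
  refine integral_congr_ae ?_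
  filter_upwards [h] with x hx
  rw [hx]

lemma iterate_derivative_comp_affine (p : Polynomial ℝ) (s d : ℝ) (j : ℕ) :
    Polynomial.derivative^[j] (p.comp (C s * X + C d)) =
      C (s ^ j) * (Polynomial.derivative^[j] p).comp (C s * X + C d) := by
  induction j with
  | zero => simp
  | succ j ih =>
    rw [Function.iterate_succ_apply', ih, Function.iterate_succ_apply', Polynomial.derivative_C_mul,
      Polynomial.derivative_comp, pow_succ, Polynomial.C_mul]
    simp only [Polynomial.derivative_add, Polynomial.derivative_C_mul, Polynomial.derivative_X,
      Polynomial.derivative_C]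
    ring

/-- The derivatives `g j` of a function on a subinterval, transplanted to `(-1,1)`. -/
def transplant (s d : ℝ) (g : ℕ → ℝ → ℝ) (j : ℕ) (x : ℝ) : ℝ := s⁻¹ ^ j * g j ((x - d) / s)

lemma affine_sub_div {s : ℝ} (hs : 0 < s) (d t : ℝ) : (s * t + d - d) / s = t := by
  field_simp
  ring

section Local

variable {ν γ s d : ℝ} {μ : ℕ} {u : ℝ → ℝ} {g : ℕ → ℝ → ℝ}

lemma memL2_comp_of_memL2 (hs : 0 < s) {w f : ℝ → ℝ}
    (hf : MemL2 (fun t => w (s * t + d)) ((-1 - d) / s) ((1 - d) / s) f) :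
    MemL2 w (-1) 1 (fun x => f ((x - d) / s)) := by
  rw [← memL2_affine_iff hs d]
  simpa only [affine_sub_div hs] using hf

/-- The upper bounds on the exponents enter here: they make each weak derivative integrable up to
the end points, which turns weak derivatives into genuine primitives. -/
lemma derivChain_transplant (hν : ν < 1) (hγ : γ < 1) (hs : 0 < s)
    (hg : ∀ j ≤ μ, IsWeakDeriv ((-1 - d) / s) ((1 - d) / s) j u (g j))
    (hgm : ∀ j ≤ μ,
      MemL2 (fun t => jacobiWeight ν γ (s * t + d)) ((-1 - d) / s) ((1 - d) / s) (g j)) :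
    DerivChain ν γ μ (transplant s d g) := by
  refine ⟨fun j hj => ?_, fun j hj => ?_⟩
  · rw [memLp_jacobiMeasure_iff]
    exact (memL2_comp_of_memL2 hs (hgm j hj)).const_mul _
  · have hlt : (-1 - d) / s < (1 - d) / s := by
      rw [div_lt_div_iff_of_pos_right hs]; linarith
    have hI : IntegrableOn (g (j + 1)) (Ioo ((-1 - d) / s) ((1 - d) / s)) := by
      have := integrableOn_of_memL2_jacobiWeight hν hγ (memL2_comp_of_memL2 hs (hgm (j + 1) hj))
      rw [← integrableOn_affine_iff hs d] at this
      simpa only [affine_sub_div hs] using this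
    have h := isPrimitive_affine hs d (s⁻¹ ^ j)
      (((hg j hj.le).of_succ (hg (j + 1) hj)).isPrimitive hlt hI)
    have e : transplant s d g (j + 1) = fun x => s⁻¹ ^ j / s * g (j + 1) ((x - d) / s) := by
      funext x
      rw [transplant, pow_succ, div_eq_mul_inv (s⁻¹ ^ j)]
    rw [e]
    exact h

lemma isWeakDeriv_local_error (hs : 0 < s) {m : ℕ} {v : ℝ → ℝ}
    (hv : ∀ t ∈ Ioo ((-1 - d) / s) ((1 - d) / s),
      v t = u t - (jacobiProj ν γ m (fun x => u ((x - d) / s))).eval (s * t + d))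
    (hg : ∀ j ≤ μ, IsWeakDeriv ((-1 - d) / s) ((1 - d) / s) j u (g j)) {j : ℕ} (hj : j ≤ μ) :
    IsWeakDeriv ((-1 - d) / s) ((1 - d) / s) j v
      (fun t => s ^ j * projError ν γ m j (transplant s d g) (s * t + d)) := by
  have hlt : (-1 - d) / s ≤ (1 - d) / s := by
    rw [div_le_div_iff_of_pos_right hs]; linarith
  -- The weak derivative of order zero is only almost everywhere equal to `u`; the projection does
  -- not see the difference.
  have hP : jacobiProj ν γ m (fun x => u ((x - d) / s)) =
      jacobiProj ν γ m (transplant s d g 0) := by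
    refine jacobiProj_congr_ae m ?_
    refine (ae_affine_iff hs d (p := fun x => u ((x - d) / s) = transplant s d g 0 x)).1 ?_
    filter_upwards [(hg 0 (Nat.zero_le _)).ae_eq_of_zero] with t ht
    simp only [transplant, affine_sub_div hs, ht, pow_zero, one_mul]
  rw [hP] at hv
  set P := jacobiProj ν γ m (transplant s d g 0) with hPdef
  have h := (hg j hj).sub (isWeakDeriv_eval hlt j (P.comp (C s * X + C d)))
  rw [iterate_derivative_comp_affine] at h
  simp only [Polynomial.eval_comp, Polynomial.eval_add, Polynomial.eval_mul, Polynomial.eval_C,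
    Polynomial.eval_X] at h
  have hv' : (fun t => u t - P.eval (s * t + d))
      =ᵐ[volume.restrict (Ioo ((-1 - d) / s) ((1 - d) / s))] v := by
    filter_upwards [ae_restrict_mem measurableSet_Ioo] with t ht using (hv t ht).symm
  convert h.congr_left hv' using 2 with t
  simp only [projError, transplant, affine_sub_div hs, ← hPdef]
  rw [mul_sub, ← mul_assoc, ← mul_pow, mul_inv_cancel₀ hs.ne', one_pow, one_mul]

lemma memLp_projError (hν : -1 < ν) (hγ : -1 < γ) {G : ℕ → ℝ → ℝ} (hG : DerivChain ν γ μ G) (m : ℕ)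
    {j : ℕ} (hj : j ≤ μ) : MemLp (projError ν γ m j G) 2 (jacobiMeasure ν γ) :=
  memLp_sub_eval hν hγ (hG.memLp j hj) _

lemma localWeight_nonneg (hs : 0 < s) :
    ∀ t ∈ Ioo ((-1 - d) / s) ((1 - d) / s), 0 ≤ jacobiWeight ν γ (s * t + d) := by
  intro t ht
  rw [← preimage_affine_Ioo hs] at ht
  exact (jacobiWeight_pos ν γ ht).le

lemma memL2_local_error (hν : -1 < ν) (hγ : -1 < γ) (hs : 0 < s) {G : ℕ → ℝ → ℝ}
    (hG : DerivChain ν γ μ G) (m : ℕ) {j : ℕ} (hj : j ≤ μ) :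
    MemL2 (fun t => jacobiWeight ν γ (s * t + d)) ((-1 - d) / s) ((1 - d) / s)
      (fun t => s ^ j * projError ν γ m j G (s * t + d)) :=
  ((memL2_affine_iff hs d _ _).2
    ((memLp_jacobiMeasure_iff _ _ _).1 (memLp_projError hν hγ hG m hj))).const_mul _

lemma l2Norm_transplant_sq (hs : 0 < s) (j : ℕ) :
    l2Norm (jacobiWeight ν γ) (-1) 1 (transplant s d g j) ^ 2 =
      s⁻¹ ^ (2 * j) * (s * l2Norm (fun t => jacobiWeight ν γ (s * t + d)) ((-1 - d) / s)
        ((1 - d) / s) (g j) ^ 2) := by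
  have hw : ∀ x ∈ Ioo (-1 : ℝ) 1, 0 ≤ jacobiWeight ν γ x := fun x hx => (jacobiWeight_pos _ _ hx).le
  have h := l2Norm_affine_sq hs d hw (fun x => g j ((x - d) / s))
  simp only [affine_sub_div hs] at h
  have h2 := l2Norm_const_mul_sq hw (fun x => g j ((x - d) / s)) (s⁻¹ ^ j)
  rw [show transplant s d g j = fun x => s⁻¹ ^ j * g j ((x - d) / s) from rfl, h2, h,
    mul_inv_cancel_left₀ hs.ne', ← pow_mul, mul_comm j]

/-- Scaling count: `s^{2j}` from differentiating the error, `s^{-2i}` from transplanting `g i`, and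
the two Jacobians `s⁻¹` and `s` cancel. -/
lemma l2Norm_weakDeriv_local_error_sq_le (hs : 0 < s) {m : ℕ} {v : ℝ → ℝ}
    (hv : ∀ t ∈ Ioo ((-1 - d) / s) ((1 - d) / s),
      v t = u t - (jacobiProj ν γ m (fun x => u ((x - d) / s))).eval (s * t + d))
    (hg : ∀ j ≤ μ, IsWeakDeriv ((-1 - d) / s) ((1 - d) / s) j u (g j)) {j : ℕ} (hj : j ≤ μ)
    {ρ : ℝ} (S : Finset ℕ)
    (h : l2Norm (jacobiWeight ν γ) (-1) 1 (projError ν γ m j (transplant s d g)) ≤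
      ρ * Real.sqrt (∑ i ∈ S, l2Norm (jacobiWeight ν γ) (-1) 1 (transplant s d g i) ^ 2)) :
    l2Norm (fun t => jacobiWeight ν γ (s * t + d)) ((-1 - d) / s) ((1 - d) / s)
      (weakDeriv ((-1 - d) / s) ((1 - d) / s) j v) ^ 2 ≤
      ρ ^ 2 * ∑ i ∈ S, s ^ (2 * (j : ℤ) - 2 * (i : ℤ)) *
        l2Norm (fun t => jacobiWeight ν γ (s * t + d)) ((-1 - d) / s) ((1 - d) / s) (g i) ^ 2 := by
  have hw : ∀ x ∈ Ioo (-1 : ℝ) 1, 0 ≤ jacobiWeight ν γ x := fun x hx => (jacobiWeight_pos _ _ hx).le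
  have hd := isWeakDeriv_local_error hs hv hg hj
  rw [l2Norm_congr_ae ((isWeakDeriv_weakDeriv hd).ae_eq hd),
    l2Norm_const_mul_sq (localWeight_nonneg hs), l2Norm_affine_sq hs d hw]
  have h1 := pow_le_pow_left₀ (l2Norm_nonneg _ _ _ _) h 2
  rw [mul_pow, Real.sq_sqrt (Finset.sum_nonneg fun _ _ => sq_nonneg _)] at h1
  calc _ ≤ (s ^ j) ^ 2 * (s⁻¹ * (ρ ^ 2 *
        ∑ i ∈ S, l2Norm (jacobiWeight ν γ) (-1) 1 (transplant s d g i) ^ 2)) := by gcongr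
    _ = _ := by
      rw [Finset.mul_sum, Finset.mul_sum, Finset.mul_sum, Finset.mul_sum]
      refine Finset.sum_congr rfl fun i _ => ?_
      rw [l2Norm_transplant_sq hs, zpow_sub₀ hs.ne']
      have e1 : s ^ (2 * (j : ℤ)) = (s ^ j) ^ 2 := by
        rw [← pow_mul, mul_comm j]; exact_mod_cast zpow_natCast s (2 * j)
      have e2 : s ^ (2 * (i : ℤ)) = s ^ (2 * i) := by exact_mod_cast zpow_natCast s (2 * i)
      rw [e1, e2, inv_pow]
      field_simp

end Local

end

end JacobiWavelet

namespace JacobiWavelet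

open Polynomial (C X)

noncomputable section

/-! ### The wavelets on the subintervals -/

lemma localVar_eq (T : ℝ) (k n : ℕ) (t : ℝ) :
    localVar T k n t = 2 ^ k / T * t + (1 - 2 * n) := by
  rw [localVar]; ring

lemma localWeight_eq (ν γ T : ℝ) (k n : ℕ) :
    localWeight ν γ T k n = fun t => jacobiWeight ν γ (2 ^ k / T * t + (1 - 2 * n)) := by
  funext t
  rw [localWeight, localVar_eq]

section Geometry

variable {T : ℝ} {k : ℕ}

lemma two_pow_div_pos (hT : 0 < T) (k : ℕ) : 0 < (2 : ℝ) ^ k / T := by positivity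

lemma leftPt_eq (hT : 0 < T) (hk : 1 ≤ k) (n : ℕ) :
    leftPt T k n = (-1 - (1 - 2 * (n : ℝ))) / (2 ^ k / T) := by
  -- The exponent `k - 1` is a truncated subtraction, so `2^k = 2 · 2^(k-1)` needs `k ≥ 1`.
  obtain ⟨k, rfl⟩ : ∃ k', k = k' + 1 := ⟨k - 1, by omega⟩
  rw [leftPt, Nat.add_sub_cancel, pow_succ]
  field_simp
  ring

lemma rightPt_eq (hT : 0 < T) (hk : 1 ≤ k) (n : ℕ) :
    rightPt T k n = (1 - (1 - 2 * (n : ℝ))) / (2 ^ k / T) := by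
  obtain ⟨k, rfl⟩ : ∃ k', k = k' + 1 := ⟨k - 1, by omega⟩
  rw [rightPt, Nat.add_sub_cancel, pow_succ]
  field_simp
  ring

lemma mem_Ico_iff (hT : 0 < T) (k n : ℕ) (t : ℝ) :
    t ∈ Ico (leftPt T k n) (rightPt T k n) ↔
      (n : ℝ) - 1 ≤ t / T * 2 ^ (k - 1) ∧ t / T * 2 ^ (k - 1) < n := by
  have h2 : (0 : ℝ) < 2 ^ (k - 1) := by positivity
  rw [mem_Ico, leftPt, rightPt, div_mul_eq_mul_div, div_mul_eq_mul_div, div_mul_eq_mul_div,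
    div_le_iff₀ h2, lt_div_iff₀ h2, le_div_iff₀ hT, div_lt_iff₀ hT]

lemma Ico_disjoint (hT : 0 < T) (k : ℕ) {n n' : ℕ} {t : ℝ}
    (h : t ∈ Ico (leftPt T k n) (rightPt T k n)) (h' : t ∈ Ico (leftPt T k n') (rightPt T k n')) :
    n = n' := by
  rw [mem_Ico_iff hT] at h h'
  have h1 : (n : ℝ) < n' + 1 := by linarith
  have h2 : (n' : ℝ) < n + 1 := by linarith
  have h1' : n < n' + 1 := by exact_mod_cast h1
  have h2' : n' < n + 1 := by exact_mod_cast h2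
  omega

lemma pairwiseDisjoint_Ico (hT : 0 < T) (k : ℕ) :
    (↑(Finset.Icc 1 (2 ^ (k - 1))) : Set ℕ).PairwiseDisjoint
      (fun n => Ico (leftPt T k n) (rightPt T k n)) := by
  intro n _ n' _ hne
  rw [Function.onFun, Set.disjoint_left]
  exact fun t h h' => hne (Ico_disjoint hT k h h')

lemma biUnion_Ico (hT : 0 < T) (k : ℕ) :
    ⋃ n ∈ Finset.Icc 1 (2 ^ (k - 1)), Ico (leftPt T k n) (rightPt T k n) = Ico 0 T := by
  have h2 : (0 : ℝ) < 2 ^ (k - 1) := by positivity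
  ext t
  simp only [mem_iUnion, exists_prop, mem_Ico_iff hT, Finset.mem_Icc]
  constructor
  · rintro ⟨n, ⟨hn1, hn2⟩, h3, h4⟩
    have hn1' : (1 : ℝ) ≤ n := by exact_mod_cast hn1
    have hn2' : (n : ℝ) ≤ 2 ^ (k - 1) := by exact_mod_cast hn2
    have h5 : 0 ≤ t / T := by
      by_contra h
      have := mul_neg_of_neg_of_pos (not_le.1 h) h2
      linarith
    have h6 : t / T < 1 := by
      by_contra h
      have := mul_le_mul_of_nonneg_right (not_lt.1 h) h2.le
      linarith
    rw [div_lt_one hT] at h6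
    rw [le_div_iff₀ hT, zero_mul] at h5
    exact ⟨h5, h6⟩
  · rintro ⟨h0, h1⟩
    have hy0 : 0 ≤ t / T * 2 ^ (k - 1) := by positivity
    have hy1 : t / T * 2 ^ (k - 1) < 2 ^ (k - 1) := by
      have : t / T < 1 := (div_lt_one hT).2 h1
      nlinarith
    refine ⟨⌊t / T * 2 ^ (k - 1)⌋₊ + 1, ⟨by omega, ?_⟩, ?_, ?_⟩
    · rw [Nat.succ_le_iff, Nat.floor_lt hy0]
      exact_mod_cast hy1
    · push_cast
      linarith [Nat.floor_le hy0]
    · push_cast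
      exact Nat.lt_floor_add_one _

lemma Ico_subset (hT : 0 < T) {n : ℕ} (hn : n ∈ Finset.Icc 1 (2 ^ (k - 1))) :
    Ico (leftPt T k n) (rightPt T k n) ⊆ Ico 0 T := by
  rw [← biUnion_Ico hT k]
  exact subset_biUnion_of_mem (u := fun n => Ico (leftPt T k n) (rightPt T k n)) hn

lemma leftPt_lt_rightPt (hT : 0 < T) (k n : ℕ) : leftPt T k n < rightPt T k n := by
  have h2 : (0 : ℝ) < 2 ^ (k - 1) := by positivity
  rw [leftPt, rightPt]
  gcongr
  linarith

lemma leftPt_nonneg (hT : 0 < T) {n : ℕ} (hn : n ∈ Finset.Icc 1 (2 ^ (k - 1))) :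
    0 ≤ leftPt T k n :=
  (Ico_subset hT hn (left_mem_Ico.2 (leftPt_lt_rightPt hT k n))).1

lemma rightPt_le (hT : 0 < T) {n : ℕ} (hn : n ∈ Finset.Icc 1 (2 ^ (k - 1))) :
    rightPt T k n ≤ T :=
  ((Ico_subset_Ico_iff (leftPt_lt_rightPt hT k n)).1 (Ico_subset hT hn)).2

lemma integrableOn_iff_forall (hT : 0 < T) (k : ℕ) (F : ℝ → ℝ) :
    IntegrableOn F (Ioo 0 T) ↔ ∀ n ∈ Finset.Icc 1 (2 ^ (k - 1)),
      IntegrableOn F (Ioo (leftPt T k n) (rightPt T k n)) := by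
  rw [← integrableOn_Ico_iff_integrableOn_Ioo, ← biUnion_Ico hT k, integrableOn_finset_iUnion]
  exact forall₂_congr fun n _ => integrableOn_Ico_iff_integrableOn_Ioo

lemma setIntegral_eq_sum (hT : 0 < T) (k : ℕ) {F : ℝ → ℝ} (hF : IntegrableOn F (Ioo 0 T)) :
    ∫ t in Ioo 0 T, F t = ∑ n ∈ Finset.Icc 1 (2 ^ (k - 1)),
      ∫ t in Ioo (leftPt T k n) (rightPt T k n), F t := by
  rw [integrableOn_iff_forall hT k] at hF
  rw [← integral_Ico_eq_integral_Ioo, ← biUnion_Ico hT k,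
    integral_biUnion_finset _ (fun _ _ => measurableSet_Ico) (pairwiseDisjoint_Ico hT k)
      (fun n hn => (integrableOn_Ico_iff_integrableOn_Ioo (by finiteness)).2 (hF n hn))]
  simp only [integral_Ico_eq_integral_Ioo]

end Geometry

section Wavelets

variable {ν γ T : ℝ} {k : ℕ}

lemma waveletWeight_of_mem (hT : 0 < T) {n : ℕ} (hn : n ∈ Finset.Icc 1 (2 ^ (k - 1))) {t : ℝ}
    (ht : t ∈ Ico (leftPt T k n) (rightPt T k n)) :
    waveletWeight ν γ T k t = localWeight ν γ T k n t := by
  rw [waveletWeight, Finset.sum_eq_single n]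
  · exact indicator_of_mem ht _
  · intro n' _ hne
    exact indicator_of_notMem (fun h => hne (Ico_disjoint hT k h ht)) _
  · exact fun h => absurd hn h

/-- The polynomial which a combination of wavelets is, in the local variable of a subinterval. -/
def waveletPoly (ν γ T : ℝ) (k M : ℕ) (c : ℕ → ℝ) : Polynomial ℝ :=
  ∑ m ∈ Finset.range (M + 1),
    (c m * ((2 : ℝ) ^ ((k : ℝ) / 2) * Real.sqrt (1 / (jacobiH ν γ m * T)))) • jacobiPoly ν γ m

lemma waveletSum_of_mem (hT : 0 < T) (M : ℕ) (c : ℕ → ℕ → ℝ) {n : ℕ}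
    (hn : n ∈ Finset.Icc 1 (2 ^ (k - 1))) {t : ℝ}
    (ht : t ∈ Ico (leftPt T k n) (rightPt T k n)) :
    waveletSum ν γ T k M c t =
      (waveletPoly ν γ T k M (c n)).eval (2 ^ k / T * t + (1 - 2 * n)) := by
  rw [waveletSum, Finset.sum_eq_single n]
  · rw [waveletPoly, Polynomial.eval_finsetSum]
    refine Finset.sum_congr rfl fun m _ => ?_
    rw [wavelet, indicator_of_mem ht, Polynomial.eval_smul, eval_jacobiPoly, localVar_eq,
      smul_eq_mul]
    ring
  · intro n' _ hne
    refine Finset.sum_eq_zero fun m _ => ?_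
    rw [wavelet, indicator_of_notMem (fun h => hne (Ico_disjoint hT k h ht)), mul_zero]
  · exact fun h => absurd hn h

lemma waveletCoeff_eq (hT : 0 < T) (hk : 1 ≤ k) (u : ℝ → ℝ) {n : ℕ}
    (hn : n ∈ Finset.Icc 1 (2 ^ (k - 1))) (m : ℕ) :
    waveletCoeff ν γ T k u n m =
      (2 : ℝ) ^ ((k : ℝ) / 2) * Real.sqrt (1 / (jacobiH ν γ m * T)) * ((2 ^ k / T)⁻¹ *
        ∫ x in Ioo (-1 : ℝ) 1, jacobiWeight ν γ x *
          (u ((x - (1 - 2 * n)) / (2 ^ k / T)) * (jacobiPoly ν γ m).eval x)) := by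
  have hs := two_pow_div_pos hT k
  rw [waveletCoeff, ← integral_Ico_eq_integral_Ioo,
    setIntegral_eq_of_subset_of_forall_sdiff_eq_zero measurableSet_Ico (Ico_subset hT hn),
    integral_Ico_eq_integral_Ioo, ← setIntegral_affine hs (1 - 2 * (n : ℝ)), ← leftPt_eq hT hk,
    ← rightPt_eq hT hk, ← integral_const_mul]
  · refine setIntegral_congr_fun measurableSet_Ioo fun t ht => ?_
    have ht' := Ioo_subset_Ico_self ht
    simp only [waveletWeight_of_mem hT hn ht', wavelet, indicator_of_mem ht', localWeight,
      localVar_eq, eval_jacobiPoly, affine_sub_div hs]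
    ring
  · intro t ht
    rw [wavelet, indicator_of_notMem ht.2, mul_zero]

/-- The normalization enters twice, in the coefficient and in the wavelet, giving `2^k / (h_m T)`.
The Jacobian `T / 2^k` reduces this to the factor `1 / h_m` of the projection. -/
lemma waveletPoly_waveletCoeff (hν : -1 < ν) (hγ : -1 < γ) (hT : 0 < T) (hk : 1 ≤ k) (M : ℕ)
    (u : ℝ → ℝ) {n : ℕ} (hn : n ∈ Finset.Icc 1 (2 ^ (k - 1))) :
    waveletPoly ν γ T k M (waveletCoeff ν γ T k u n) =
      jacobiProj ν γ (M + 1) (fun x => u ((x - (1 - 2 * n)) / (2 ^ k / T))) := by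
  rw [waveletPoly, jacobiProj]
  refine Finset.sum_congr rfl fun m _ => ?_
  have hh : 0 < jacobiH ν γ m := by
    rw [jacobiH_eq hν hγ]
    have := norm_jacobiPoly_pos hν hγ m
    positivity
  congr 1
  rw [waveletCoeff_eq hT hk u hn]
  set I := ∫ x in Ioo (-1 : ℝ) 1, jacobiWeight ν γ x *
    (u ((x - (1 - 2 * n)) / (2 ^ k / T)) * (jacobiPoly ν γ m).eval x)
  set p : ℝ := (2 : ℝ) ^ ((k : ℝ) / 2) with hp
  set q := Real.sqrt (1 / (jacobiH ν γ m * T)) with hq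
  have hp2 : p * p = 2 ^ k := by
    rw [hp, ← Real.rpow_add two_pos, add_halves, Real.rpow_natCast]
  have hq2 : q * q = 1 / (jacobiH ν γ m * T) := Real.mul_self_sqrt (by positivity)
  calc p * q * ((2 ^ k / T)⁻¹ * I) * (p * q) = (p * p) * (q * q) * ((2 ^ k / T)⁻¹ * I) := by ring
    _ = I / jacobiH ν γ m := by
      rw [hp2, hq2]
      field_simp

lemma waveletApprox_of_mem (hν : -1 < ν) (hγ : -1 < γ) (hT : 0 < T) (hk : 1 ≤ k) (M : ℕ)
    (u : ℝ → ℝ) {n : ℕ} (hn : n ∈ Finset.Icc 1 (2 ^ (k - 1))) {t : ℝ}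
    (ht : t ∈ Ico (leftPt T k n) (rightPt T k n)) :
    waveletApprox ν γ T k M u t =
      (jacobiProj ν γ (M + 1) (fun x => u ((x - (1 - 2 * n)) / (2 ^ k / T)))).eval
        (2 ^ k / T * t + (1 - 2 * n)) := by
  rw [waveletApprox, waveletSum_of_mem hT M _ hn ht, waveletPoly_waveletCoeff hν hγ hT hk M u hn]

lemma degree_waveletPoly_lt (hν : -1 < ν) (hγ : -1 < γ) (M : ℕ) (c : ℕ → ℝ) :
    (waveletPoly ν γ T k M c).degree < (M + 1 : ℕ) :=
  degree_sum_jacobiPoly_lt hν hγ _ _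

lemma measurable_waveletSum (M : ℕ) (c : ℕ → ℕ → ℝ) : Measurable (waveletSum ν γ T k M c) := by
  unfold waveletSum
  refine Finset.measurable_fun_sum _ fun n _ => Finset.measurable_fun_sum _ fun m _ => ?_
  refine Measurable.const_mul ?_ _
  refine Measurable.indicator ?_ measurableSet_Ico
  refine Measurable.const_mul ?_ _
  simp only [← eval_jacobiPoly, localVar]
  exact (jacobiPoly ν γ m).continuous.measurable.comp (by fun_prop)

lemma MemL2.localize (hT : 0 < T) {f : ℝ → ℝ} (hf : MemL2 (waveletWeight ν γ T k) 0 T f) {n : ℕ}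
    (hn : n ∈ Finset.Icc 1 (2 ^ (k - 1))) :
    MemL2 (localWeight ν γ T k n) (leftPt T k n) (rightPt T k n) f := by
  have hs : Ioo (leftPt T k n) (rightPt T k n) ⊆ Ioo 0 T :=
    Ioo_subset_Ioo (leftPt_nonneg hT hn) (rightPt_le hT hn)
  refine ⟨hf.1.mono_set hs, (hf.2.mono_set hs).congr ?_⟩
  filter_upwards [ae_restrict_mem measurableSet_Ioo] with t ht
  rw [waveletWeight_of_mem hT hn (Ioo_subset_Ico_self ht)]

lemma memL2_of_forall_localize (hT : 0 < T) {f : ℝ → ℝ}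
    (hf : AEStronglyMeasurable f (volume.restrict (Ioo 0 T)))
    (h : ∀ n ∈ Finset.Icc 1 (2 ^ (k - 1)),
      MemL2 (localWeight ν γ T k n) (leftPt T k n) (rightPt T k n) f) :
    MemL2 (waveletWeight ν γ T k) 0 T f := by
  refine ⟨hf, (integrableOn_iff_forall hT k _).2 fun n hn => (h n hn).2.congr ?_⟩
  filter_upwards [ae_restrict_mem measurableSet_Ioo] with t ht
  rw [waveletWeight_of_mem hT hn (Ioo_subset_Ico_self ht)]

lemma localWeight_nonneg_of_mem (hT : 0 < T) (hk : 1 ≤ k) (n : ℕ) :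
    ∀ t ∈ Ioo (leftPt T k n) (rightPt T k n), 0 ≤ localWeight ν γ T k n t := by
  rw [leftPt_eq hT hk, rightPt_eq hT hk, localWeight_eq]
  exact localWeight_nonneg (two_pow_div_pos hT k)

lemma l2Norm_sq_eq_sum (hT : 0 < T) (hk : 1 ≤ k) {f : ℝ → ℝ}
    (hf : MemL2 (waveletWeight ν γ T k) 0 T f) :
    l2Norm (waveletWeight ν γ T k) 0 T f ^ 2 = ∑ n ∈ Finset.Icc 1 (2 ^ (k - 1)),
      l2Norm (localWeight ν γ T k n) (leftPt T k n) (rightPt T k n) f ^ 2 := by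
  have e : ∀ n ∈ Finset.Icc 1 (2 ^ (k - 1)),
      l2Norm (localWeight ν γ T k n) (leftPt T k n) (rightPt T k n) f ^ 2 =
        ∫ t in Ioo (leftPt T k n) (rightPt T k n), waveletWeight ν γ T k t * f t ^ 2 := by
    intro n hn
    rw [l2Norm, Real.sq_sqrt (setIntegral_nonneg measurableSet_Ioo fun t ht =>
      mul_nonneg (localWeight_nonneg_of_mem hT hk n t ht) (sq_nonneg _))]
    refine setIntegral_congr_fun measurableSet_Ioo fun t ht => ?_
    simp only [waveletWeight_of_mem hT hn (Ioo_subset_Ico_self ht)]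
  rw [Finset.sum_congr rfl e, ← setIntegral_eq_sum hT k hf.2, l2Norm, Real.sq_sqrt]
  rw [setIntegral_eq_sum hT k hf.2, ← Finset.sum_congr rfl e]
  exact Finset.sum_nonneg fun _ _ => sq_nonneg _

lemma memL2_sub_waveletSum (hν : -1 < ν) (hγ : -1 < γ) (hT : 0 < T) (hk : 1 ≤ k)
    {u : ℝ → ℝ} (hu : MemL2 (waveletWeight ν γ T k) 0 T u) (M : ℕ) (c : ℕ → ℕ → ℝ) :
    MemL2 (waveletWeight ν γ T k) 0 T (fun t => u t - waveletSum ν γ T k M c t) := by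
  have hs := two_pow_div_pos hT k
  refine memL2_of_forall_localize hT
    (hu.1.sub (measurable_waveletSum M c).aestronglyMeasurable) fun n hn => ?_
  have h := hu.localize hT hn
  rw [leftPt_eq hT hk, rightPt_eq hT hk, localWeight_eq] at h ⊢
  have h1 := memLp_sub_eval hν hγ ((memLp_jacobiMeasure_iff _ _ _).2 (memL2_comp_of_memL2 hs h))
    (waveletPoly ν γ T k M (c n))
  rw [memLp_jacobiMeasure_iff, ← memL2_affine_iff hs (1 - 2 * (n : ℝ))] at h1
  refine h1.congr_ae ?_
  filter_upwards [ae_restrict_mem measurableSet_Ioo] with t ht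
  rw [← leftPt_eq hT hk, ← rightPt_eq hT hk] at ht
  rw [affine_sub_div hs, waveletSum_of_mem hT M c hn (Ioo_subset_Ico_self ht)]

/-- The truncated wavelet expansion is a best approximation. -/
lemma l2Norm_sub_waveletApprox_le (hν : -1 < ν) (hγ : -1 < γ) (hT : 0 < T) (hk : 1 ≤ k)
    {u : ℝ → ℝ} (hu : MemL2 (waveletWeight ν γ T k) 0 T u) (M : ℕ) (c : ℕ → ℕ → ℝ) :
    l2Norm (waveletWeight ν γ T k) 0 T (fun t => u t - waveletApprox ν γ T k M u t) ≤
      l2Norm (waveletWeight ν γ T k) 0 T (fun t => u t - waveletSum ν γ T k M c t) := by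
  have hs := two_pow_div_pos hT k
  refine (sq_le_sq₀ (l2Norm_nonneg _ _ _ _) (l2Norm_nonneg _ _ _ _)).1 ?_
  unfold waveletApprox
  rw [l2Norm_sq_eq_sum hT hk (memL2_sub_waveletSum hν hγ hT hk hu M c),
    l2Norm_sq_eq_sum hT hk (memL2_sub_waveletSum hν hγ hT hk hu M _)]
  refine Finset.sum_le_sum fun n hn => ?_
  have h := hu.localize hT hn
  rw [leftPt_eq hT hk, rightPt_eq hT hk, localWeight_eq] at h ⊢
  have hum := (memLp_jacobiMeasure_iff _ _ _).2 (memL2_comp_of_memL2 hs h)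
  -- On a subinterval every wavelet sum is a polynomial of degree at most `M`, so the comparison
  -- becomes best approximation on `(-1,1)`.
  have key : ∀ c : ℕ → ℕ → ℝ, l2Norm (fun t => jacobiWeight ν γ (2 ^ k / T * t + (1 - 2 * n)))
      ((-1 - (1 - 2 * (n : ℝ))) / (2 ^ k / T)) ((1 - (1 - 2 * (n : ℝ))) / (2 ^ k / T))
      (fun t => u t - waveletSum ν γ T k M c t) ^ 2 =
      (2 ^ k / T)⁻¹ * l2Norm (jacobiWeight ν γ) (-1) 1 (fun x =>
        u ((x - (1 - 2 * n)) / (2 ^ k / T)) - (waveletPoly ν γ T k M (c n)).eval x) ^ 2 := by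
    intro c
    rw [← l2Norm_affine_sq hs (1 - 2 * (n : ℝ)) fun x hx => (jacobiWeight_pos ν γ hx).le]
    congr 1
    refine l2Norm_congr_ae ?_
    filter_upwards [ae_restrict_mem measurableSet_Ioo] with t ht
    rw [← leftPt_eq hT hk, ← rightPt_eq hT hk] at ht
    rw [affine_sub_div hs, waveletSum_of_mem hT M c hn (Ioo_subset_Ico_self ht)]
  rw [key, key, waveletPoly_waveletCoeff hν hγ hT hk M u hn]
  have := l2Norm_sub_jacobiProj_le hν hγ hum (degree_waveletPoly_lt (T := T) (k := k) hν hγ M (c n))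
  have h0 := l2Norm_nonneg (jacobiWeight ν γ) (-1) 1
  exact mul_le_mul_of_nonneg_left (pow_le_pow_left₀ (h0 _) this 2) (inv_pos.2 hs).le

end Wavelets

end

end JacobiWavelet

namespace JacobiWavelet

noncomputable section

/-! ### Error estimates for the wavelet expansion -/

/-- The rate `M^{-μ}` of the `L²` estimate (`r = 0`), and `M^{2r-1/2-μ}` of the `H^r` estimate. -/
def approxRate (μ M r : ℕ) : ℝ :=
  if r = 0 then (M : ℝ) ^ (-(μ : ℝ)) else (M : ℝ) ^ (2 * (r : ℝ) - 1 / 2 - μ)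

lemma approxRate_nonneg (μ M r : ℕ) : 0 ≤ approxRate μ M r := by
  unfold approxRate
  split_ifs <;> positivity

/-- Needed because the `H^r` norm contains all orders `j ≤ r`. From order zero to `r ≥ 1` the
exponent grows since `2r - 1/2 > 0`. -/
lemma approxRate_mono (μ : ℕ) {M : ℕ} (hM : 1 ≤ M) {j r : ℕ} (hjr : j ≤ r) :
    approxRate μ M j ≤ approxRate μ M r := by
  have hM' : (1 : ℝ) ≤ M := by exact_mod_cast hM
  have hjr' : (j : ℝ) ≤ r := by exact_mod_cast hjr
  unfold approxRate
  split_ifs with h1 h2 h2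
  · exact le_rfl
  · have : (1 : ℝ) ≤ r := by exact_mod_cast Nat.one_le_iff_ne_zero.2 h2
    exact Real.rpow_le_rpow_of_exponent_le hM' (by linarith)
  · omega
  · exact Real.rpow_le_rpow_of_exponent_le hM' (by linarith)

lemma exists_projError_le_approxRate {ν γ : ℝ} (hν : -1 < ν) (hγ : -1 < γ) (μ : ℕ) :
    ∃ K : ℝ, 0 ≤ K ∧ ∀ M : ℕ, 1 ≤ M → ∀ G : ℕ → ℝ → ℝ, DerivChain ν γ μ G → ∀ r ≤ μ,
      l2Norm (jacobiWeight ν γ) (-1) 1 (projError ν γ (M + 1) r G) ≤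
        K * approxRate μ M r * Real.sqrt (∑ j ∈ Finset.Icc (min μ (M + 1)) μ,
          l2Norm (jacobiWeight ν γ) (-1) 1 (G j) ^ 2) := by
  obtain ⟨K, hK0, hK⟩ := exists_projError_le hν hγ μ
  refine ⟨K, hK0, fun M hM G hG r hr => ?_⟩
  have hM' : (0 : ℝ) < M := by exact_mod_cast hM
  have h := hK M hM G hG r hr
  have hsq : 0 < Real.sqrt M := Real.sqrt_pos.2 hM'
  have hp : (0 : ℝ) < (M : ℝ) ^ μ * Real.sqrt M := by positivity
  have e : approxRate μ M r * ((M : ℝ) ^ μ * Real.sqrt M) =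
      (M : ℝ) ^ (2 * r) * (if r = 0 then Real.sqrt M else 1) := by
    have e1 : (M : ℝ) ^ μ = (M : ℝ) ^ (μ : ℝ) := (Real.rpow_natCast _ _).symm
    have e2 : (M : ℝ) ^ (2 * r) = (M : ℝ) ^ (2 * (r : ℝ)) := by
      rw [← Real.rpow_natCast]; push_cast; rfl
    unfold approxRate
    split_ifs with h0
    · rw [e1, ← mul_assoc, ← Real.rpow_add hM']
      simp [h0]
    · rw [e1, e2, Real.sqrt_eq_rpow, ← Real.rpow_add hM', ← Real.rpow_add hM', mul_one]
      congr 1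
      ring
  refine le_of_mul_le_mul_left (h.trans_eq ?_) hp
  rw [mul_assoc K, ← e]
  ring

lemma zpow_le_max_pow {T : ℝ} (hT : 0 < T) {N : ℕ} {z : ℤ} (hz : z.natAbs ≤ N) :
    T ^ z ≤ (max T T⁻¹) ^ N := by
  have h1 : 1 ≤ max T T⁻¹ := by
    rcases le_total 1 T with h | h
    · exact h.trans (le_max_left _ _)
    · exact ((one_le_inv₀ hT).2 h).trans (le_max_right _ _)
  have hi := (inv_pos.2 hT).le
  refine le_trans ?_ (pow_le_pow_right₀ h1 hz)
  rcases Int.natAbs_eq z with h | h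
  · nth_rewrite 1 [h]
    rw [zpow_natCast]
    exact pow_le_pow_left₀ hT.le (le_max_left _ _) _
  · nth_rewrite 1 [h]
    rw [zpow_neg, zpow_natCast, ← inv_pow]
    exact pow_le_pow_left₀ hi (le_max_right _ _) _

/-- The powers of `T` have exponents of size at most `2μ` and go into the constant; `j` may be
raised to `r` because `2^k ≥ 1`. -/
lemma two_pow_div_zpow_le {T : ℝ} (hT : 0 < T) (k : ℕ) {μ r i j : ℕ} (hjr : j ≤ r) (hr : r ≤ μ)
    (hi : i ≤ μ) :
    ((2 : ℝ) ^ k / T) ^ (2 * (j : ℤ) - 2 * (i : ℤ)) ≤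
      (max T T⁻¹) ^ (2 * μ) * ((2 : ℝ) ^ k) ^ (2 * (r : ℤ) - 2 * (i : ℤ)) := by
  have h2 : (1 : ℝ) ≤ 2 ^ k := one_le_pow₀ (by norm_num)
  rw [div_zpow, div_eq_mul_inv, ← zpow_neg, mul_comm]
  have hm : 0 ≤ max T T⁻¹ := hT.le.trans (le_max_left _ _)
  refine mul_le_mul (zpow_le_max_pow hT (by omega)) (zpow_le_zpow_right₀ h2 (by omega))
    (by positivity) (by positivity)

section Wavelets

variable {ν γ T : ℝ} {k M μ : ℕ} {u : ℝ → ℝ}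

lemma MemSobolev.isWeakDeriv {w : ℝ → ℝ} {a b : ℝ} (hu : MemSobolev w a b μ u) {j : ℕ}
    (hj : j ≤ μ) : IsWeakDeriv a b j u (weakDeriv a b j u) := by
  obtain ⟨g, hg, -⟩ := hu j hj
  exact isWeakDeriv_weakDeriv hg

lemma MemSobolev.memL2_weakDeriv {w : ℝ → ℝ} {a b : ℝ} (hu : MemSobolev w a b μ u) {j : ℕ}
    (hj : j ≤ μ) : MemL2 w a b (weakDeriv a b j u) := by
  obtain ⟨g, hg, hm⟩ := hu j hj
  exact hm.congr_ae (hg.ae_eq (isWeakDeriv_weakDeriv hg))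

lemma MemSobolev.memL2 {w : ℝ → ℝ} {a b : ℝ} (hu : MemSobolev w a b μ u) : MemL2 w a b u := by
  obtain ⟨g, hg, hm⟩ := hu 0 (Nat.zero_le _)
  exact hm.congr_ae hg.ae_eq_of_zero.symm

lemma waveletSeminorm_sq (r : ℕ) :
    waveletSeminorm ν γ T k r μ M u ^ 2 = ∑ j ∈ Finset.Icc (min μ (M + 1)) μ,
      ((2 : ℝ) ^ k) ^ (2 * (r : ℤ) - 2 * (j : ℤ)) *
        l2Norm (waveletWeight ν γ T k) 0 T (weakDeriv 0 T j u) ^ 2 :=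
  Real.sq_sqrt (Finset.sum_nonneg fun _ _ => by positivity)

lemma isWeakDeriv_subinterval (hT : 0 < T) {f g : ℝ → ℝ} {j : ℕ} (h : IsWeakDeriv 0 T j f g)
    {n : ℕ} (hn : n ∈ Finset.Icc 1 (2 ^ (k - 1))) :
    IsWeakDeriv (leftPt T k n) (rightPt T k n) j f g :=
  h.restrict (leftPt_nonneg hT hn) (rightPt_le hT hn)

lemma memBrokenSobolev_sub_waveletApprox (hν : -1 < ν) (hν' : ν < 1) (hγ : -1 < γ) (hγ' : γ < 1)
    (hT : 0 < T) (hk : 1 ≤ k) (hu : MemSobolev (waveletWeight ν γ T k) 0 T μ u) :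
    MemBrokenSobolev ν γ T k μ (fun t => u t - waveletApprox ν γ T k M u t) := by
  intro n hn j hj
  have hs := two_pow_div_pos hT k
  have hg := fun j (hj : j ≤ μ) => isWeakDeriv_subinterval hT (hu.isWeakDeriv hj) hn
  have hgm := fun j (hj : j ≤ μ) => (hu.memL2_weakDeriv hj).localize hT hn
  have hv := fun t (ht : t ∈ Ioo (leftPt T k n) (rightPt T k n)) => congrArg (u t - ·)
    (waveletApprox_of_mem hν hγ hT hk M u hn (Ioo_subset_Ico_self ht))
  rw [leftPt_eq hT hk, rightPt_eq hT hk] at hg hgm hv ⊢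
  rw [localWeight_eq] at hgm ⊢
  exact ⟨_, isWeakDeriv_local_error hs hv hg hj,
    memL2_local_error hν hγ hs (derivChain_transplant hν' hγ' hs hg hgm) _ hj⟩

/-- The sum over the subintervals of the squared norms of the derivatives of order `j` of the
error, for `j ≤ r`. -/
lemma sum_l2Norm_weakDeriv_error_sq_le (hν : -1 < ν) (hν' : ν < 1) (hγ : -1 < γ) (hγ' : γ < 1)
    (hT : 0 < T) (hk : 1 ≤ k) (hu : MemSobolev (waveletWeight ν γ T k) 0 T μ u) {j r : ℕ}
    (hjr : j ≤ r) (hr : r ≤ μ) {ρ : ℝ}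
    (h : ∀ G : ℕ → ℝ → ℝ, DerivChain ν γ μ G →
      l2Norm (jacobiWeight ν γ) (-1) 1 (projError ν γ (M + 1) j G) ≤
        ρ * Real.sqrt (∑ i ∈ Finset.Icc (min μ (M + 1)) μ,
          l2Norm (jacobiWeight ν γ) (-1) 1 (G i) ^ 2)) :
    ∑ n ∈ Finset.Icc 1 (2 ^ (k - 1)),
      l2Norm (localWeight ν γ T k n) (leftPt T k n) (rightPt T k n)
        (weakDeriv (leftPt T k n) (rightPt T k n) j
          (fun t => u t - waveletApprox ν γ T k M u t)) ^ 2 ≤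
      ρ ^ 2 * (max T T⁻¹) ^ (2 * μ) * waveletSeminorm ν γ T k r μ M u ^ 2 := by
  have hs := two_pow_div_pos hT k
  calc _ ≤ ∑ n ∈ Finset.Icc 1 (2 ^ (k - 1)), ρ ^ 2 * ∑ i ∈ Finset.Icc (min μ (M + 1)) μ,
        ((2 : ℝ) ^ k / T) ^ (2 * (j : ℤ) - 2 * (i : ℤ)) *
          l2Norm (localWeight ν γ T k n) (leftPt T k n) (rightPt T k n)
            (weakDeriv 0 T i u) ^ 2 := by
        refine Finset.sum_le_sum fun n hn => ?_
        have hg := fun j (hj : j ≤ μ) => isWeakDeriv_subinterval hT (hu.isWeakDeriv hj) hn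
        have hgm := fun j (hj : j ≤ μ) => (hu.memL2_weakDeriv hj).localize hT hn
        have hv := fun t (ht : t ∈ Ioo (leftPt T k n) (rightPt T k n)) => congrArg (u t - ·)
          (waveletApprox_of_mem hν hγ hT hk M u hn (Ioo_subset_Ico_self ht))
        rw [leftPt_eq hT hk, rightPt_eq hT hk] at hg hgm hv ⊢
        rw [localWeight_eq] at hgm ⊢
        exact l2Norm_weakDeriv_local_error_sq_le hs hv hg (hjr.trans hr) _
          (h _ (derivChain_transplant hν' hγ' hs hg hgm))
    _ = ρ ^ 2 * ∑ i ∈ Finset.Icc (min μ (M + 1)) μ,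
        ((2 : ℝ) ^ k / T) ^ (2 * (j : ℤ) - 2 * (i : ℤ)) *
          l2Norm (waveletWeight ν γ T k) 0 T (weakDeriv 0 T i u) ^ 2 := by
        rw [← Finset.mul_sum, Finset.sum_comm]
        congr 1
        refine Finset.sum_congr rfl fun i hi => ?_
        rw [← Finset.mul_sum,
          l2Norm_sq_eq_sum hT hk (hu.memL2_weakDeriv (Finset.mem_Icc.1 hi).2)]
    _ ≤ _ := by
        rw [waveletSeminorm_sq, mul_assoc, Finset.mul_sum _ _ ((max T T⁻¹) ^ (2 * μ))]
        refine mul_le_mul_of_nonneg_left (Finset.sum_le_sum fun i hi => ?_) (sq_nonneg _)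
        rw [← mul_assoc]
        exact mul_le_mul_of_nonneg_right
          (two_pow_div_zpow_le hT k hjr hr (Finset.mem_Icc.1 hi).2) (sq_nonneg _)

/-- Both error estimates at once, with a constant independent of `k` and `M`. -/
lemma exists_error_le (hν : -1 < ν) (hν' : ν < 1) (hγ : -1 < γ) (hγ' : γ < 1) (hT : 0 < T)
    (μ : ℕ) :
    ∃ C : ℝ, 0 < C ∧ ∀ k M : ℕ, 1 ≤ k → 1 ≤ M → ∀ u : ℝ → ℝ,
      MemSobolev (waveletWeight ν γ T k) 0 T μ u →
        l2Norm (waveletWeight ν γ T k) 0 T (fun t => u t - waveletApprox ν γ T k M u t) ≤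
          C * approxRate μ M 0 * waveletSeminorm ν γ T k 0 μ M u ∧
        ∀ r ≤ μ, brokenSobolevNorm ν γ T k r (fun t => u t - waveletApprox ν γ T k M u t) ≤
          C * approxRate μ M r * waveletSeminorm ν γ T k r μ M u := by
  obtain ⟨K, hK0, hK⟩ := exists_projError_le_approxRate hν hγ μ
  set B : ℝ := (max T T⁻¹) ^ μ with hB
  have hB0 : 0 < B := pow_pos (hT.trans_le (le_max_left _ _)) _
  have hB2 : (max T T⁻¹) ^ (2 * μ) = B ^ 2 := by rw [hB, ← pow_mul, mul_comm]
  have hm : (1 : ℝ) ≤ Real.sqrt (μ + 1) := Real.one_le_sqrt.2 (by linarith [μ.cast_nonneg (α := ℝ)])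
  -- `K` is the reference constant, `B` absorbs the powers of `T`, and `√(μ+1)` the at most `μ + 1`
  -- orders in the Sobolev norm. The added `1` makes the constant positive even if `K = 0`.
  refine ⟨K * B * Real.sqrt (μ + 1) + 1, by positivity, fun k M hk hM u hu => ?_⟩
  have main := fun {j r : ℕ} (hjr : j ≤ r) (hr : r ≤ μ) =>
    sum_l2Norm_weakDeriv_error_sq_le (M := M) hν hν' hγ hγ' hT hk hu hjr hr
      fun G hG => hK M hM G hG j (hjr.trans hr)
  have hS : ∀ r, 0 ≤ waveletSeminorm ν γ T k r μ M u := fun r => Real.sqrt_nonneg _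
  have hR := approxRate_nonneg μ M
  have hb := memBrokenSobolev_sub_waveletApprox (M := M) hν hν' hγ hγ' hT hk hu
  have fin : ∀ r, K * B * Real.sqrt (μ + 1) * approxRate μ M r *
      waveletSeminorm ν γ T k r μ M u ≤
      (K * B * Real.sqrt (μ + 1) + 1) * approxRate μ M r * waveletSeminorm ν γ T k r μ M u := by
    intro r
    have := hS r
    have := hR r
    gcongr
    linarith
  constructor
  · refine le_trans (abs_le_of_sq_le_sq' ?_ ?_).2 (fin 0)
    · have hm : MemL2 (waveletWeight ν γ T k) 0 T (fun t => u t - waveletApprox ν γ T k M u t) :=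
        memL2_sub_waveletSum hν hγ hT hk hu.memL2 M _
      rw [l2Norm_sq_eq_sum hT hk hm]
      -- `weakDeriv` of order zero is a chosen representative, equal to the error almost everywhere
      -- only.
      have e : ∀ n ∈ Finset.Icc 1 (2 ^ (k - 1)),
          l2Norm (localWeight ν γ T k n) (leftPt T k n) (rightPt T k n)
            (fun t => u t - waveletApprox ν γ T k M u t) ^ 2 =
          l2Norm (localWeight ν γ T k n) (leftPt T k n) (rightPt T k n)
            (weakDeriv (leftPt T k n) (rightPt T k n) 0
              (fun t => u t - waveletApprox ν γ T k M u t)) ^ 2 := fun n hn => by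
        rw [l2Norm_congr_ae ((hb n hn).isWeakDeriv (Nat.zero_le _)).ae_eq_of_zero]
      refine (Finset.sum_congr rfl e).trans_le ((main le_rfl (Nat.zero_le _)).trans ?_)
      rw [hB2]
      calc _ = (K * B * 1 * approxRate μ M 0 * waveletSeminorm ν γ T k 0 μ M u) ^ 2 := by ring
        _ ≤ _ := by
          have := hS 0
          have := hR 0
          gcongr
    · have := hS 0
      have := hR 0
      positivity
  · intro r hr
    have hSr := hS r
    have hRr := hR r
    refine le_trans (Real.sqrt_le_iff.2 ⟨by positivity, ?_⟩) (fin r)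
    have e : ∀ n, sobolevNorm (localWeight ν γ T k n) (leftPt T k n) (rightPt T k n) r
        (fun t => u t - waveletApprox ν γ T k M u t) ^ 2 = ∑ j ∈ Finset.range (r + 1),
        l2Norm (localWeight ν γ T k n) (leftPt T k n) (rightPt T k n)
          (weakDeriv (leftPt T k n) (rightPt T k n) j
            (fun t => u t - waveletApprox ν γ T k M u t)) ^ 2 := fun n =>
      Real.sq_sqrt (Finset.sum_nonneg fun _ _ => sq_nonneg _)
    rw [Finset.sum_congr rfl fun n _ => e n, Finset.sum_comm]
    calc _ ≤ ∑ j ∈ Finset.range (r + 1), (K * approxRate μ M r) ^ 2 * B ^ 2 *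
          waveletSeminorm ν γ T k r μ M u ^ 2 := by
          refine Finset.sum_le_sum fun j hj => ?_
          have hjr : j ≤ r := by rw [Finset.mem_range] at hj; omega
          refine (main hjr hr).trans ?_
          rw [hB2]
          have := approxRate_mono μ hM hjr
          have := hR j
          gcongr
      _ = ((r : ℝ) + 1) * (K * B * approxRate μ M r * waveletSeminorm ν γ T k r μ M u) ^ 2 := by
          rw [Finset.sum_const, Finset.card_range, nsmul_eq_mul]
          push_cast
          ring
      _ ≤ ((μ : ℝ) + 1) * (K * B * approxRate μ M r * waveletSeminorm ν γ T k r μ M u) ^ 2 := by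
          gcongr
      _ = _ := by
          have : Real.sqrt ((μ : ℝ) + 1) ^ 2 = μ + 1 := Real.sq_sqrt (by positivity)
          simp only [mul_pow, this]
          ring

lemma waveletSeminorm_eq (hμ : μ ≤ M + 1) (r : ℕ) :
    waveletSeminorm ν γ T k r μ M u = ((2 : ℝ) ^ k) ^ ((r : ℝ) - μ) *
      l2Norm (waveletWeight ν γ T k) 0 T (weakDeriv 0 T μ u) := by
  rw [waveletSeminorm, min_eq_left hμ, Finset.Icc_self, Finset.sum_singleton]
  have h2 : (0 : ℝ) < 2 ^ k := by positivity
  have e : ((2 : ℝ) ^ k) ^ (2 * (r : ℤ) - 2 * (μ : ℤ)) = (((2 : ℝ) ^ k) ^ ((r : ℝ) - μ)) ^ 2 := by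
    rw [← Real.rpow_natCast _ 2, ← Real.rpow_mul h2.le, ← Real.rpow_intCast]
    congr 1
    push_cast
    ring
  rw [e, ← mul_pow, Real.sqrt_sq (mul_nonneg (by positivity) (l2Norm_nonneg _ _ _ _))]

end Wavelets

end

end JacobiWavelet

/-! ### Assembly of the theorem -/

theorem theorem3p1 (ν γ T : ℝ) (hν : -1 < ν) (hν' : ν < 1) (hγ : -1 < γ) (hγ' : γ < 1)
    (hT : 0 < T) (μ : ℕ) :
    ∃ C : ℝ, 0 < C ∧ ∀ k M : ℕ, 1 ≤ k → 1 ≤ M → ∀ u : ℝ → ℝ,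
      MemSobolev (waveletWeight ν γ T k) 0 T μ u →
        -- the truncated expansion is the best approximation by wavelets
        (∀ c : ℕ → ℕ → ℝ,
          l2Norm (waveletWeight ν γ T k) 0 T (fun t => u t - waveletApprox ν γ T k M u t) ≤
            l2Norm (waveletWeight ν γ T k) 0 T (fun t => u t - waveletSum ν γ T k M c t)) ∧
        -- the error lies in the spaces whose norms are estimated
        MemL2 (waveletWeight ν γ T k) 0 T (fun t => u t - waveletApprox ν γ T k M u t) ∧
        MemBrokenSobolev ν γ T k μ (fun t => u t - waveletApprox ν γ T k M u t) ∧
        -- weighted L² estimate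
        l2Norm (waveletWeight ν γ T k) 0 T (fun t => u t - waveletApprox ν γ T k M u t) ≤
          C * (M : ℝ) ^ (-(μ : ℝ)) * waveletSeminorm ν γ T k 0 μ M u ∧
        -- weighted Sobolev estimate
        (∀ r : ℕ, 1 ≤ r → r ≤ μ →
          brokenSobolevNorm ν γ T k r (fun t => u t - waveletApprox ν γ T k M u t) ≤
            C * (M : ℝ) ^ (2 * (r : ℝ) - 1 / 2 - μ) * waveletSeminorm ν γ T k r μ M u) ∧
        -- the case `M ≥ μ - 1`: value of the seminorm and explicit rates
        (μ ≤ M + 1 →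
          (∀ r : ℕ, r ≤ μ →
            waveletSeminorm ν γ T k r μ M u =
              ((2 : ℝ) ^ k) ^ ((r : ℝ) - μ) *
                l2Norm (waveletWeight ν γ T k) 0 T (weakDeriv 0 T μ u)) ∧
          l2Norm (waveletWeight ν γ T k) 0 T (fun t => u t - waveletApprox ν γ T k M u t) ≤
            C * (M : ℝ) ^ (-(μ : ℝ)) * (2 : ℝ) ^ (-((μ : ℝ) * k)) *
              l2Norm (waveletWeight ν γ T k) 0 T (weakDeriv 0 T μ u) ∧
          (∀ r : ℕ, 1 ≤ r → r ≤ μ →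
            brokenSobolevNorm ν γ T k r (fun t => u t - waveletApprox ν γ T k M u t) ≤
              C * (M : ℝ) ^ (2 * (r : ℝ) - 1 / 2 - μ) * ((2 : ℝ) ^ k) ^ ((r : ℝ) - μ) *
                l2Norm (waveletWeight ν γ T k) 0 T (weakDeriv 0 T μ u))) := by
  obtain ⟨C, hC, h⟩ := exists_error_le hν hν' hγ hγ' hT μ
  refine ⟨C, hC, fun k M hk hM u hu => ?_⟩
  obtain ⟨h0, hr⟩ := h k M hk hM u hu
  have hr' : ∀ r : ℕ, 1 ≤ r → r ≤ μ →
      brokenSobolevNorm ν γ T k r (fun t => u t - waveletApprox ν γ T k M u t) ≤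
        C * (M : ℝ) ^ (2 * (r : ℝ) - 1 / 2 - μ) * waveletSeminorm ν γ T k r μ M u := by
    intro r h1 h2
    have := hr r h2
    rwa [approxRate, if_neg (by omega)] at this
  rw [approxRate, if_pos rfl] at h0
  refine ⟨l2Norm_sub_waveletApprox_le hν hγ hT hk hu.memL2 M,
    memL2_sub_waveletSum hν hγ hT hk hu.memL2 M _,
    memBrokenSobolev_sub_waveletApprox hν hν' hγ hγ' hT hk hu, h0, hr', fun hμ =>
    ⟨fun r _ => waveletSeminorm_eq hμ r, ?_, fun r h1 h2 => ?_⟩⟩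
  · rw [waveletSeminorm_eq hμ, ← Real.rpow_natCast, ← Real.rpow_mul (by norm_num),
      ← mul_assoc] at h0
    convert h0 using 4
    push_cast
    ring
  · have := hr' r h1 h2
    rwa [waveletSeminorm_eq hμ, ← mul_assoc] at this
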